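/- **Setting.** Let $S$ be a smooth manifold diffeomorphic to $\mathbb{R}^3$, let $C^\infty=C^\infty(\mathbb{R}\times S,\mathbb{R})$, and let $D_0=\partial/\partial t$ be the partial derivative along the first factor. Let $W$ be the free $C^\infty$-module with basis $\theta_0,\theta_1,\theta_2,\theta_3$, with the inner product for which this basis is orthonormal of signature $-+++$. Let $\mathrm{CDerEnd}(W)$ be the Lie algebroid of first order operators $\delta:W\to W$, $\delta(fw)=f\delta(w)+X(f)w$ with $X\in\mathrm{Der}(C^\infty)$, that preserve the inner product up to a factor in $C^\infty$. Elements $X\in\mathrm{Der}(C^\infty)$ are viewed as elements of $\mathrm{CDerEnd}(W)$ that annihilate all $\theta_a$. Let $\sigma_0=\mathbb{1}_W$; for $i=1,2,3$ let $\sigma_i\theta_0=\theta_i$, $\sigma_i\theta_i=\theta_0$, and $\sigma_i=0$ on the other basis elements; and let $\sigma_{ij}=[\sigma_i,\sigma_j]$, so $\sigma_{ij}\theta_j=\theta_i$, $\sigma_{ij}\theta_i=-\theta_j$. Let $\mathcal{L}=\wedge W\otimes_{C^\infty}\mathrm{CDerEnd}(W)$, a real graded Lie algebra (gLa) with $$[\omega\delta,\omega'\delta']=\omega\omega'[\delta,\delta']+\omega\,\delta(\omega')\,\delta'-(-1)^{|\omega||\omega'|}\omega'\delta'(\omega)\,\delta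 ,$$ let $I\subset\mathcal{L}$ be the ideal given by the $\wedge W$-submodule generated by the algebraic Weyl tensors in $\wedge^2W\otimes\mathfrak{so}(W)$, and let $\mathcal{E}=\mathcal{L}/I$. It acts on $\wedge W$ and on $\wedge W\otimes\wedge^4W$. Products of $\theta$'s are wedge products, and cyclic $(i,j,k)$ means $(1,2,3)$, $(2,3,1)$, $(3,1,2)$. *Filtration.* For an orthogonal decomposition $W=W_0\oplus W_1$ let $F_{\lhd q}(\wedge W)$ be spanned by the monomials in the basis elements whose degree in the basis elements of $W_1$ is $\le q$ and has the parity of $q$; similarly for $\wedge W\otimes\wedge^4W$ (the factor $\wedge^4 W$ has no effect on the index). Let $F_{\lhd p}\mathcal{E}$ be the set of elements of $\mathbb{Z}_2$-degree $p \bmod 2$ (for the $\mathbb{Z}_2$-grading of $\mathcal{E}$ induced by $W=W_0\oplus W_1$) that map $F_{\lhd q}$ to $F_{\lhd q+p}$ for all $q$ in both representations, and let $F_p\mathcal{E}=F_{\lhd p}\mathcal{E}+F_{\lhd p-1}\mathcal{E}$. Let $F,F',F''$ be these filtrations for $W_0$ spanned by $\{\theta_0,\theta_1\}$, $\{\theta_0,\theta_2\}$,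 $\{\theta_0,\theta_3\}$ and $W_1$ spanned by the respective other two basis elements. For $\alpha=p_1p_2p_3\in\mathbb{Z}_{\ge0}^3$ set $F_\alpha\mathcal{E}=F_{p_1}\mathcal{E}\cap F'_{p_2}\mathcal{E}\cap F''_{p_3}\mathcal{E}$. *The graded Lie algebras.* With formal symbols $s_1,s_2,s_3$ and $s^\alpha=s_1^{p_1}s_2^{p_2}s_3^{p_3}$, let $\mathcal{P}_{\rm free}=\{\sum_\alpha s^\alpha x_\alpha\mid x_\alpha\in F_\alpha\mathcal{E}\}\subset\mathcal{E}[[s_1,s_2,s_3]]$ and $\mathcal{A}_{\rm free}=\mathcal{P}_{\rm free}/(s_1,s_2,s_3)$. *The pieces.* Let $G_\alpha\mathcal{E}_G\subset\mathcal{E}$ be the $C^\infty$-span of the following elements, for all cyclic $(i,j,k)$, with $e_1=100$, $e_2=010$, $e_3=001$, and where $X$ runs over $\mathrm{Der}(C^\infty)$; for all other $\alpha$ set $G_\alpha\mathcal{E}_G=0$. * $\alpha=000$: $X$; $\sigma_0$; $\theta_0\sigma_0+\theta_l\sigma_l$ ($l=1,2,3$); $\theta_2\theta_3\sigma_{23}+\theta_3\theta_1\sigma_{31}+\theta_1\theta_2\sigma_{12}+2\sum_{l=1}^3\theta_0\theta_l\sigma_l$.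 * $\alpha=2e_i$: $-\theta_i\sigma_{jk}+\theta_j\sigma_{ki}+\theta_k\sigma_{ij}$. * $\alpha=e_j+e_k$: $\sigma_i$; $\sigma_{jk}$; $\theta_iX$; $\theta_0\sigma_i+\theta_i\sigma_0$; $\theta_j\sigma_k+\theta_k\sigma_j$; $\theta_k\sigma_{ki}$; $\theta_j\sigma_{ij}$; $\theta_0\theta_j\sigma_{ij}+\theta_i\theta_j\sigma_j$. * $\alpha=2e_i+e_j+e_k$: $\theta_j\sigma_k-\theta_k\sigma_j$; $\theta_j\theta_kX$; $\theta_0\theta_j\sigma_k-\theta_0\theta_k\sigma_j-2\theta_j\theta_k\sigma_0$; $\theta_0\theta_j\sigma_k+\theta_0\theta_k\sigma_j-2\theta_i\theta_j\sigma_{ki}$. * $\alpha=222$: $\sum_{\rm cyclic}(\theta_0\theta_i\sigma_{jk}-2\theta_j\theta_k\sigma_i)$; $\theta_1\theta_2\theta_3X$; $\sum_{\rm cyclic}\theta_0\theta_j\theta_k\sigma_i+3\theta_1\theta_2\theta_3\sigma_0$. Let $G_\alpha\mathcal{E}=G_\alpha\mathcal{E}_G\oplus\theta_0G_\alpha\mathcal{E}_G$.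 One has $G_\alpha\mathcal{E}\subset F_\alpha\mathcal{E}$. Let $G_\alpha\mathcal{A}_{\rm free}$ and $(G_\alpha\mathcal{A}_{\rm free})_G$ be the sets of classes of $s^\alpha G_\alpha\mathcal{E}$ and $s^\alpha G_\alpha\mathcal{E}_G$ in $\mathcal{A}_{\rm free}$, let an upper index $0,1,\dots$ denote the part of that degree in $\wedge W$, and let $\mathcal{A}^1_{{\rm free},G}=\bigoplus_\alpha (G_\alpha\mathcal{A}^1_{\rm free})_G$. Every element of the affine gauge subspace $\theta_0D_0+\mathcal{A}^1_{{\rm free},G}\subset\mathcal{A}_{\rm free}^1$ is uniquely of the form $\theta_0D_0-\sum_{l=1}^3\gamma_l^0(\theta_0\sigma_0+\theta_l\sigma_l)+(\text{an element of }\bigoplus_{\alpha\ne000}(G_\alpha\mathcal{A}^1_{\rm free})_G)$ with $\gamma_1^0,\gamma_2^0,\gamma_3^0\in C^\infty$; this defines its functions $\gamma_l^0$. **Lemma.** Every $x\in\bigoplus_{\alpha\ne000}G_\alpha\mathcal{A}_{\rm free}^0$ generates a nilpotent automorphism $\exp([x,-])$ of the gLa $\mathcal{A}_{\rm free}$: the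 operator $[x,-]$ is nilpotent and its exponential is an automorphism of the real gLa $\mathcal{A}_{\rm free}$. It need not preserve the $\alpha$-grading: for some such $x$ there are $\alpha$ and $y\in G_\alpha\mathcal{A}_{\rm free}$ with $\exp([x,-])y\notin G_\alpha\mathcal{A}_{\rm free}$. Every such automorphism is induced by an $\mathbb{R}[[s_1,s_2,s_3]]$-linear automorphism of the gLa $\mathcal{P}_{\rm free}$. In particular, for all $f\in C^\infty$ and all cyclic $(i,j,k)$: (i) $x=f s_js_k\sigma_i$ is such an element, and $\exp([f s_js_k\sigma_i,-])$ is $C^\infty$-linear and acts as \begin{align*} \theta_0D_0&\mapsto\theta_0D_0-s_js_kD_0(f)\theta_0\sigma_i+s_js_kf\theta_iD_0\\ \theta_0\sigma_0+\theta_i\sigma_i&\mapsto\theta_0\sigma_0+\theta_i\sigma_i+s_js_kf(\theta_0\sigma_i+\theta_i\sigma_0)\\ \theta_0\sigma_0+\theta_j\sigma_j&\mapsto\theta_0\sigma_0+\theta_j\sigma_j+s_js_kf(\theta_i\sigma_0+\theta_j\sigma_{ij})\\ \theta_0\sigma_0+\theta_k\sigma_k&\mapsto\theta_0\sigma_0+\theta_k\sigma_k+s_js_kf(\theta_i\sigma_0-\theta_k\sigma_{ki})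 \end{align*} It maps a given element of $\theta_0D_0+\mathcal{A}^1_{{\rm free},G}$, with functions $\gamma_l^0$, back to this space if and only if $D_0(f)-(\gamma_j^0+\gamma_k^0)f=0$. If $\mu_1,\mu_2,\mu_3\in C^\infty$ satisfy $D_0(\mu_l)=\gamma_l^0$ for $l=1,2,3$, then an equivalent condition is $D_0(e^{-\mu_j-\mu_k}f)=0$. (ii) $x=f s_js_k\sigma_{jk}$ is such an element, and $\exp([f s_js_k\sigma_{jk},-])$ is $C^\infty$-linear and acts as \begin{align*} \theta_0D_0&\mapsto\theta_0D_0-s_js_kD_0(f)\theta_0\sigma_{jk}\\ \theta_0\sigma_0+\theta_i\sigma_i&\mapsto\theta_0\sigma_0+\theta_i\sigma_i\\ \theta_0\sigma_0+\theta_j\sigma_j&\mapsto\theta_0\sigma_0+\theta_j\sigma_j-s_js_kf(\theta_j\sigma_k+\theta_k\sigma_j)\\ \theta_0\sigma_0+\theta_k\sigma_k&\mapsto\theta_0\sigma_0+\theta_k\sigma_k+s_js_kf(\theta_j\sigma_k+\theta_k\sigma_j) \end{align*} It maps a given element of $\theta_0D_0+\mathcal{A}^1_{{\rm free},G}$ back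 to this space if and only if $D_0(f)=0$. -/

import Mathlib

noncomputable section

namespace BKL

open scoped TensorProduct

section Algebra

variable (R : Type*) [CommRing R] [Algebra ℝ R]

/-- The exterior algebra of the free module `W = R⁴`. -/
abbrev Ext : Type _ := ExteriorAlgebra R (Fin 4 → R)

/-- The conformally orthonormal basis `θ₀, θ₁, θ₂, θ₃` of `W`, inside the exterior algebra. -/
def theta (a : Fin 4) : Ext R := ExteriorAlgebra.ι R (Pi.single a 1)

/-- Signature `-+++`. -/
def eta : Fin 4 → R := ![-1, 1, 1, 1]

/-- Gram matrix of the basis `θ₀, θ₁, θ₂, θ₃` for the inner product of signature `-+++`. -/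
def gram : Matrix (Fin 4) (Fin 4) R := Matrix.diagonal (eta R)

variable {R}

/-- The ring of dual numbers `a + ε b` over the exterior algebra, on which `R` acts through
`f ↦ f + ε X(f)`. It is only used to extend derivations from `W` to the exterior algebra. -/
def Tw (_X : Derivation ℝ R R) : Type _ := TrivSqZeroExt (Ext R) (Ext R)

namespace Tw

variable {X : Derivation ℝ R R}

instance : Ring (Tw X) := inferInstanceAs (Ring (TrivSqZeroExt (Ext R) (Ext R)))

def mk (a b : Ext R) : Tw X := (a, b)

def fst (x : Tw X) : Ext R := TrivSqZeroExt.fst x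

def snd (x : Tw X) : Ext R := TrivSqZeroExt.snd x

@[ext] lemma ext {x y : Tw X} (h : x.fst = y.fst) (h' : x.snd = y.snd) : x = y :=
  TrivSqZeroExt.ext h h'

@[simp] lemma fst_mk (a b : Ext R) : (mk a b : Tw X).fst = a := rfl
@[simp] lemma snd_mk (a b : Ext R) : (mk a b : Tw X).snd = b := rfl
@[simp] lemma fst_zero : (0 : Tw X).fst = 0 := rfl
@[simp] lemma snd_zero : (0 : Tw X).snd = 0 := rfl
@[simp] lemma fst_one : (1 : Tw X).fst = 1 := rfl
@[simp] lemma snd_one : (1 : Tw X).snd = 0 := rfl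
@[simp] lemma fst_add (x y : Tw X) : (x + y).fst = x.fst + y.fst := rfl
@[simp] lemma snd_add (x y : Tw X) : (x + y).snd = x.snd + y.snd := rfl
@[simp] lemma fst_mul (x y : Tw X) : (x * y).fst = x.fst * y.fst := rfl
@[simp] lemma snd_mul (x y : Tw X) : (x * y).snd = x.fst * y.snd + x.snd * y.fst := rfl

/-- `f ↦ f + ε X(f)`. -/
def hom (X : Derivation ℝ R R) : R →+* Tw X where
  toFun f := mk (algebraMap R _ f) (algebraMap R _ (X f))
  map_one' := by ext <;> simp
  map_zero' := by ext <;> simp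
  map_add' f g := by ext <;> simp only [map_add, fst_add, fst_mk, snd_add, snd_mk]
  map_mul' f g := by
    ext
    · simp only [fst_mk, fst_mul, map_mul]
    · simp only [snd_mk, snd_mul, fst_mk, ← map_mul, ← map_add, Derivation.leibniz, smul_eq_mul,
        mul_comm]

instance : Algebra R (Tw X) :=
  RingHom.toAlgebra' (hom X) (fun f x => by
    ext
    · exact Algebra.commutes _ _
    · change algebraMap R (Ext R) _ * _ + algebraMap R (Ext R) _ * _ =
        _ * algebraMap R (Ext R) _ + _ * algebraMap R (Ext R) _
      rw [Algebra.commutes, Algebra.commutes, add_comm]; rfl)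

@[simp] lemma fst_algebraMap (f : R) : (algebraMap R (Tw X) f).fst = algebraMap R _ f := rfl
@[simp] lemma snd_algebraMap (f : R) : (algebraMap R (Tw X) f).snd = algebraMap R _ (X f) := rfl

end Tw

/-- An element `(X, M)` acts on `W = R⁴` by `w ↦ X(w) + M w`. -/
def actW (δ : Derivation ℝ R R × Matrix (Fin 4) (Fin 4) R) (w : Fin 4 → R) : Fin 4 → R :=
  (fun a => δ.1 (w a)) + δ.2.mulVec w

/-- `w ↦ w + ε δ(w)`. -/
def twLin (δ : Derivation ℝ R R × Matrix (Fin 4) (Fin 4) R) : (Fin 4 → R) →ₗ[R] Tw δ.1 where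
  toFun w := Tw.mk (ExteriorAlgebra.ι R w) (ExteriorAlgebra.ι R (actW δ w))
  map_add' v w := by
    have : actW δ (v + w) = actW δ v + actW δ w := by
      ext a; simp [actW, Matrix.mulVec_add]; ring
    ext <;> simp [this]
  map_smul' f w := by
    have : actW δ (f • w) = f • actW δ w + δ.1 f • w := by
      ext a; simp [actW, Matrix.mulVec_smul]; ring
    rw [RingHom.id_apply, Algebra.smul_def (A := Tw δ.1)]
    ext
    · rw [Tw.fst_mk, Tw.fst_mul, Tw.fst_algebraMap, map_smul, Tw.fst_mk, ← Algebra.smul_def]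
    · rw [Tw.snd_mk, Tw.snd_mul, Tw.fst_algebraMap, Tw.snd_algebraMap, this, map_add, map_smul,
        map_smul, Tw.fst_mk, Tw.snd_mk, ← Algebra.smul_def, ← Algebra.smul_def]

/-- `ω ↦ ω + ε δ(ω)`. -/
def twAlg (δ : Derivation ℝ R R × Matrix (Fin 4) (Fin 4) R) : Ext R →ₐ[R] Tw δ.1 :=
  ExteriorAlgebra.lift R ⟨twLin δ, fun w => by
    ext
    · exact ExteriorAlgebra.ι_sq_zero w
    · exact ExteriorAlgebra.ι_add_mul_swap _ _⟩

lemma twAlg_ι (δ : Derivation ℝ R R × Matrix (Fin 4) (Fin 4) R) (w : Fin 4 → R) :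
    twAlg δ (ExteriorAlgebra.ι R w) =
      Tw.mk (ExteriorAlgebra.ι R w) (ExteriorAlgebra.ι R (actW δ w)) := by
  simp only [twAlg, ExteriorAlgebra.lift_ι_apply]; rfl

lemma twAlg_fst (δ : Derivation ℝ R R × Matrix (Fin 4) (Fin 4) R) (u : Ext R) :
    (twAlg δ u).fst = u := by
  induction u using ExteriorAlgebra.induction with
  | algebraMap r => rw [AlgHom.commutes, Tw.fst_algebraMap]
  | ι x => rw [twAlg_ι, Tw.fst_mk]
  | mul a b iha ihb => rw [map_mul, Tw.fst_mul, iha, ihb]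
  | add a b iha ihb => rw [map_add, Tw.fst_add, iha, ihb]

/-- The derivation of the exterior algebra induced by `δ = (X, M)`: it is determined by the
Leibniz rule, `f ↦ X(f)` on functions and `w ↦ X(w) + M w` on `W`, see the lemmas below. -/
def extDer (δ : Derivation ℝ R R × Matrix (Fin 4) (Fin 4) R) : Ext R →+ Ext R :=
  AddMonoidHom.mk' (fun u => (twAlg δ u).snd) (fun a b => by rw [map_add, Tw.snd_add])

lemma extDer_mul (δ : Derivation ℝ R R × Matrix (Fin 4) (Fin 4) R) (a b : Ext R) :
    extDer δ (a * b) = a * extDer δ b + extDer δ a * b := by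
  change (twAlg δ (a * b)).snd = a * (twAlg δ b).snd + (twAlg δ a).snd * b
  rw [map_mul, Tw.snd_mul, twAlg_fst, twAlg_fst]

lemma extDer_algebraMap (δ : Derivation ℝ R R × Matrix (Fin 4) (Fin 4) R) (f : R) :
    extDer δ (algebraMap R _ f) = algebraMap R _ (δ.1 f) := by
  change (twAlg δ (algebraMap R _ f)).snd = _
  rw [AlgHom.commutes, Tw.snd_algebraMap]

lemma extDer_ι (δ : Derivation ℝ R R × Matrix (Fin 4) (Fin 4) R) (w : Fin 4 → R) :
    extDer δ (ExteriorAlgebra.ι R w) = ExteriorAlgebra.ι R (actW δ w) := by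
  change (twAlg δ (ExteriorAlgebra.ι R w)).snd = _
  rw [twAlg_ι, Tw.snd_mk]

lemma extDer_smul_fun (δ : Derivation ℝ R R × Matrix (Fin 4) (Fin 4) R) (f : R) (u : Ext R) :
    extDer δ (f • u) = f • extDer δ u + δ.1 f • u := by
  rw [Algebra.smul_def, extDer_mul, extDer_algebraMap, ← Algebra.smul_def, ← Algebra.smul_def]

/-- Uniqueness of extensions to the exterior algebra. -/
lemma leibniz_ext {R : Type*} [CommRing R] (d d' : Ext R → Ext R)
    (ha : ∀ x y, d (x + y) = d x + d y) (ha' : ∀ x y, d' (x + y) = d' x + d' y)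
    (hm : ∀ x y, d (x * y) = x * d y + d x * y) (hm' : ∀ x y, d' (x * y) = x * d' y + d' x * y)
    (h0 : ∀ f : R, d (algebraMap R _ f) = d' (algebraMap R _ f))
    (h1 : ∀ w, d (ExteriorAlgebra.ι R w) = d' (ExteriorAlgebra.ι R w)) (u : Ext R) :
    d u = d' u := by
  induction u using ExteriorAlgebra.induction with
  | algebraMap r => exact h0 r
  | ι x => exact h1 x
  | mul a b iha ihb => rw [hm, hm', iha, ihb]
  | add a b iha ihb => rw [ha, ha', iha, ihb]

lemma extDer_add_left (δ δ' : Derivation ℝ R R × Matrix (Fin 4) (Fin 4) R) (u : Ext R) :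
    extDer (δ + δ') u = extDer δ u + extDer δ' u := by
  refine leibniz_ext (extDer (δ + δ')) (fun u => extDer δ u + extDer δ' u) (map_add _) ?_
    (extDer_mul _) ?_ ?_ ?_ u
  · intro x y; simp only [map_add]; abel
  · intro x y; simp only [extDer_mul, mul_add, add_mul]; abel
  · intro f; simp [extDer_algebraMap]
  · intro w
    simp only [extDer_ι, ← map_add]
    congr 1
    ext a; simp [actW, Matrix.add_mulVec]; ring

lemma extDer_smul_left (r : R) (δ : Derivation ℝ R R × Matrix (Fin 4) (Fin 4) R) (u : Ext R) :
    extDer (r • δ) u = r • extDer δ u := by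
  refine leibniz_ext (extDer (r • δ)) (fun u => r • extDer δ u) (map_add _) ?_
    (extDer_mul _) ?_ ?_ ?_ u
  · intro x y; simp only [map_add, smul_add]
  · intro x y; simp only [extDer_mul, smul_add, mul_smul_comm, smul_mul_assoc]
  · intro f; simp [extDer_algebraMap, Algebra.smul_def]
  · intro w
    simp only [extDer_ι, ← map_smul]
    congr 1
    ext a; simp [actW, Matrix.smul_mulVec]; ring

/-- Commutator of `(X, M)` and `(X', M')` as operators on `W`. -/
def bracketC (δ δ' : Derivation ℝ R R × Matrix (Fin 4) (Fin 4) R) :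
    Derivation ℝ R R × Matrix (Fin 4) (Fin 4) R :=
  (⁅δ.1, δ'.1⁆, δ'.2.map δ.1 - δ.2.map δ'.1 + (δ.2 * δ'.2 - δ'.2 * δ.2))

lemma actW_bracketC (δ δ' : Derivation ℝ R R × Matrix (Fin 4) (Fin 4) R) (w : Fin 4 → R) :
    actW (bracketC δ δ') w = actW δ (actW δ' w) - actW δ' (actW δ w) := by
  ext a
  simp only [actW, bracketC, Pi.add_apply, Pi.sub_apply, Matrix.add_mulVec, Matrix.sub_mulVec,
    Matrix.mulVec_add, ← Matrix.mulVec_mulVec, map_add, Derivation.commutator_apply]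
  simp only [Matrix.mulVec, dotProduct, map_sum, Derivation.leibniz, Matrix.map_apply, smul_eq_mul,
    Finset.sum_add_distrib]
  simp only [fun x y : R => mul_comm x (δ.1 y), fun x y : R => mul_comm x (δ'.1 y)]
  ring_nf

lemma extDer_bracketC (δ δ' : Derivation ℝ R R × Matrix (Fin 4) (Fin 4) R) (u : Ext R) :
    extDer (bracketC δ δ') u = extDer δ (extDer δ' u) - extDer δ' (extDer δ u) := by
  refine leibniz_ext (extDer (bracketC δ δ'))
    (fun u => extDer δ (extDer δ' u) - extDer δ' (extDer δ u)) (map_add _) ?_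
    (extDer_mul _) ?_ ?_ ?_ u
  · intro x y; simp only [map_add]; abel
  · intro x y; simp only [extDer_mul, map_add, mul_sub, sub_mul]; abel
  · intro f; simp [extDer_algebraMap, bracketC, Derivation.commutator_apply]
  · intro w
    simp only [extDer_ι, ← map_sub, actW_bracketC]

end Algebra

section Algebra2

variable (R : Type*) [CommRing R] [Algebra ℝ R]

/-- Conformal derivations of `W = R⁴`: pairs `(X, M)`, acting on `W` by `w ↦ X(w) + M w`, that
preserve the inner product of signature `-+++` up to a factor. -/
def CDerEnd : Submodule R (Derivation ℝ R R × Matrix (Fin 4) (Fin 4) R) where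
  carrier := {δ | ∃ c : R, gram R * δ.2 + δ.2.transpose * gram R = c • gram R}
  zero_mem' := ⟨0, by simp⟩
  add_mem' := by
    rintro δ δ' ⟨c, h⟩ ⟨c', h'⟩
    refine ⟨c + c', ?_⟩
    rw [add_smul, ← h, ← h', Prod.snd_add, Matrix.transpose_add]
    noncomm_ring
  smul_mem' := by
    rintro r δ ⟨c, h⟩
    refine ⟨r * c, ?_⟩
    rw [mul_smul, ← h, Prod.smul_snd, Matrix.transpose_smul, smul_add, Matrix.mul_smul,
      Matrix.smul_mul]

variable {R}

lemma eta_sq {R : Type*} [CommRing R] (a : Fin 4) : eta R a * eta R a = 1 := by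
  fin_cases a <;> simp [eta]

lemma der_eta (X : Derivation ℝ R R) (a : Fin 4) : X (eta R a) = 0 := by
  fin_cases a <;> simp [eta]

lemma conformal_map (X : Derivation ℝ R R) {c : R} {M : Matrix (Fin 4) (Fin 4) R}
    (h : gram R * M + M.transpose * gram R = c • gram R) :
    gram R * M.map X + (M.map X).transpose * gram R = X c • gram R := by
  ext a b
  have h1 := congrArg X (congrFun (congrFun h a) b)
  simp only [gram, Matrix.add_apply, Matrix.diagonal_mul, Matrix.mul_diagonal,
    Matrix.smul_apply, Matrix.transpose_apply, Matrix.map_apply, smul_eq_mul,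
    Matrix.diagonal_apply, map_add, Derivation.leibniz, der_eta] at h1 ⊢
  split_ifs at h1 ⊢ <;> simpa [mul_comm, der_eta] using h1

lemma bracketC_mem {δ δ' : Derivation ℝ R R × Matrix (Fin 4) (Fin 4) R}
    (h : δ ∈ CDerEnd R) (h' : δ' ∈ CDerEnd R) : bracketC δ δ' ∈ CDerEnd R := by
  obtain ⟨X, M⟩ := δ
  obtain ⟨X', M'⟩ := δ'
  obtain ⟨c, h⟩ := h
  obtain ⟨c', h'⟩ := h'
  refine ⟨X c' - X' c, ?_⟩
  have e1 := conformal_map X h'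
  have e2 := conformal_map X' h
  simp only at h h' e1 e2
  have k : gram R * M = c • gram R - M.transpose * gram R := eq_sub_of_add_eq h
  have k' : gram R * M' = c' • gram R - M'.transpose * gram R := eq_sub_of_add_eq h'
  have l : gram R * M * M' = c • (c' • gram R - M'.transpose * gram R) -
      M.transpose * (c' • gram R - M'.transpose * gram R) := by
    rw [k, sub_mul, Matrix.smul_mul, Matrix.mul_assoc, k']
  have l' : gram R * M' * M = c' • (c • gram R - M.transpose * gram R) -
      M'.transpose * (c • gram R - M.transpose * gram R) := by
    rw [k', sub_mul, Matrix.smul_mul, Matrix.mul_assoc, k]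
  simp only [bracketC, Matrix.transpose_add, Matrix.transpose_sub, Matrix.transpose_mul, mul_add,
    mul_sub, add_mul, sub_mul, sub_smul, ← e1, ← e2, ← Matrix.mul_assoc, l, l', Matrix.mul_smul,
    smul_sub, smul_comm c' c]
  abel

instance : Bracket (CDerEnd R) (CDerEnd R) := ⟨fun δ δ' => ⟨bracketC δ δ', bracketC_mem δ.2 δ'.2⟩⟩

lemma coe_bracket (δ δ' : CDerEnd R) :
    (⁅δ, δ'⁆ : CDerEnd R).1 = bracketC δ.1 δ'.1 := rfl

lemma matrix_map_add' (M M' : Matrix (Fin 4) (Fin 4) R) (X : Derivation ℝ R R) :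
    (M + M').map X = M.map X + M'.map X := by ext; simp

lemma bracket_add (δ δ' δ'' : CDerEnd R) : ⁅δ, δ' + δ''⁆ = ⁅δ, δ'⁆ + ⁅δ, δ''⁆ := by
  refine Subtype.ext (Prod.ext ?_ ?_)
  · exact lie_add _ _ _
  · ext a b
    simp [coe_bracket, bracketC, mul_add, add_mul]; ring

lemma add_bracket (δ δ' δ'' : CDerEnd R) : ⁅δ + δ', δ''⁆ = ⁅δ, δ''⁆ + ⁅δ', δ''⁆ := by
  refine Subtype.ext (Prod.ext ?_ ?_)
  · exact add_lie _ _ _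
  · ext a b
    simp [coe_bracket, bracketC, mul_add, add_mul]; ring

lemma bracket_smul (r : R) (δ δ' : CDerEnd R) : ⁅δ, r • δ'⁆ = r • ⁅δ, δ'⁆ + δ.1.1 r • δ' := by
  refine Subtype.ext (Prod.ext ?_ ?_)
  · ext f
    simp [coe_bracket, bracketC, Derivation.commutator_apply]
  · ext a b
    simp [coe_bracket, bracketC]; ring

lemma smul_bracket (r : R) (δ δ' : CDerEnd R) : ⁅r • δ, δ'⁆ = r • ⁅δ, δ'⁆ - δ'.1.1 r • δ := by
  refine Subtype.ext (Prod.ext ?_ ?_)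
  · ext f
    simp [coe_bracket, bracketC, Derivation.commutator_apply]
    try ring
  · ext a b
    simp [coe_bracket, bracketC]; ring

variable (R) in
/-- `L = ∧W ⊗ CDerEnd(W)`. -/
abbrev Lie : Type _ := Ext R ⊗[R] CDerEnd R

/-- `ω'δ' ↦ [δ, ω'δ'] = ω'[δ, δ'] + δ(ω')δ'`. -/
def lieL (δ : CDerEnd R) : Lie R →+ Lie R :=
  TensorProduct.liftAddHom
    (AddMonoidHom.mk' (fun u => AddMonoidHom.mk'
      (fun δ' => u ⊗ₜ[R] ⁅δ, δ'⁆ + extDer δ.1 u ⊗ₜ[R] δ')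
      (fun x y => by simp only [bracket_add, TensorProduct.tmul_add]; abel))
      (fun x y => by
        ext z; simp only [map_add, TensorProduct.add_tmul, AddMonoidHom.mk'_apply,
          AddMonoidHom.add_apply]; abel))
    (fun r u δ' => by
      simp only [AddMonoidHom.mk'_apply, extDer_smul_fun, bracket_smul, TensorProduct.add_tmul,
        TensorProduct.tmul_add, TensorProduct.smul_tmul]
      abel)

lemma lieL_tmul (δ : CDerEnd R) (u : Ext R) (δ' : CDerEnd R) :
    lieL δ (u ⊗ₜ[R] δ') = u ⊗ₜ[R] ⁅δ, δ'⁆ + extDer δ.1 u ⊗ₜ[R] δ' := rfl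

/-- `ω'δ' ↦ δ'(ω) ω'`. -/
def ract (u : Ext R) : Lie R →ₗ[R] Ext R :=
  TensorProduct.lift (LinearMap.mk₂ R (fun u' δ' => extDer δ'.1 u * u')
    (fun a b c => mul_add _ _ _) (fun r a b => by rw [mul_smul_comm])
    (fun a b c => by rw [Submodule.coe_add, extDer_add_left, add_mul])
    (fun r a b => by rw [Submodule.coe_smul, extDer_smul_left, smul_mul_assoc]))

lemma ract_tmul (u u' : Ext R) (δ' : CDerEnd R) :
    ract u (u' ⊗ₜ[R] δ') = extDer δ'.1 u * u' := rfl

/-- `[ωδ, -]`. -/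
def brOn (u : Ext R) (δ : CDerEnd R) : Lie R →+ Lie R :=
  AddMonoidHom.mk' (fun l => u • lieL δ l - ract u l ⊗ₜ[R] δ)
    (fun x y => by simp only [map_add, smul_add, TensorProduct.add_tmul]; abel)

lemma brOn_apply (u : Ext R) (δ : CDerEnd R) (l : Lie R) :
    brOn u δ l = u • lieL δ l - ract u l ⊗ₜ[R] δ := rfl

lemma brOn_tmul (u u' : Ext R) (δ δ' : CDerEnd R) :
    brOn u δ (u' ⊗ₜ[R] δ') =
      (u * u') ⊗ₜ[R] ⁅δ, δ'⁆ + (u * extDer δ.1 u') ⊗ₜ[R] δ' - (extDer δ'.1 u * u') ⊗ₜ[R] δ := by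
  rw [brOn_apply, lieL_tmul, ract_tmul, smul_add, TensorProduct.smul_tmul',
    TensorProduct.smul_tmul', smul_eq_mul, smul_eq_mul]

lemma lieHom_ext {A : Type*} [AddCommGroup A] {f g : Lie R →+ A}
    (h : ∀ u δ, f (u ⊗ₜ[R] δ) = g (u ⊗ₜ[R] δ)) : f = g := by
  ext l
  induction l using TensorProduct.induction_on with
  | zero => rw [map_zero, map_zero]
  | add a b ha hb => rw [map_add, map_add, ha, hb]
  | tmul u δ => exact h u δ

lemma brOn_add_right (u : Ext R) (δ δ' : CDerEnd R) :
    brOn u (δ + δ') = brOn u δ + brOn u δ' := by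
  refine lieHom_ext fun u' δ'' => ?_
  simp only [AddMonoidHom.add_apply, brOn_tmul, add_bracket, Submodule.coe_add, extDer_add_left,
    TensorProduct.tmul_add, TensorProduct.add_tmul, mul_add]
  abel

lemma brOn_add_left (u v : Ext R) (δ : CDerEnd R) :
    brOn (u + v) δ = brOn u δ + brOn v δ := by
  refine lieHom_ext fun u' δ'' => ?_
  simp only [AddMonoidHom.add_apply, brOn_tmul, map_add, add_mul, TensorProduct.add_tmul]
  abel

lemma brOn_smul (r : R) (u : Ext R) (δ : CDerEnd R) : brOn (r • u) δ = brOn u (r • δ) := by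
  refine lieHom_ext fun u' δ'' => ?_
  simp only [brOn_tmul, smul_bracket, Submodule.coe_smul, extDer_smul_left, extDer_smul_fun,
    TensorProduct.tmul_sub, TensorProduct.tmul_smul, smul_mul_assoc, mul_smul_comm, add_mul,
    TensorProduct.add_tmul, ← TensorProduct.smul_tmul']
  abel

/-- `δ ↦ [ωδ, -]`. -/
def brLeft (u : Ext R) : CDerEnd R →+ (Lie R →+ Lie R) :=
  AddMonoidHom.mk' (brOn u) (brOn_add_right u)

lemma brLeft_apply (u : Ext R) (δ : CDerEnd R) : brLeft u δ = brOn u δ := rfl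

lemma brLeft_add (u v : Ext R) : brLeft (u + v) = brLeft u + brLeft v := by
  refine AddMonoidHom.ext fun δ => ?_
  rw [AddMonoidHom.add_apply, brLeft_apply, brLeft_apply, brLeft_apply, brOn_add_left]

/-- The bracket of `L`, determined by
`[ωδ, ω'δ'] = ωω'[δ, δ'] + ωδ(ω')δ' - δ'(ω)ω'δ`, see `brAdd_tmul`. (For homogeneous `ω`, `ω'` the
last term is the usual `- (-1)^{|ω||ω'|} ω'δ'(ω)δ`.) -/
def brAdd : Lie R →+ Lie R →+ Lie R :=
  TensorProduct.liftAddHom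
    (AddMonoidHom.mk' brLeft brLeft_add)
    (fun r u δ => brOn_smul r u δ)

lemma brAdd_tmul' (u : Ext R) (δ : CDerEnd R) (l : Lie R) :
    brAdd (u ⊗ₜ[R] δ) l = u • lieL δ l - ract u l ⊗ₜ[R] δ := rfl

lemma brAdd_tmul (u u' : Ext R) (δ δ' : CDerEnd R) :
    brAdd (u ⊗ₜ[R] δ) (u' ⊗ₜ[R] δ') =
      (u * u') ⊗ₜ[R] ⁅δ, δ'⁆ + (u * extDer δ.1 u') ⊗ₜ[R] δ' - (extDer δ'.1 u * u') ⊗ₜ[R] δ :=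
  brOn_tmul u u' δ δ'

lemma extDer_smul_real (δ : Derivation ℝ R R × Matrix (Fin 4) (Fin 4) R) (c : ℝ) (u : Ext R) :
    extDer δ (c • u) = c • extDer δ u := by
  have := extDer_smul_fun δ (algebraMap ℝ R c) u
  rwa [δ.1.map_algebraMap, zero_smul, add_zero, algebraMap_smul, algebraMap_smul] at this

lemma brAdd_smul (c : ℝ) (x y : Lie R) : brAdd x (c • y) = c • brAdd x y := by
  induction x using TensorProduct.induction_on with
  | zero => simp
  | add a b ha hb => rw [map_add, AddMonoidHom.add_apply, ha, hb]; simp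
  | tmul u δ =>
    induction y using TensorProduct.induction_on with
    | zero => simp
    | add a b ha hb => rw [smul_add, map_add, ha, hb, map_add, smul_add]
    | tmul u' δ' =>
      simp only [TensorProduct.smul_tmul', brAdd_tmul, extDer_smul_real, smul_add, smul_sub,
        mul_smul_comm]

lemma smul_brAdd (c : ℝ) (x y : Lie R) : brAdd (c • x) y = c • brAdd x y := by
  induction x using TensorProduct.induction_on with
  | zero => simp
  | add a b ha hb => rw [smul_add, map_add, AddMonoidHom.add_apply, ha, hb]; simp
  | tmul u δ =>
    induction y using TensorProduct.induction_on with
    | zero => simp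
    | add a b ha hb => rw [map_add, ha, hb, map_add, smul_add]
    | tmul u' δ' =>
      simp only [TensorProduct.smul_tmul', brAdd_tmul, extDer_smul_real, smul_add, smul_sub,
        smul_mul_assoc]

end Algebra2

section Algebra3

variable {R : Type*} [CommRing R] [Algebra ℝ R]

/-- The infinitesimal rotation `w ↦ θ_c ⟨θ_d, w⟩ - θ_d ⟨θ_c, w⟩`. -/
def rotMat {R : Type*} [CommRing R] (c d : Fin 4) : Matrix (Fin 4) (Fin 4) R :=
  Matrix.single c d (eta R d) - Matrix.single d c (eta R c)

lemma rotMat_apply {R : Type*} [CommRing R] (c d a b : Fin 4) :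
    rotMat (R := R) c d a b = (if a = c then (if b = d then eta R b else 0) else 0) -
      (if a = d then (if b = c then eta R b else 0) else 0) := by
  simp only [rotMat, Matrix.sub_apply, Matrix.single_apply]
  congr 1
  · split_ifs <;> simp_all
  · split_ifs <;> simp_all

lemma rotMat_mem (c d : Fin 4) : ((0 : Derivation ℝ R R), rotMat c d) ∈ CDerEnd R := by
  refine ⟨0, ?_⟩
  ext a b
  simp only [gram, Matrix.add_apply, Matrix.diagonal_mul, Matrix.mul_diagonal,
    Matrix.transpose_apply, rotMat_apply, zero_smul, Matrix.zero_apply]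
  grind

/-- The infinitesimal rotation as an element of `CDerEnd(W)`. -/
def rot (c d : Fin 4) : CDerEnd R := ⟨(0, rotMat c d), rotMat_mem c d⟩

/-- Algebraic Weyl tensors `C_{abcd}`: antisymmetric in `ab` and in `cd`, with the first Bianchi
identity, and trace-free. -/
structure IsWeyl (C : Fin 4 → Fin 4 → Fin 4 → Fin 4 → R) : Prop where
  swap₁ : ∀ a b c d, C b a c d = - C a b c d
  swap₂ : ∀ a b c d, C a b d c = - C a b c d
  bianchi : ∀ a b c d, C a b c d + C b c a d + C c a b d = 0
  trace : ∀ b d, ∑ a, eta R a * C a b a d = 0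

/-- The element `∑ C_{abcd} θ_aθ_b ⊗ (θ_c ∧ θ_d)` of `∧²W ⊗ so(W) ⊆ L`. -/
def weylElt (C : Fin 4 → Fin 4 → Fin 4 → Fin 4 → R) : Lie R :=
  ∑ a, ∑ b, ∑ c, ∑ d, C a b c d • ((theta R a * theta R b) ⊗ₜ[R] rot c d)

variable (R) in
/-- The ideal `I ⊆ L`: the `∧W`-submodule generated by the algebraic Weyl tensors. It lives in
degrees `2, 3, 4` and has rank `10 + 16 + 6`. -/
def weylIdeal : Submodule (Ext R) (Lie R) :=
  Submodule.span (Ext R) {l | ∃ C, IsWeyl C ∧ l = weylElt C}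

lemma extDer_theta (δ : Derivation ℝ R R × Matrix (Fin 4) (Fin 4) R) (b : Fin 4) :
    extDer δ (theta R b) = ∑ a, δ.2 a b • theta R a := by
  rw [theta, extDer_ι]
  have : actW δ (Pi.single b 1) = ∑ a, δ.2 a b • (Pi.single a 1 : Fin 4 → R) := by
    ext c
    have h0 : δ.1 (if c = b then 1 else 0) = 0 := by
      split_ifs <;> simp
    simp [actW, h0, Finset.sum_apply, Pi.single_apply]
  rw [this, map_sum]
  simp only [map_smul, theta]

/-- The change of `C` under the Lie derivative along `δ = (X, M)` with conformal factor `c`. -/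
def lieWeyl (X : Derivation ℝ R R) (M : Matrix (Fin 4) (Fin 4) R) (k : R)
    (C : Fin 4 → Fin 4 → Fin 4 → Fin 4 → R) : Fin 4 → Fin 4 → Fin 4 → Fin 4 → R :=
  fun a b c d => X (C a b c d) - k * C a b c d + ∑ e, (M a e * C e b c d + M b e * C a e c d +
    M c e * C a b e d + M d e * C a b c e)

lemma gram_entry {M : Matrix (Fin 4) (Fin 4) R} {k : R}
    (h : gram R * M + M.transpose * gram R = k • gram R) (a b : Fin 4) :
    eta R a * M a b + M b a * eta R b = if a = b then k * eta R a else 0 := by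
  have := congrFun (congrFun h a) b
  simpa [gram, Matrix.diagonal_mul, Matrix.mul_diagonal, Matrix.diagonal_apply] using this

lemma isWeyl_lieWeyl (X : Derivation ℝ R R) {M : Matrix (Fin 4) (Fin 4) R} {k : R}
    (h : gram R * M + M.transpose * gram R = k • gram R)
    {C : Fin 4 → Fin 4 → Fin 4 → Fin 4 → R} (hC : IsWeyl C) : IsWeyl (lieWeyl X M k C) where
  swap₁ a b c d := by
    have : ∀ e, (M b e * C e a c d + M a e * C b e c d + M c e * C b a e d + M d e * C b a c e) =
      - (M a e * C e b c d + M b e * C a e c d + M c e * C a b e d + M d e * C a b c e) := by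
      intro e
      rw [hC.swap₁ a e, hC.swap₁ e b, hC.swap₁ a b, hC.swap₁ a b]; ring
    simp only [lieWeyl, this, Finset.sum_neg_distrib]
    rw [hC.swap₁ a b, map_neg]; ring
  swap₂ a b c d := by
    have : ∀ e, (M a e * C e b d c + M b e * C a e d c + M d e * C a b e c + M c e * C a b d e) =
      - (M a e * C e b c d + M b e * C a e c d + M c e * C a b e d + M d e * C a b c e) := by
      intro e
      rw [hC.swap₂ e b c d, hC.swap₂ a e c d, hC.swap₂ a b c e, hC.swap₂ a b e d]; ring
    simp only [lieWeyl, this, Finset.sum_neg_distrib]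
    rw [hC.swap₂ a b c d, map_neg]; ring
  bianchi a b c d := by
    have h1 := congrArg X (hC.bianchi a b c d)
    have h2 := hC.bianchi a b c d
    simp only [map_add, map_zero] at h1
    have h3 : ∑ e, (M a e * C e b c d + M b e * C a e c d + M c e * C a b e d + M d e * C a b c e) +
      ∑ e, (M b e * C e c a d + M c e * C b e a d + M a e * C b c e d + M d e * C b c a e) +
      ∑ e, (M c e * C e a b d + M a e * C c e b d + M b e * C c a e d + M d e * C c a b e) = 0 := by
      rw [← Finset.sum_add_distrib, ← Finset.sum_add_distrib]
      refine Finset.sum_eq_zero fun e _ => ?_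
      linear_combination M a e * hC.bianchi e b c d + M b e * hC.bianchi a e c d +
        M c e * hC.bianchi a b e d + M d e * hC.bianchi a b c e
    simp only [lieWeyl]
    linear_combination h1 - k * h2 + h3
  trace b d := by
    have h1 := congrArg X (hC.trace b d)
    have h2 := hC.trace b d
    simp only [map_sum, Derivation.leibniz, der_eta, mul_zero, add_zero, smul_eq_mul,
      map_zero] at h1
    have h3 : ∀ (T : Fin 4 → Fin 4 → R), ∑ a, eta R a * ∑ e, (M a e * T e a + M a e * T a e) =
        k * ∑ a, eta R a * T a a := by
      intro T
      have : ∑ a, eta R a * ∑ e, (M a e * T e a + M a e * T a e) =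
          ∑ a, ∑ e, (eta R a * M a e + M e a * eta R e) * T a e := by
        simp only [Finset.mul_sum, add_mul, mul_add, Finset.sum_add_distrib]
        rw [add_comm]
        congr 1
        · simp only [mul_assoc]
        · rw [Finset.sum_comm]
          refine Finset.sum_congr rfl fun _ _ => Finset.sum_congr rfl fun _ _ => by ring
      rw [this, Finset.mul_sum]
      refine Finset.sum_congr rfl fun a _ => ?_
      simp only [gram_entry h, ite_mul, zero_mul, Finset.sum_ite_eq, Finset.mem_univ, if_true]
      ring
    have h4 := h3 (fun e a => C e b a d)
    have h5 : ∑ a, eta R a * ∑ e, (M b e * C a e a d) = 0 := by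
      simp only [Finset.mul_sum]
      rw [Finset.sum_comm]
      refine Finset.sum_eq_zero fun e _ => ?_
      have := hC.trace e d
      calc _ = M b e * ∑ a, eta R a * C a e a d := by
            rw [Finset.mul_sum]; exact Finset.sum_congr rfl fun _ _ => by ring
        _ = 0 := by rw [this, mul_zero]
    have h6 : ∑ a, eta R a * ∑ e, (M d e * C a b a e) = 0 := by
      simp only [Finset.mul_sum]
      rw [Finset.sum_comm]
      refine Finset.sum_eq_zero fun e _ => ?_
      have := hC.trace b e
      calc _ = M d e * ∑ a, eta R a * C a b a e := by
            rw [Finset.mul_sum]; exact Finset.sum_congr rfl fun _ _ => by ring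
        _ = 0 := by rw [this, mul_zero]
    have : ∑ a, eta R a * lieWeyl X M k C a b a d = ∑ a, eta R a * X (C a b a d)
        - k * ∑ a, eta R a * C a b a d + ∑ a, eta R a * ∑ e, (M a e * C e b a d + M a e * C a b e d)
        + ∑ a, eta R a * ∑ e, (M b e * C a e a d) + ∑ a, eta R a * ∑ e, (M d e * C a b a e) := by
      rw [Finset.mul_sum, ← Finset.sum_sub_distrib, ← Finset.sum_add_distrib,
        ← Finset.sum_add_distrib, ← Finset.sum_add_distrib]
      refine Finset.sum_congr rfl fun a _ => ?_
      simp only [lieWeyl, Finset.sum_add_distrib]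
      ring
    rw [this, h1, h2, h4, h5, h6, h2]
    ring

/-- Commutator of a conformal derivation with an infinitesimal rotation. -/
lemma bracket_rot (δ : CDerEnd R) {k : R}
    (h : gram R * δ.1.2 + δ.1.2.transpose * gram R = k • gram R) (c d : Fin 4) :
    ⁅δ, rot c d⁆ = ∑ e, (δ.1.2 e c • rot e d + δ.1.2 e d • rot c e) - k • rot (R := R) c d := by
  refine Subtype.ext (Prod.ext ?_ ?_)
  · simp [coe_bracket, bracketC, rot, Submodule.coe_sum, Prod.fst_sum]
  · ext a b
    have hg := gram_entry h
    have e1 : eta R d * δ.1.2 d b = (if d = b then k * eta R d else 0) - δ.1.2 b d * eta R b :=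
      eq_sub_of_add_eq (hg d b)
    have e2 : eta R c * δ.1.2 c b = (if c = b then k * eta R c else 0) - δ.1.2 b c * eta R b :=
      eq_sub_of_add_eq (hg c b)
    have e0 : δ.1.1 (rotMat c d a b) = 0 := by
      rw [rotMat_apply]; split_ifs <;> simp [der_eta]
    have l1 : (⁅δ, rot c d⁆ : CDerEnd R).1.2 a b =
        ∑ e, δ.1.2 a e * rotMat c d e b - ∑ e, rotMat c d a e * δ.1.2 e b := by
      simp [coe_bracket, bracketC, rot, e0, Matrix.mul_apply]
    have l2 : (∑ e, (δ.1.2 e c • rot e d + δ.1.2 e d • rot c e) - k • rot (R := R) c d).1.2 a b =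
        ∑ e, (δ.1.2 e c * rotMat e d a b + δ.1.2 e d * rotMat c e a b) - k * rotMat c d a b := by
      simp [rot, Prod.snd_sum, Matrix.sum_apply]
    rw [l1, l2]
    simp only [rotMat_apply, mul_sub, sub_mul, Finset.sum_sub_distrib, Finset.sum_add_distrib,
      mul_ite, ite_mul, mul_zero, zero_mul, Finset.sum_ite_eq, Finset.sum_ite_eq',
      Finset.mem_univ, if_true]
    have swap : ∀ (P : Prop) [Decidable P] (f : Fin 4 → R),
        (∑ x, if P then f x else 0) = if P then ∑ x, f x else 0 := by
      intro P _ f; split_ifs <;> simp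
    simp only [swap, Finset.sum_ite_eq, Finset.sum_ite_eq', Finset.mem_univ, if_true, e1, e2]
    have c1 : (d = b) ↔ (b = d) := eq_comm
    have c2 : (c = b) ↔ (b = c) := eq_comm
    simp only [c1, c2]
    clear h e0 l1 l2 hg e1 e2 c1 c2 swap
    split_ifs <;> subst_vars <;> first | ring1 | (exfalso; tauto)

lemma lieL_weylElt (δ : CDerEnd R) {k : R}
    (h : gram R * δ.1.2 + δ.1.2.transpose * gram R = k • gram R)
    (C : Fin 4 → Fin 4 → Fin 4 → Fin 4 → R) :
    lieL δ (weylElt C) = weylElt (lieWeyl δ.1.1 δ.1.2 k C) := by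
  have e1 : ∀ a b, extDer δ.1 (theta R a * theta R b) =
      ∑ e, (δ.1.2 e a • (theta R e * theta R b) + δ.1.2 e b • (theta R a * theta R e)) := by
    intro a b
    rw [extDer_mul, extDer_theta, extDer_theta, Finset.mul_sum, Finset.sum_mul,
      Finset.sum_add_distrib, add_comm]
    simp only [mul_smul_comm, smul_mul_assoc]
  have e2 : ∀ (f : R) (l : Lie R), lieL δ (f • l) = f • lieL δ l + δ.1.1 f • l := by
    intro f l
    induction l using TensorProduct.induction_on with
    | zero => simp
    | add a b ha hb => rw [smul_add, map_add, ha, hb, map_add, smul_add, smul_add]; abel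
    | tmul u δ' =>
      rw [TensorProduct.smul_tmul', lieL_tmul, lieL_tmul, extDer_smul_fun]
      simp only [TensorProduct.add_tmul, TensorProduct.smul_tmul', smul_add]
      abel
  have e3 : ∀ a b c d, lieL δ ((theta R a * theta R b) ⊗ₜ[R] rot c d) =
      ∑ e, (δ.1.2 e a • ((theta R e * theta R b) ⊗ₜ[R] rot c d) +
        δ.1.2 e b • ((theta R a * theta R e) ⊗ₜ[R] rot c d) +
        δ.1.2 e c • ((theta R a * theta R b) ⊗ₜ[R] rot e d) +
        δ.1.2 e d • ((theta R a * theta R b) ⊗ₜ[R] rot c e)) -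
      k • ((theta R a * theta R b) ⊗ₜ[R] rot c d) := by
    intro a b c d
    rw [lieL_tmul, bracket_rot δ h, e1, TensorProduct.tmul_sub, TensorProduct.tmul_sum,
      TensorProduct.sum_tmul]
    simp only [TensorProduct.add_tmul, TensorProduct.tmul_add, Finset.sum_add_distrib,
      TensorProduct.tmul_smul, ← TensorProduct.smul_tmul']
    abel
  have m : ∀ G : Fin 4 → Fin 4 → Fin 4 → Fin 4 → Lie R,
      ∑ b, ∑ c, ∑ d, ∑ e, G e b c d = ∑ e, ∑ b, ∑ c, ∑ d, G e b c d := by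
    intro G
    rw [Finset.sum_comm (s := Finset.univ) (t := Finset.univ) (f := fun e b => ∑ c, ∑ d, G e b c d)]
    refine Finset.sum_congr rfl fun b _ => ?_
    rw [Finset.sum_comm (s := Finset.univ) (t := Finset.univ) (f := fun e c => ∑ d, G e b c d)]
    refine Finset.sum_congr rfl fun c _ => ?_
    rw [Finset.sum_comm]
  have s1 : ∀ F : Fin 4 → Fin 4 → Fin 4 → Fin 4 → Fin 4 → Lie R,
      ∑ a, ∑ b, ∑ c, ∑ d, ∑ e, F a e b c d = ∑ a, ∑ b, ∑ c, ∑ d, ∑ e, F e a b c d := by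
    intro F
    calc _ = ∑ a, ∑ e, ∑ b, ∑ c, ∑ d, F a e b c d :=
          Finset.sum_congr rfl fun a _ => m (F a)
      _ = ∑ e, ∑ a, ∑ b, ∑ c, ∑ d, F a e b c d := Finset.sum_comm
      _ = _ := Finset.sum_congr rfl fun e _ => (m (fun a => F a e)).symm
  have s4 : ∀ F : Fin 4 → Fin 4 → Lie R, ∑ d, ∑ e, F d e = ∑ d, ∑ e, F e d :=
    fun F => Finset.sum_comm
  have s3 : ∀ F : Fin 4 → Fin 4 → Fin 4 → Lie R,
      ∑ c, ∑ d, ∑ e, F c e d = ∑ c, ∑ d, ∑ e, F e c d := by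
    intro F
    calc _ = ∑ c, ∑ e, ∑ d, F c e d := Finset.sum_congr rfl fun c _ => Finset.sum_comm
      _ = ∑ e, ∑ c, ∑ d, F c e d := Finset.sum_comm
      _ = _ := Finset.sum_congr rfl fun e _ => Finset.sum_comm
  have s2 : ∀ F : Fin 4 → Fin 4 → Fin 4 → Fin 4 → Lie R,
      ∑ b, ∑ c, ∑ d, ∑ e, F b e c d = ∑ b, ∑ c, ∑ d, ∑ e, F e b c d := by
    intro F
    have m' : ∀ G : Fin 4 → Fin 4 → Fin 4 → Lie R,
        ∑ c, ∑ d, ∑ e, G e c d = ∑ e, ∑ c, ∑ d, G e c d := by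
      intro G
      rw [Finset.sum_comm (s := Finset.univ) (t := Finset.univ) (f := fun e c => ∑ d, G e c d)]
      exact Finset.sum_congr rfl fun c _ => Finset.sum_comm
    calc _ = ∑ b, ∑ e, ∑ c, ∑ d, F b e c d := Finset.sum_congr rfl fun b _ => m' (F b)
      _ = ∑ e, ∑ b, ∑ c, ∑ d, F b e c d := Finset.sum_comm
      _ = _ := Finset.sum_congr rfl fun e _ => (m' (fun b => F b e)).symm
  simp only [weylElt, map_sum, e2, e3, lieWeyl, add_smul, sub_smul, Finset.sum_smul, smul_add,
    smul_sub, Finset.smul_sum, smul_smul, Finset.sum_add_distrib, Finset.sum_sub_distrib]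
  rw [s1 (fun a e b c d => (C a b c d * δ.1.2 e a) • ((theta R e * theta R b) ⊗ₜ[R] rot c d))]
  rw [Finset.sum_congr rfl fun a _ => s2 (fun b e c d => (C a b c d * δ.1.2 e b) •
    ((theta R a * theta R e) ⊗ₜ[R] rot c d))]
  rw [Finset.sum_congr rfl fun a _ => Finset.sum_congr rfl fun b _ =>
    s3 (fun c e d => (C a b c d * δ.1.2 e c) • ((theta R a * theta R b) ⊗ₜ[R] rot e d))]
  rw [Finset.sum_congr rfl fun a _ => Finset.sum_congr rfl fun b _ =>
    Finset.sum_congr rfl fun c _ =>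
    s4 (fun d e => (C a b c d * δ.1.2 e d) • ((theta R a * theta R b) ⊗ₜ[R] rot c e))]
  simp only [mul_comm (δ.1.2 _ _), mul_comm k]
  abel

lemma commute_ι_mul_ι (v w : Fin 4 → R) (u : Ext R) :
    u * (ExteriorAlgebra.ι R v * ExteriorAlgebra.ι R w) =
      (ExteriorAlgebra.ι R v * ExteriorAlgebra.ι R w) * u := by
  have key : ∀ x y : Fin 4 → R, ExteriorAlgebra.ι R x * ExteriorAlgebra.ι R y =
    - (ExteriorAlgebra.ι R y * ExteriorAlgebra.ι R x) := fun x y =>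
      eq_neg_of_add_eq_zero_left (ExteriorAlgebra.ι_add_mul_swap x y)
  induction u using ExteriorAlgebra.induction with
  | algebraMap r => exact Algebra.commutes _ _
  | ι x => rw [← mul_assoc, key x v, neg_mul, mul_assoc, key x w, mul_neg, neg_neg, mul_assoc]
  | mul a b iha ihb => rw [mul_assoc, ihb, ← mul_assoc, iha, mul_assoc]
  | add a b iha ihb => rw [add_mul, mul_add, iha, ihb]

lemma extDer_rot_weyl {C : Fin 4 → Fin 4 → Fin 4 → Fin 4 → R} (hC : IsWeyl C) (u : Ext R) :
    ∑ a, ∑ b, ∑ c, ∑ d, C a b c d • ((theta R a * theta R b) * extDer (rot (R := R) c d).1 u) = 0 := by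
  refine leibniz_ext (fun u => ∑ a, ∑ b, ∑ c, ∑ d, C a b c d •
    ((theta R a * theta R b) * extDer (rot (R := R) c d).1 u)) (fun _ => 0) ?_ (by simp) ?_
    (by simp) ?_ ?_ u
  · intro x y
    simp only [map_add, mul_add, smul_add, Finset.sum_add_distrib]
  · intro x y
    have : ∀ a b c d, C a b c d • ((theta R a * theta R b) * extDer (rot (R := R) c d).1 (x * y)) =
        x * (C a b c d • ((theta R a * theta R b) * extDer (rot (R := R) c d).1 y)) +
        (C a b c d • ((theta R a * theta R b) * extDer (rot (R := R) c d).1 x)) * y := by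
      intro a b c d
      rw [extDer_mul, mul_add, smul_add, mul_smul_comm, smul_mul_assoc, ← mul_assoc, ← mul_assoc,
        ← mul_assoc x, theta, theta, ← commute_ι_mul_ι]
    simp only [this, Finset.sum_add_distrib, Finset.mul_sum, Finset.sum_mul]
  · intro f
    simp only [extDer_algebraMap, rot, Derivation.zero_apply, map_zero, mul_zero, smul_zero,
      Finset.sum_const_zero]
  · intro w
    have e1 : ∀ c d, extDer (rot (R := R) c d).1 (ExteriorAlgebra.ι R w) =
        (eta R d * w d) • theta R c - (eta R c * w c) • theta R d := by
      intro c d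
      rw [extDer_ι]
      have : actW (rot (R := R) c d).1 w = (eta R d * w d) • (Pi.single c 1 : Fin 4 → R) -
          (eta R c * w c) • (Pi.single d 1 : Fin 4 → R) := by
        simp only [actW, rot, rotMat, Matrix.sub_mulVec, Matrix.single_mulVec]
        ext e
        simp [Pi.single_apply, Function.update_apply]
      rw [this, map_sub, map_smul, map_smul]; rfl
    have hT : ∀ a b c, theta R a * theta R b * theta R c = theta R b * theta R c * theta R a := by
      intro a b c
      rw [mul_assoc]; exact commute_ι_mul_ι _ _ _
    have rot3 : ∀ F : Fin 4 → Fin 4 → Fin 4 → Ext R,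
        ∑ a, ∑ b, ∑ c, F a b c = ∑ a, ∑ b, ∑ c, F b c a := by
      intro F
      rw [Finset.sum_comm]
      calc _ = ∑ b, ∑ c, ∑ a, F a b c := Finset.sum_congr rfl fun b _ => Finset.sum_comm
        _ = ∑ c, ∑ b, ∑ a, F a b c := Finset.sum_comm
        _ = _ := Finset.sum_congr rfl fun c _ => Finset.sum_comm
    have e2 : ∀ d, ∑ a, ∑ b, ∑ c, C a b c d • (theta R a * theta R b * theta R c) = 0 := by
      intro d
      set S := ∑ a, ∑ b, ∑ c, C a b c d • (theta R a * theta R b * theta R c) with hS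
      have r1 : S = ∑ a, ∑ b, ∑ c, C b c a d • (theta R a * theta R b * theta R c) := by
        rw [hS, rot3]
        simp only [← hT]
      have r2 : S = ∑ a, ∑ b, ∑ c, C c a b d • (theta R a * theta R b * theta R c) := by
        rw [r1, rot3]
        simp only [← hT]
      have : (3 : ℝ) • S = 0 := by
        have h3 : (3 : ℝ) • S = S + S + S := by
          rw [show (3 : ℝ) = 1 + 1 + 1 by norm_num, add_smul, add_smul, one_smul]
        rw [h3]
        nth_rw 3 [r2]
        nth_rw 2 [r1]
        rw [hS]
        simp only [← Finset.sum_add_distrib, ← add_smul, hC.bianchi, zero_smul,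
          Finset.sum_const_zero]
      rw [← one_smul ℝ S, show (1 : ℝ) = 3⁻¹ * 3 by norm_num, mul_smul, this, smul_zero]
    have e3 : ∀ a b, ∑ c, ∑ d, C a b c d • (theta R a * theta R b *
        ((eta R d * w d) • theta R c - (eta R c * w c) • theta R d)) =
        ∑ d, ∑ c, (2 * (eta R d * w d)) • (C a b c d • (theta R a * theta R b * theta R c)) := by
      intro a b
      simp only [mul_sub, smul_sub, Finset.sum_sub_distrib, mul_smul_comm]
      rw [sub_eq_iff_eq_add, Finset.sum_comm, ← Finset.sum_add_distrib]
      refine Finset.sum_congr rfl fun d _ => ?_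
      rw [← Finset.sum_add_distrib]
      refine Finset.sum_congr rfl fun c _ => ?_
      rw [hC.swap₂ a b c d, neg_smul, smul_smul, smul_smul, ← sub_eq_add_neg, ← sub_smul]
      congr 1; ring
    have e4 : ∀ a, ∑ b, ∑ d, ∑ c,
        (2 * (eta R d * w d)) • (C a b c d • (theta R a * theta R b * theta R c)) =
        ∑ d, ∑ b, ∑ c, (2 * (eta R d * w d)) • (C a b c d • (theta R a * theta R b * theta R c)) :=
      fun a => Finset.sum_comm
    simp only [e1, e3, e4]
    rw [Finset.sum_comm]
    refine Finset.sum_eq_zero fun d _ => ?_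
    simp only [← Finset.smul_sum, e2, smul_zero]

lemma extDer_theta_mul_comm (δ : Derivation ℝ R R × Matrix (Fin 4) (Fin 4) R) (a b : Fin 4)
    (u : Ext R) : u * extDer δ (theta R a * theta R b) = extDer δ (theta R a * theta R b) * u := by
  rw [extDer_mul, theta, theta, extDer_ι, extDer_ι, mul_add, add_mul, commute_ι_mul_ι,
    commute_ι_mul_ι]

lemma brAdd_weyl_right {C : Fin 4 → Fin 4 → Fin 4 → Fin 4 → R} (hC : IsWeyl C) (v : Ext R)
    (l : Lie R) : brAdd l (v • weylElt C) ∈ weylIdeal R := by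
  have hw : ∀ C : Fin 4 → Fin 4 → Fin 4 → Fin 4 → R, IsWeyl C → weylElt C ∈ weylIdeal R :=
    fun C hC => Submodule.subset_span ⟨C, hC, rfl⟩
  induction l using TensorProduct.induction_on with
  | zero => rw [map_zero]; exact zero_mem _
  | add a b ha hb => rw [map_add]; exact add_mem ha hb
  | tmul u δ =>
    obtain ⟨k, hk⟩ := δ.2
    have h1 : ract u (v • weylElt C) = 0 := by
      have := congrArg (· * v) (extDer_rot_weyl hC u)
      simp only [weylElt, Finset.smul_sum, map_sum, zero_mul, Finset.sum_mul] at this ⊢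
      rw [← this]
      refine Finset.sum_congr rfl fun a _ => Finset.sum_congr rfl fun b _ =>
        Finset.sum_congr rfl fun c _ => Finset.sum_congr rfl fun d _ => ?_
      rw [smul_comm, TensorProduct.smul_tmul', map_smul, ract_tmul, smul_eq_mul, smul_mul_assoc]
      congr 1
      rw [theta, theta, commute_ι_mul_ι, ← mul_assoc, commute_ι_mul_ι]
    have h2 : lieL δ (v • weylElt C) =
        v • weylElt (lieWeyl δ.1.1 δ.1.2 k C) + extDer δ.1 v • weylElt C := by
      rw [← lieL_weylElt δ hk]
      generalize weylElt C = l
      induction l using TensorProduct.induction_on with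
      | zero => simp
      | add a b ha hb => rw [smul_add, map_add, ha, hb, map_add, smul_add, smul_add]; abel
      | tmul u' δ' =>
        rw [TensorProduct.smul_tmul', lieL_tmul, lieL_tmul, smul_eq_mul, extDer_mul]
        simp only [TensorProduct.add_tmul, TensorProduct.smul_tmul', smul_add, smul_eq_mul]
        abel
    rw [brAdd_tmul', h1, TensorProduct.zero_tmul, sub_zero, h2]
    exact Submodule.smul_mem _ _ (add_mem
      (Submodule.smul_mem _ _ (hw _ (isWeyl_lieWeyl _ hk hC))) (Submodule.smul_mem _ _ (hw _ hC)))

lemma bracket_skew (δ δ' : CDerEnd R) : ⁅δ', δ⁆ = - ⁅δ, δ'⁆ := by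
  refine Subtype.ext (Prod.ext ?_ ?_)
  · exact (lie_skew _ _).symm
  · ext i j
    simp [coe_bracket, bracketC]
    abel

lemma brAdd_even_left (v p u : Ext R) (r δ : CDerEnd R) (hp : ∀ u, u * p = p * u)
    (hp' : ∀ u, u * extDer δ.1 p = extDer δ.1 p * u) :
    brAdd (v • (p ⊗ₜ[R] r)) (u ⊗ₜ[R] δ) = (v * (p * extDer r.1 u)) ⊗ₜ[R] δ -
      (v * u) • lieL δ (p ⊗ₜ[R] r) - (extDer δ.1 v * u) • (p ⊗ₜ[R] r) := by
  rw [TensorProduct.smul_tmul', brAdd_tmul, lieL_tmul, bracket_skew, smul_eq_mul, extDer_mul]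
  simp only [smul_add, TensorProduct.smul_tmul', smul_eq_mul, add_mul, mul_assoc, hp u, hp' u,
    TensorProduct.add_tmul, TensorProduct.tmul_neg]
  abel

lemma brAdd_weyl_left {C : Fin 4 → Fin 4 → Fin 4 → Fin 4 → R} (hC : IsWeyl C) (v : Ext R)
    (l : Lie R) : brAdd (v • weylElt C) l ∈ weylIdeal R := by
  have hw : ∀ C : Fin 4 → Fin 4 → Fin 4 → Fin 4 → R, IsWeyl C → weylElt C ∈ weylIdeal R :=
    fun C hC => Submodule.subset_span ⟨C, hC, rfl⟩
  induction l using TensorProduct.induction_on with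
  | zero => rw [map_zero]; exact zero_mem _
  | add a b ha hb => rw [map_add]; exact add_mem ha hb
  | tmul u δ =>
    obtain ⟨k, hk⟩ := δ.2
    have h1 : brAdd (v • weylElt C) (u ⊗ₜ[R] δ) =
        (∑ a, ∑ b, ∑ c, ∑ d, v * C a b c d •
          ((theta R a * theta R b) * extDer (rot (R := R) c d).1 u)) ⊗ₜ[R] δ
        - (v * u) • weylElt (lieWeyl δ.1.1 δ.1.2 k C) - (extDer δ.1 v * u) • weylElt C := by
      rw [← lieL_weylElt δ hk]
      simp only [weylElt, Finset.smul_sum, map_sum, AddMonoidHom.finsetSum_apply,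
        TensorProduct.sum_tmul, ← Finset.sum_sub_distrib]
      refine Finset.sum_congr rfl fun a _ => Finset.sum_congr rfl fun b _ =>
        Finset.sum_congr rfl fun c _ => Finset.sum_congr rfl fun d _ => ?_
      rw [TensorProduct.smul_tmul', brAdd_even_left, smul_mul_assoc]
      · intro u
        rw [mul_smul_comm, smul_mul_assoc, theta, theta, commute_ι_mul_ι]
      · intro u
        rw [extDer_smul_fun, mul_add, add_mul, mul_smul_comm, smul_mul_assoc,
          extDer_theta_mul_comm, mul_smul_comm, smul_mul_assoc, theta, theta, commute_ι_mul_ι]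
    rw [h1]
    have h2 := congrArg (v * ·) (extDer_rot_weyl hC u)
    simp only [Finset.mul_sum, mul_zero] at h2
    rw [h2, TensorProduct.zero_tmul, zero_sub]
    exact sub_mem (neg_mem (Submodule.smul_mem _ _ (hw _ (isWeyl_lieWeyl _ hk hC))))
      (Submodule.smul_mem _ _ (hw _ hC))

/-- `I` is an ideal of `L`. -/
lemma brAdd_mem_weylIdeal {n : Lie R} (hn : n ∈ weylIdeal R) (l : Lie R) :
    brAdd l n ∈ weylIdeal R ∧ brAdd n l ∈ weylIdeal R := by
  refine Submodule.closure_induction (p := fun n _ => brAdd l n ∈ weylIdeal R ∧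
    brAdd n l ∈ weylIdeal R) ?_ ?_ ?_ hn
  · rw [map_zero, map_zero, AddMonoidHom.zero_apply]
    exact ⟨zero_mem _, zero_mem _⟩
  · intro x y _ _ hx hy
    rw [map_add, map_add, AddMonoidHom.add_apply]
    exact ⟨add_mem hx.1 hy.1, add_mem hx.2 hy.2⟩
  · intro r x hx
    obtain ⟨C, hC, hx⟩ := hx
    have h1 := brAdd_weyl_right hC r l
    have h2 := brAdd_weyl_left hC r l
    rw [← hx] at h1 h2
    exact ⟨h1, h2⟩

end Algebra3

section Algebra4

variable {R : Type*} [CommRing R] [Algebra ℝ R]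

/-- The bracket of `L` as a real bilinear map. -/
def brL : Lie R →ₗ[ℝ] Lie R →ₗ[ℝ] Lie R :=
  LinearMap.mk₂ ℝ (fun x y => brAdd x y) (fun x y z => by rw [map_add]; rfl) smul_brAdd
    (fun x y z => map_add _ _ _) brAdd_smul

variable (R) in
/-- The graded Lie algebroid `E = L / I`, a `∧W`-module. -/
def EE : Type _ := Lie R ⧸ weylIdeal R

instance : AddCommGroup (EE R) := inferInstanceAs (AddCommGroup (Lie R ⧸ weylIdeal R))
instance : Module (Ext R) (EE R) := inferInstanceAs (Module (Ext R) (Lie R ⧸ weylIdeal R))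
instance : Module R (EE R) := inferInstanceAs (Module R (Lie R ⧸ weylIdeal R))
instance : Module ℝ (EE R) := inferInstanceAs (Module ℝ (Lie R ⧸ weylIdeal R))
instance : IsScalarTower R (Ext R) (EE R) :=
  inferInstanceAs (IsScalarTower R (Ext R) (Lie R ⧸ weylIdeal R))
instance : IsScalarTower ℝ (Ext R) (EE R) :=
  inferInstanceAs (IsScalarTower ℝ (Ext R) (Lie R ⧸ weylIdeal R))
instance : IsScalarTower ℝ R (EE R) :=
  inferInstanceAs (IsScalarTower ℝ R (Lie R ⧸ weylIdeal R))

lemma brL_apply (x y : Lie R) : brL x y = brAdd x y := rfl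

/-- The canonical surjection `L → E`. -/
def toE : Lie R →ₗ[Ext R] EE R := (weylIdeal R).mkQ

lemma toE_surjective : Function.Surjective (toE (R := R)) := Submodule.mkQ_surjective _

lemma toE_eq_zero {l : Lie R} : toE l = 0 ↔ l ∈ weylIdeal R := by
  exact Submodule.Quotient.mk_eq_zero (weylIdeal R)

lemma toE_smul_real (c : ℝ) (l : Lie R) : toE (c • l) = c • toE l :=
  ((toE (R := R)).restrictScalars ℝ).map_smul c l

/-- A real linear map on `L` that vanishes on `I` descends to `E`. -/
def descend {V : Type*} [AddCommGroup V] [Module ℝ V] (f : Lie R →ₗ[ℝ] V)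
    (hf : ∀ l ∈ weylIdeal R, f l = 0) : EE R →ₗ[ℝ] V :=
  ((weylIdeal R).restrictScalars ℝ).liftQ f hf ∘ₗ
    (Submodule.Quotient.restrictScalarsEquiv ℝ (weylIdeal R)).symm.toLinearMap

lemma descend_toE {V : Type*} [AddCommGroup V] [Module ℝ V] (f : Lie R →ₗ[ℝ] V)
    (hf : ∀ l ∈ weylIdeal R, f l = 0) (l : Lie R) : descend f hf (toE l) = f l := rfl

/-- `[x, -]` on `E` for `x ∈ L`. -/
def brE₁ (x : Lie R) : EE R →ₗ[ℝ] EE R :=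
  descend ((toE (R := R)).restrictScalars ℝ ∘ₗ brL x)
    (fun _ hl => toE_eq_zero.2 (brAdd_mem_weylIdeal hl x).1)

lemma brE₁_toE (x y : Lie R) : brE₁ x (toE y) = toE (brL x y) := rfl

/-- `x ↦ [x, -]` as a linear map from `L` to the endomorphisms of `E`. -/
def brE₂ : Lie R →ₗ[ℝ] EE R →ₗ[ℝ] EE R where
  toFun := brE₁
  map_add' x x' := by
    refine LinearMap.ext fun y => ?_
    obtain ⟨y, rfl⟩ := toE_surjective y
    rw [LinearMap.add_apply, brE₁_toE, brE₁_toE, brE₁_toE, map_add, LinearMap.add_apply, map_add]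
  map_smul' c x := by
    refine LinearMap.ext fun y => ?_
    obtain ⟨y, rfl⟩ := toE_surjective y
    rw [RingHom.id_apply, LinearMap.smul_apply, brE₁_toE, brE₁_toE, map_smul, LinearMap.smul_apply,
      toE_smul_real]

/-- The bracket of `E`, induced by that of `L`, see `brE_toE`. -/
def brE : EE R →ₗ[ℝ] EE R →ₗ[ℝ] EE R :=
  descend brE₂ (fun l hl => by
    refine LinearMap.ext fun y => ?_
    obtain ⟨y, rfl⟩ := toE_surjective y
    rw [LinearMap.zero_apply]
    exact toE_eq_zero.2 (brAdd_mem_weylIdeal hl y).2)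

lemma brE_toE (x y : Lie R) : brE (toE x) (toE y) = toE (brL x y) := rfl

end Algebra4

section Algebra5

variable {R : Type*} [CommRing R] [Algebra ℝ R]

/-- For `c = 0` the action of `δ` on `∧W`, for `c = 1` the action of `δ` on `∧W ⊗ ∧⁴W ≅ ∧W`, where
`∧⁴W` is trivialized by `θ₀θ₁θ₂θ₃`, on which `δ = (X, M)` acts by the trace of `M`. -/
def actTr (c : ℕ) (δ : CDerEnd R) : Ext R →ₗ[ℝ] Ext R where
  toFun z := extDer δ.1 z + (c * δ.1.2.trace) • z
  map_add' x y := by rw [map_add, smul_add]; abel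
  map_smul' r x := by rw [extDer_smul_real, RingHom.id_apply, smul_add, smul_comm r]

lemma actTr_apply (c : ℕ) (δ : CDerEnd R) (z : Ext R) :
    actTr c δ z = extDer δ.1 z + (c * δ.1.2.trace) • z := rfl

lemma actTr_mul (c : ℕ) (δ : CDerEnd R) (u z : Ext R) :
    actTr c δ (u * z) = u * actTr c δ z + extDer δ.1 u * z := by
  rw [actTr_apply, actTr_apply, extDer_mul, mul_add, mul_smul_comm]; abel

lemma actTr_bracket (c : ℕ) (δ δ' : CDerEnd R) (z : Ext R) :
    actTr c ⁅δ, δ'⁆ z = actTr c δ (actTr c δ' z) - actTr c δ' (actTr c δ z) := by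
  have h : (bracketC δ.1 δ'.1).2.trace = δ.1.1 δ'.1.2.trace - δ'.1.1 δ.1.2.trace := by
    simp only [bracketC, Matrix.trace_add, Matrix.trace_sub, Matrix.trace_mul_comm δ.1.2 δ'.1.2,
      sub_self, add_zero]
    simp [Matrix.trace]
  simp only [actTr_apply, coe_bracket, extDer_bracketC, h, map_add, extDer_smul_fun,
    Derivation.leibniz, Derivation.map_natCast, mul_zero, add_zero, smul_eq_mul, mul_sub,
    sub_smul, smul_smul, mul_comm (c * δ.1.2.trace)]
  abel

/-- The representation `ωδ ↦ (z ↦ ω δ(z))` of `L` on `∧W` (`c = 0`) and on `∧W ⊗ ∧⁴W` (`c = 1`). -/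
def repL (c : ℕ) : Lie R →ₗ[R] (Ext R →ₗ[ℝ] Ext R) :=
  TensorProduct.lift (LinearMap.mk₂ R (fun u δ => LinearMap.mulLeft ℝ u ∘ₗ actTr c δ)
    (fun u v δ => by ext z; simp [add_mul])
    (fun r u δ => by ext z; simp)
    (fun u δ δ' => by
      ext z
      simp only [LinearMap.comp_apply, LinearMap.mulLeft_apply, LinearMap.add_apply, actTr_apply,
        Submodule.coe_add, extDer_add_left, Prod.snd_add, Matrix.trace_add, mul_add, add_smul]
      abel)
    (fun r u δ => by
      ext z
      simp only [LinearMap.comp_apply, LinearMap.mulLeft_apply, LinearMap.smul_apply, actTr_apply,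
        Submodule.coe_smul, extDer_smul_left, Prod.smul_snd, Matrix.trace_smul, smul_eq_mul,
        mul_left_comm _ r, mul_smul r, ← smul_add, mul_smul_comm]))

lemma repL_tmul (c : ℕ) (u : Ext R) (δ : CDerEnd R) (z : Ext R) :
    repL c (u ⊗ₜ[R] δ) z = u * actTr c δ z := rfl

lemma repL_smul (c : ℕ) (v : Ext R) (l : Lie R) (z : Ext R) :
    repL c (v • l) z = v * repL c l z := by
  induction l using TensorProduct.induction_on with
  | zero => simp
  | add a b ha hb =>
    rw [smul_add, map_add, map_add, LinearMap.add_apply, LinearMap.add_apply, ha, hb, mul_add]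
  | tmul u δ => rw [TensorProduct.smul_tmul', repL_tmul, repL_tmul, smul_eq_mul, mul_assoc]

lemma repL_weylIdeal (c : ℕ) {l : Lie R} (hl : l ∈ weylIdeal R) : repL c l = 0 := by
  refine Submodule.closure_induction (p := fun l _ => repL c l = 0) (map_zero _) ?_ ?_ hl
  · intro x y _ _ hx hy
    rw [map_add, hx, hy, add_zero]
  · rintro v x ⟨C, hC, hx⟩
    ext z
    have hz := extDer_rot_weyl hC z
    have ht : ∀ a b, (rot (R := R) a b).1.2.trace = 0 := by
      intro a b
      simp only [rot, rotMat, Matrix.trace_sub]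
      by_cases h : a = b
      · subst h; simp
      · rw [Matrix.trace_single_eq_of_ne _ _ _ h, Matrix.trace_single_eq_of_ne _ _ _ (Ne.symm h),
          sub_zero]
    rw [repL_smul, hx, LinearMap.zero_apply]
    simp only [weylElt, map_sum, map_smul, LinearMap.sum_apply, LinearMap.smul_apply, repL_tmul,
      actTr_apply, ht, mul_zero, zero_smul, add_zero, hz]

/-- The representation of `E` on `∧W` (`c = 0`) and on `∧W ⊗ ∧⁴W` (`c = 1`). -/
def repE (c : ℕ) : EE R →ₗ[ℝ] (Ext R →ₗ[ℝ] Ext R) :=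
  descend ((repL c).restrictScalars ℝ) (fun _ hl => repL_weylIdeal c hl)

lemma repE_toE (c : ℕ) (l : Lie R) : repE c (toE l) = repL c l := rfl

lemma toE_smul_fun (r : R) (l : Lie R) : toE (r • l) = r • toE l :=
  ((toE (R := R)).restrictScalars R).map_smul r l

lemma repE_smul_fun (c : ℕ) (r : R) (e : EE R) : repE c (r • e) = r • repE c e := by
  obtain ⟨l, rfl⟩ := toE_surjective e
  rw [← toE_smul_fun, repE_toE, repE_toE, map_smul]

/-- For `m = 0, 1, 2` the orthogonal decomposition `W = W₀ ⊕ W₁` has `W₀` spanned by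
`θ₀, θ_{m+1}` and `W₁` spanned by the other two basis elements. The weight is `0` on `W₀` and `1`
on `W₁`. -/
def wt (m : Fin 3) (a : Fin 4) : ℕ := if a = 0 ∨ a = m.succ then 0 else 1

variable (R) in
/-- A monomial in `θ₀, θ₁, θ₂, θ₃`. -/
def mono (l : List (Fin 4)) : Ext R := (l.map (theta R)).prod

/-- The degree in the basis elements of `W₁`. -/
def wtL (m : Fin 3) (l : List (Fin 4)) : ℕ := (l.map (wt m)).sum

variable (R) in
/-- `F_{⊲q}(∧W)`: spanned by the monomials whose degree in the basis elements of `W₁` is at most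
`q` and has the parity of `q`. -/
def extFil (m : Fin 3) (q : ℕ) : Submodule R (Ext R) :=
  Submodule.span R {u | ∃ l, wtL m l ≤ q ∧ wtL m l % 2 = q % 2 ∧ u = mono R l}

variable (R) in
/-- The part of `∧W` of degree `k` and of `ℤ₂`-degree `a`. -/
def extPiece (m : Fin 3) (a : ZMod 2) (k : ℕ) : Submodule R (Ext R) :=
  Submodule.span R {u | ∃ l, l.length = k ∧ (wtL m l : ZMod 2) = a ∧ u = mono R l}

variable (R) in
/-- The part of `CDerEnd(W)` of `ℤ₂`-degree `b`, for the decomposition `W = W₀ ⊕ W₁`. -/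
def cPiece (m : Fin 3) (b : ZMod 2) : Submodule R (CDerEnd R) where
  carrier := {δ | (∀ i j, (wt m i + wt m j : ZMod 2) ≠ b → δ.1.2 i j = 0) ∧ (b ≠ 0 → δ.1.1 = 0)}
  zero_mem' := by simp
  add_mem' := by
    rintro x y ⟨h1, h2⟩ ⟨h3, h4⟩
    exact ⟨fun i j h => by simp [h1 i j h, h3 i j h], fun h => by simp [h2 h, h4 h]⟩
  smul_mem' := by
    rintro r x ⟨h1, h2⟩
    exact ⟨fun i j h => by simp [h1 i j h], fun h => by simp [h2 h]⟩

variable (R) in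
/-- The part of `L` of degree `k` and of `ℤ₂`-degree `e`. -/
def lPiece (m : Fin 3) (e : ZMod 2) (k : ℕ) : Submodule R (Lie R) :=
  Submodule.span R {l | ∃ a b u δ, a + b = e ∧ u ∈ extPiece R m a k ∧ δ ∈ cPiece R m b ∧
    l = u ⊗ₜ[R] δ}

variable (R) in
/-- The part of `E` of degree `k` and of `ℤ₂`-degree `e`. -/
def ePiece (m : Fin 3) (e : ZMod 2) (k : ℕ) : Submodule R (EE R) :=
  (lPiece R m e k).map (toE.restrictScalars R)

variable (R) in
/-- The elements of `E` that map `F_{⊲q}` to `F_{⊲q+p}` for all `q`, both for `∧W` and for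
`∧W ⊗ ∧⁴W`. -/
def stab (m : Fin 3) (p : ℕ) : Submodule R (EE R) where
  carrier := {e | ∀ c < 2, ∀ q, ∀ z ∈ extFil R m q, repE c e z ∈ extFil R m (q + p)}
  zero_mem' := fun c _ q z _ => by rw [map_zero]; exact zero_mem _
  add_mem' := fun hx hy c hc q z hz => by
    rw [map_add]; exact add_mem (hx c hc q z hz) (hy c hc q z hz)
  smul_mem' := fun r x hx c hc q z hz => by
    rw [repE_smul_fun]; exact Submodule.smul_mem _ _ (hx c hc q z hz)

variable (R) in
/-- `F_{⊲p}E`, the elements of `ℤ₂`-degree `p mod 2` that map `F_{⊲q}` to `F_{⊲q+p}` for all `q`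
(a graded subspace, so it is the sum of its parts of degree `k`). -/
def triFil (m : Fin 3) (p : ℕ) : Submodule R (EE R) :=
  ⨆ k, ePiece R m p k ⊓ stab R m p

variable (R) in
/-- The 1-index BKL filtration `F_pE = F_{⊲p}E + F_{⊲p-1}E` of `E` (written as the sum over all
`q ≤ p`, which is the same since `F_{⊲q}E ⊆ F_{⊲q+2}E`). The three values of `m` give the
filtrations `F`, `F'`, `F''`. -/
def fil (m : Fin 3) (p : ℕ) : Submodule R (EE R) :=
  ⨆ q, ⨆ _ : q ≤ p, triFil R m q

variable (R) in
/-- The 3-index BKL filtration `F_{p₁p₂p₃}E = F_{p₁}E ∩ F'_{p₂}E ∩ F''_{p₃}E`. -/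
def fil3 (α : Fin 3 →₀ ℕ) : Submodule R (EE R) :=
  fil R 0 (α 0) ⊓ fil R 1 (α 1) ⊓ fil R 2 (α 2)

lemma fil_mono (m : Fin 3) : Monotone (fil R m) := fun _ _ h =>
  iSup₂_le fun q hq => le_iSup₂_of_le q (hq.trans h) le_rfl

lemma fil3_mono : Monotone (fil3 R) := fun _ _ h =>
  inf_le_inf (inf_le_inf (fil_mono _ (h 0)) (fil_mono _ (h 1))) (fil_mono _ (h 2))

end Algebra5

section Algebra6

variable {R : Type*} [CommRing R] [Algebra ℝ R]

lemma mono_append {R : Type*} [CommRing R] (l l' : List (Fin 4)) :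
    mono R (l ++ l') = mono R l * mono R l' := by
  simp [mono]

lemma mono_cons {R : Type*} [CommRing R] (a : Fin 4) (l : List (Fin 4)) :
    mono R (a :: l) = theta R a * mono R l := by
  simp [mono]

lemma mul_mem_extPiece {R : Type*} [CommRing R] {m : Fin 3} {a a' : ZMod 2} {k k' : ℕ}
    {u u' : Ext R} (hu : u ∈ extPiece R m a k) (hu' : u' ∈ extPiece R m a' k') :
    u * u' ∈ extPiece R m (a + a') (k + k') := by
  induction hu using Submodule.span_induction with
  | zero => rw [zero_mul]; exact zero_mem _
  | add x y _ _ hx hy => rw [add_mul]; exact add_mem hx hy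
  | smul r x _ hx => rw [smul_mul_assoc]; exact Submodule.smul_mem _ _ hx
  | mem x hx =>
    obtain ⟨l, h1, h2, rfl⟩ := hx
    induction hu' using Submodule.span_induction with
    | zero => rw [mul_zero]; exact zero_mem _
    | add x y _ _ hx hy => rw [mul_add]; exact add_mem hx hy
    | smul r x _ hx => rw [mul_smul_comm]; exact Submodule.smul_mem _ _ hx
    | mem x hx =>
      obtain ⟨l', h1', h2', rfl⟩ := hx
      refine Submodule.subset_span ⟨l ++ l', by simp [h1, h1'], ?_, (mono_append l l').symm⟩
      rw [← h2, ← h2', wtL, List.map_append, List.sum_append, Nat.cast_add]; rfl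

lemma theta_mem_extPiece {R : Type*} [CommRing R] (m : Fin 3) (a : Fin 4) :
    theta R a ∈ extPiece R m (wt m a) 1 :=
  Submodule.subset_span ⟨[a], rfl, by simp [wtL], by simp [mono]⟩

lemma extDer_mem_extPiece {m : Fin 3} {a b : ZMod 2} {k : ℕ} {u : Ext R} {δ : CDerEnd R}
    (hu : u ∈ extPiece R m a k) (hδ : δ ∈ cPiece R m b) :
    extDer δ.1 u ∈ extPiece R m (b + a) k := by
  have hθ : ∀ i, extDer δ.1 (theta R i) ∈ extPiece R m (b + wt m i) 1 := by
    intro i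
    rw [extDer_theta]
    refine sum_mem fun j _ => ?_
    by_cases h : (wt m j + wt m i : ZMod 2) = b
    · rw [← h, add_assoc, CharTwo.add_self_eq_zero, add_zero]
      exact Submodule.smul_mem _ _ (theta_mem_extPiece m j)
    · rw [hδ.1 j i h, zero_smul]; exact zero_mem _
  have hm : ∀ l, extDer δ.1 (mono R l) ∈ extPiece R m (b + wtL m l) l.length := by
    intro l
    induction l with
    | nil =>
      have : mono R [] = algebraMap R _ 1 := by simp [mono]
      rw [this, extDer_algebraMap, Derivation.map_one_eq_zero, map_zero]; exact zero_mem _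
    | cons i l ih =>
      rw [mono_cons, extDer_mul, List.length_cons, add_comm l.length]
      have hl : mono R l ∈ extPiece R m (wtL m l) l.length :=
        Submodule.subset_span ⟨l, rfl, rfl, rfl⟩
      have e : (wtL m (i :: l) : ZMod 2) = wt m i + wtL m l := by
        simp [wtL]
      have h1 := mul_mem_extPiece (theta_mem_extPiece m i) ih
      have h2 := mul_mem_extPiece (hθ i) hl
      rw [e]
      refine add_mem ?_ ?_
      · convert h1 using 1; ring_nf
      · convert h2 using 1; ring_nf
  induction hu using Submodule.span_induction with
  | zero => rw [map_zero]; exact zero_mem _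
  | add x y _ _ hx hy => rw [map_add]; exact add_mem hx hy
  | smul r x hx' hx =>
    rw [extDer_smul_fun]
    refine add_mem (Submodule.smul_mem _ _ hx) ?_
    by_cases hb : b = 0
    · rw [hb, zero_add]; exact Submodule.smul_mem _ _ hx'
    · rw [hδ.2 hb, Derivation.zero_apply, zero_smul]; exact zero_mem _
  | mem x hx =>
    obtain ⟨l, h1, h2, rfl⟩ := hx
    rw [← h1, ← h2]; exact hm l

lemma extPiece_comm {R : Type*} [CommRing R] {m : Fin 3} {a a' : ZMod 2} {k k' : ℕ}
    {u u' : Ext R} (hu : u ∈ extPiece R m a k) (hu' : u' ∈ extPiece R m a' k') :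
    u' * u = (-1 : ℤ) ^ (k * k') • (u * u') := by
  have h1 : ∀ (i : Fin 4) (l : List (Fin 4)),
      mono R l * theta R i = (-1 : ℤ) ^ l.length • (theta R i * mono R l) := by
    intro i l
    induction l with
    | nil => simp [mono]
    | cons j l ih =>
      have h : theta R j * theta R i = - (theta R i * theta R j) :=
        eq_neg_of_add_eq_zero_left (ExteriorAlgebra.ι_add_mul_swap _ _)
      rw [mono_cons, mul_assoc, ih, mul_smul_comm, ← mul_assoc, h, List.length_cons, pow_succ,
        neg_mul, mul_smul, neg_one_smul, mul_assoc]
  have h2 : ∀ l l' : List (Fin 4), mono R l' * mono R l =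
      (-1 : ℤ) ^ (l.length * l'.length) • (mono R l * mono R l') := by
    intro l l'
    induction l with
    | nil => simp [mono]
    | cons i l ih =>
      rw [mono_cons, ← mul_assoc, h1, smul_mul_assoc, mul_assoc, ih, mul_smul_comm, smul_smul,
        List.length_cons, ← pow_add, mul_assoc]
      congr 2; ring
  induction hu using Submodule.span_induction with
  | zero => simp
  | add x y _ _ hx hy => rw [mul_add, add_mul, hx, hy, smul_add]
  | smul r x _ hx => rw [mul_smul_comm, smul_mul_assoc, hx, smul_comm]
  | mem x hx =>
    obtain ⟨l, h3, _, rfl⟩ := hx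
    induction hu' using Submodule.span_induction with
    | zero => simp
    | add x y _ _ hx hy => rw [mul_add, add_mul, hx, hy, smul_add]
    | smul r x _ hx => rw [mul_smul_comm, smul_mul_assoc, hx, smul_comm]
    | mem x hx =>
      obtain ⟨l', h3', _, rfl⟩ := hx
      rw [h2, h3, h3']

lemma bracket_mem_cPiece {m : Fin 3} {b b' : ZMod 2} {δ δ' : CDerEnd R}
    (hδ : δ ∈ cPiece R m b) (hδ' : δ' ∈ cPiece R m b') : ⁅δ, δ'⁆ ∈ cPiece R m (b + b') := by
  have hX : ∀ {b : ZMod 2} {b' : ZMod 2} {δ δ' : CDerEnd R}, δ ∈ cPiece R m b →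
      δ' ∈ cPiece R m b' → ∀ i j, (wt m i + wt m j : ZMod 2) ≠ b + b' →
      δ.1.1 (δ'.1.2 i j) = 0 := by
    intro b b' δ δ' h h' i j hij
    by_cases hb : b = 0
    · rw [h'.1 i j (by rwa [hb, zero_add] at hij), map_zero]
    · rw [h.2 hb]; rfl
  have hM : ∀ {b : ZMod 2} {b' : ZMod 2} {δ δ' : CDerEnd R}, δ ∈ cPiece R m b →
      δ' ∈ cPiece R m b' → ∀ i j, (wt m i + wt m j : ZMod 2) ≠ b + b' →
      (δ.1.2 * δ'.1.2) i j = 0 := by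
    intro b b' δ δ' h h' i j hij
    rw [Matrix.mul_apply]
    refine Finset.sum_eq_zero fun e _ => ?_
    by_cases hb : (wt m i + wt m e : ZMod 2) = b
    · rw [h'.1 e j, mul_zero]
      intro hb'
      apply hij
      rw [← hb, ← hb']
      have := CharTwo.add_self_eq_zero (wt m e : ZMod 2)
      linear_combination - this
    · rw [h.1 i e hb, zero_mul]
  refine ⟨fun i j hij => ?_, fun hb => ?_⟩
  · have hij' : (wt m i + wt m j : ZMod 2) ≠ b' + b := by rwa [add_comm b']
    rw [coe_bracket]
    simp only [bracketC, Matrix.add_apply, Matrix.sub_apply, Matrix.map_apply, hX hδ hδ' i j hij,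
      hX hδ' hδ i j hij', hM hδ hδ' i j hij, hM hδ' hδ i j hij', sub_zero, add_zero]
  · rw [coe_bracket]
    change ⁅δ.1.1, δ'.1.1⁆ = 0
    by_cases h0 : b = 0
    · rw [hδ'.2 (by rwa [h0, zero_add] at hb), lie_zero]
    · rw [hδ.2 h0, zero_lie]

lemma lPiece_induction {m : Fin 3} {e : ZMod 2} {k : ℕ} {p : Lie R → Prop} (h0 : p 0)
    (hadd : ∀ x y, p x → p y → p (x + y))
    (htmul : ∀ a b u δ, a + b = e → u ∈ extPiece R m a k → δ ∈ cPiece R m b → p (u ⊗ₜ[R] δ))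
    {l : Lie R} (hl : l ∈ lPiece R m e k) : p l := by
  refine Submodule.closure_induction (p := fun l _ => p l) h0 (fun x y _ _ => hadd x y) ?_ hl
  rintro r x ⟨a, b, u, δ, hab, hu, hδ, rfl⟩
  rw [TensorProduct.smul_tmul']
  exact htmul a b _ _ hab (Submodule.smul_mem _ _ hu) hδ

lemma brL_mem_lPiece {m : Fin 3} {e e' : ZMod 2} {k k' : ℕ} {x y : Lie R}
    (hx : x ∈ lPiece R m e k) (hy : y ∈ lPiece R m e' k') :
    brL x y ∈ lPiece R m (e + e') (k + k') := by
  refine lPiece_induction (p := fun x => brL x y ∈ lPiece R m (e + e') (k + k')) ?_ ?_ ?_ hx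
  · rw [map_zero, LinearMap.zero_apply]; exact zero_mem _
  · intro x x' h h'
    rw [map_add, LinearMap.add_apply]; exact add_mem h h'
  intro a b u δ hab hu hδ
  refine lPiece_induction (p := fun y => brL (u ⊗ₜ[R] δ) y ∈ lPiece R m (e + e') (k + k'))
    ?_ ?_ ?_ hy
  · rw [map_zero]; exact zero_mem _
  · intro x x' h h'
    rw [map_add]; exact add_mem h h'
  intro a' b' u' δ' hab' hu' hδ'
  rw [brL_apply, brAdd_tmul]
  refine sub_mem (add_mem (Submodule.subset_span ?_) (Submodule.subset_span ?_))
    (Submodule.subset_span ?_)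
  · exact ⟨a + a', b + b', _, _, by rw [← hab, ← hab']; ring, mul_mem_extPiece hu hu',
      bracket_mem_cPiece hδ hδ', rfl⟩
  · exact ⟨a + (b + a'), b', _, _, by rw [← hab, ← hab']; ring,
      mul_mem_extPiece hu (extDer_mem_extPiece hu' hδ), hδ', rfl⟩
  · exact ⟨(b' + a) + a', b, _, _, by rw [← hab, ← hab']; ring,
      mul_mem_extPiece (extDer_mem_extPiece hu hδ') hu', hδ, rfl⟩

/-- The representation property, with the graded commutator. -/
lemma repL_brL (c : ℕ) {m : Fin 3} {e e' : ZMod 2} {k k' : ℕ} {x y : Lie R}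
    (hx : x ∈ lPiece R m e k) (hy : y ∈ lPiece R m e' k') (z : Ext R) :
    repL c (brL x y) z =
      repL c x (repL c y z) - (-1 : ℤ) ^ (k * k') • repL c y (repL c x z) := by
  refine lPiece_induction (p := fun x => repL c (brL x y) z =
    repL c x (repL c y z) - (-1 : ℤ) ^ (k * k') • repL c y (repL c x z)) ?_ ?_ ?_ hx
  · simp
  · intro x x' h h'
    simp only [map_add, LinearMap.add_apply, h, h', smul_add]; abel
  intro a b u δ hab hu hδ
  refine lPiece_induction (p := fun y => repL c (brL (u ⊗ₜ[R] δ) y) z =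
    repL c (u ⊗ₜ[R] δ) (repL c y z) - (-1 : ℤ) ^ (k * k') • repL c y (repL c (u ⊗ₜ[R] δ) z))
    ?_ ?_ ?_ hy
  · simp
  · intro x x' h h'
    simp only [map_add, LinearMap.add_apply, h, h', smul_add]; abel
  intro a' b' u' δ' hab' hu' hδ'
  have h1 : u' * u = (-1 : ℤ) ^ (k * k') • (u * u') := extPiece_comm hu hu'
  have h2 : u' * extDer δ'.1 u = (-1 : ℤ) ^ (k * k') • (extDer δ'.1 u * u') :=
    extPiece_comm (extDer_mem_extPiece hu hδ') hu'
  have h3 : (-1 : ℤ) ^ (k * k') * (-1 : ℤ) ^ (k * k') = 1 := by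
    rw [← mul_pow]; norm_num
  rw [brL_apply, brAdd_tmul, map_sub, map_add, LinearMap.sub_apply, LinearMap.add_apply]
  simp only [repL_tmul, actTr_bracket, actTr_mul, mul_add, mul_sub, ← mul_assoc, h1, h2, smul_add,
    smul_mul_assoc, smul_smul, h3, one_smul]
  abel

lemma brE_mem_triFil {m : Fin 3} {p p' : ℕ} {x y : EE R} (hx : x ∈ triFil R m p)
    (hy : y ∈ triFil R m p') : brE x y ∈ triFil R m (p + p') := by
  rw [triFil] at hx hy
  induction hx using Submodule.iSup_induction' with
  | zero => rw [map_zero]; exact zero_mem _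
  | add x x' _ _ h h' => rw [map_add]; exact add_mem h h'
  | mem k x hx =>
    induction hy using Submodule.iSup_induction' with
    | zero => rw [map_zero]; exact zero_mem _
    | add x x' _ _ h h' => rw [map_add]; exact add_mem h h'
    | mem k' y hy =>
      obtain ⟨⟨x, hx1, rfl⟩, hx2⟩ := hx
      obtain ⟨⟨y, hy1, rfl⟩, hy2⟩ := hy
      refine Submodule.mem_iSup_of_mem (k + k') ⟨⟨brL x y, ?_, rfl⟩, ?_⟩
      · rw [Nat.cast_add]; exact brL_mem_lPiece hx1 hy1
      · intro c hc q z hz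
        have := repL_brL c hx1 hy1 z
        change repL c (brL x y) z ∈ _
        rw [this]
        refine sub_mem ?_ (zsmul_mem ?_ _)
        · have := hx2 c hc _ _ (hy2 c hc q z hz)
          rwa [show q + p' + p = q + (p + p') by ring] at this
        · have := hy2 c hc _ _ (hx2 c hc q z hz)
          rwa [show q + p + p' = q + (p + p') by ring] at this

lemma brE_mem_fil {m : Fin 3} {p p' : ℕ} {x y : EE R} (hx : x ∈ fil R m p)
    (hy : y ∈ fil R m p') : brE x y ∈ fil R m (p + p') := by
  have h : ∀ q ≤ p, ∀ q' ≤ p', ∀ x ∈ triFil R m q, ∀ y ∈ triFil R m q',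
      brE x y ∈ fil R m (p + p') := fun q hq q' hq' x hx y hy =>
    (le_iSup₂_of_le (f := fun r (_ : r ≤ p + p') => triFil R m r) (q + q') (add_le_add hq hq')
      le_rfl) (brE_mem_triFil hx hy)
  rw [fil] at hx hy
  induction hx using Submodule.iSup_induction' with
  | zero => rw [map_zero]; exact zero_mem _
  | add x x' _ _ h h' => rw [map_add]; exact add_mem h h'
  | mem q x hx =>
    induction hx using Submodule.iSup_induction' with
    | zero => rw [map_zero]; exact zero_mem _
    | add x x' _ _ h h' => rw [map_add]; exact add_mem h h'
    | mem hq x hx =>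
      induction hy using Submodule.iSup_induction' with
      | zero => rw [map_zero]; exact zero_mem _
      | add x x' _ _ h h' => rw [map_add]; exact add_mem h h'
      | mem q' y hy =>
        induction hy using Submodule.iSup_induction' with
        | zero => rw [map_zero]; exact zero_mem _
        | add x x' _ _ h h' => rw [map_add]; exact add_mem h h'
        | mem hq' y hy => exact h q hq q' hq' x hx y hy

lemma brE_mem_fil3 {α β : Fin 3 →₀ ℕ} {x y : EE R} (hx : x ∈ fil3 R α) (hy : y ∈ fil3 R β) :
    brE x y ∈ fil3 R (α + β) :=
  ⟨⟨brE_mem_fil hx.1.1 hy.1.1, brE_mem_fil hx.1.2 hy.1.2⟩, brE_mem_fil hx.2 hy.2⟩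

end Algebra6

section Algebra7

/-- Formal power series `∑ s^α x_α` in `s₁, s₂, s₃` with coefficients `x_α` in `V`. -/
def PowSer (V : Type*) : Type _ := (Fin 3 →₀ ℕ) → V

namespace PowSer

variable {V : Type*} [AddCommGroup V]

instance : AddCommGroup (PowSer V) := inferInstanceAs (AddCommGroup ((Fin 3 →₀ ℕ) → V))

instance {k : Type*} [CommRing k] [Module k V] : Module k (PowSer V) :=
  inferInstanceAs (Module k ((Fin 3 →₀ ℕ) → V))

@[ext] lemma ext {V : Type*} {x y : PowSer V} (h : ∀ γ, x γ = y γ) : x = y := funext h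

@[simp] lemma zero_apply (γ : Fin 3 →₀ ℕ) : (0 : PowSer V) γ = 0 := rfl
@[simp] lemma add_apply (x y : PowSer V) (γ : Fin 3 →₀ ℕ) : (x + y) γ = x γ + y γ := rfl
@[simp] lemma smul_apply {k : Type*} [CommRing k] [Module k V] (c : k) (x : PowSer V)
    (γ : Fin 3 →₀ ℕ) : (c • x) γ = c • x γ := rfl

lemma triple (γ : Fin 3 →₀ ℕ) (f : (Fin 3 →₀ ℕ) → (Fin 3 →₀ ℕ) → (Fin 3 →₀ ℕ) → V) :
    ∑ p ∈ Finset.HasAntidiagonal.antidiagonal γ, ∑ q ∈ Finset.HasAntidiagonal.antidiagonal p.1, f q.1 q.2 p.2 =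
      ∑ p ∈ Finset.HasAntidiagonal.antidiagonal γ, ∑ q ∈ Finset.HasAntidiagonal.antidiagonal p.2, f p.1 q.1 q.2 := by
  rw [Finset.sum_sigma', Finset.sum_sigma']
  refine Finset.sum_nbij' (fun ⟨⟨_i, j⟩, ⟨k, l⟩⟩ => ⟨(k, l + j), (l, j)⟩)
    (fun ⟨⟨i, _j⟩, ⟨k, l⟩⟩ => ⟨(i + k, l), (i, k)⟩) ?_ ?_ ?_ ?_ ?_
  · rintro ⟨⟨i, j⟩, ⟨k, l⟩⟩; simp; rintro rfl rfl; rw [add_assoc]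
  · rintro ⟨⟨i, j⟩, ⟨k, l⟩⟩; simp; rintro rfl rfl; rw [add_assoc]
  · rintro ⟨⟨i, j⟩, ⟨k, l⟩⟩; rintro h; simp at h ⊢; simp [← h.2]
  · rintro ⟨⟨i, j⟩, ⟨k, l⟩⟩; rintro h; simp at h ⊢; simp [← h.2]
  · rintro ⟨⟨i, j⟩, ⟨k, l⟩⟩; simp

section Conv

variable {k : Type*} [CommRing k] [Module k V]

instance : SMul (MvPowerSeries (Fin 3) k) (PowSer V) :=
  ⟨fun c x γ => ∑ p ∈ Finset.HasAntidiagonal.antidiagonal γ, MvPowerSeries.coeff p.1 c • x p.2⟩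

lemma conv_apply (c : MvPowerSeries (Fin 3) k) (x : PowSer V) (γ : Fin 3 →₀ ℕ) :
    (c • x) γ = ∑ p ∈ Finset.HasAntidiagonal.antidiagonal γ, MvPowerSeries.coeff p.1 c • x p.2 := rfl

lemma monomial_smul (β : Fin 3 →₀ ℕ) (c : k) (x : PowSer V) (γ : Fin 3 →₀ ℕ) :
    (MvPowerSeries.monomial β c • x) γ =
      ∑ p ∈ Finset.HasAntidiagonal.antidiagonal γ, if p.1 = β then c • x p.2 else 0 := by
  rw [conv_apply]
  refine Finset.sum_congr rfl fun p _ => ?_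
  rw [MvPowerSeries.coeff_monomial]
  split_ifs <;> simp

lemma C_smul (c : k) (x : PowSer V) : (MvPowerSeries.C c : MvPowerSeries (Fin 3) k) • x = c • x := by
  ext γ
  rw [← MvPowerSeries.monomial_zero_eq_C_apply, monomial_smul, Finset.sum_eq_single (0, γ)]
  · simp
  · rintro ⟨a, b⟩ h1 h2
    rw [if_neg]
    rintro rfl
    simp at h1 h2
    exact h2 h1
  · intro h; simp at h

/-- Multiplication of power series with coefficients in `k` and power series with coefficients in
the `k`-module `V`. -/
instance : Module (MvPowerSeries (Fin 3) k) (PowSer V) where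
  one_smul x := by
    have := C_smul (1 : k) x
    rwa [map_one, one_smul] at this
  mul_smul c d x := by
    ext γ
    simp only [conv_apply, MvPowerSeries.coeff_mul, Finset.sum_smul, Finset.smul_sum, mul_smul]
    exact triple γ (fun a b e => MvPowerSeries.coeff a c • MvPowerSeries.coeff b d • x e)
  smul_zero c := by ext γ; simp [conv_apply]
  smul_add c x y := by ext γ; simp [conv_apply, Finset.sum_add_distrib]
  add_smul c d x := by ext γ; simp [conv_apply, add_smul, Finset.sum_add_distrib]
  zero_smul x := by ext γ; simp [conv_apply]

instance : IsScalarTower k (MvPowerSeries (Fin 3) k) (PowSer V) where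
  smul_assoc a c x := by
    ext γ
    simp [conv_apply, Finset.smul_sum, mul_smul]

end Conv

instance {k R : Type*} [CommRing k] [CommRing R] [Algebra k R] [Module k V] [Module R V]
    [IsScalarTower k R V] :
    IsScalarTower (MvPowerSeries (Fin 3) k) (MvPowerSeries (Fin 3) R) (PowSer V) where
  smul_assoc c d x := by
    have h : ∀ (c : MvPowerSeries (Fin 3) k) (y : PowSer V),
        MvPowerSeries.map (algebraMap k R) c • y = c • y := by
      intro c y
      ext γ
      simp [conv_apply]
    rw [Algebra.smul_def, mul_smul, MvPowerSeries.algebraMap_apply'', h]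

instance {k R : Type*} [CommRing k] [CommRing R] [Algebra k R] [Module k V] [Module R V]
    [IsScalarTower k R V] : IsScalarTower k (MvPowerSeries (Fin 3) R) (PowSer V) where
  smul_assoc a c x := by
    ext γ
    simp [conv_apply, Finset.smul_sum]

end PowSer

variable (R : Type*) [CommRing R] [Algebra ℝ R]

/-- The Rees algebra `P`: power series `∑ s^α x_α` with `x_α ∈ F_αE`. -/
def PP : Submodule (MvPowerSeries (Fin 3) R) (PowSer (EE R)) where
  carrier := {x | ∀ γ, x γ ∈ fil3 R γ}
  zero_mem' := fun _ => zero_mem _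
  add_mem' := fun hx hy γ => add_mem (hx γ) (hy γ)
  smul_mem' := fun c x hx γ => by
    rw [PowSer.conv_apply]
    refine sum_mem fun p hp => Submodule.smul_mem _ _ (fil3_mono ?_ (hx p.2))
    rw [← Finset.HasAntidiagonal.mem_antidiagonal.1 hp]
    exact le_add_self

variable {R}

/-- Bracket of power series, extending the bracket of `E` by `s₁, s₂, s₃`-linearity. -/
def brPow₀ (x y : PowSer (EE R)) : PowSer (EE R) :=
  fun γ => ∑ p ∈ Finset.HasAntidiagonal.antidiagonal γ, brE (x p.1) (y p.2)

/-- The bracket of power series as a real bilinear map. -/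
def brPow : PowSer (EE R) →ₗ[ℝ] PowSer (EE R) →ₗ[ℝ] PowSer (EE R) :=
  LinearMap.mk₂ ℝ brPow₀
    (fun x x' y => by
      ext γ
      simp only [brPow₀, PowSer.add_apply, map_add, LinearMap.add_apply, Finset.sum_add_distrib])
    (fun c x y => by
      ext γ
      simp only [brPow₀, PowSer.smul_apply, map_smul, LinearMap.smul_apply, Finset.smul_sum])
    (fun x y y' => by
      ext γ
      simp only [brPow₀, PowSer.add_apply, map_add, Finset.sum_add_distrib])
    (fun c x y => by
      ext γ
      simp only [brPow₀, PowSer.smul_apply, map_smul, Finset.smul_sum])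

lemma brPow_apply (x y : PowSer (EE R)) (γ : Fin 3 →₀ ℕ) :
    brPow x y γ = ∑ p ∈ Finset.HasAntidiagonal.antidiagonal γ, brE (x p.1) (y p.2) := rfl

lemma brPow_mem {x y : PowSer (EE R)} (hx : x ∈ PP R) (hy : y ∈ PP R) : brPow x y ∈ PP R := by
  intro γ
  rw [brPow_apply]
  refine sum_mem fun p hp => ?_
  rw [← Finset.HasAntidiagonal.mem_antidiagonal.1 hp]
  exact brE_mem_fil3 (hx _) (hy _)

/-- The bracket of the Rees algebra. -/
def brP : PP R →ₗ[ℝ] PP R →ₗ[ℝ] PP R :=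
  LinearMap.mk₂ ℝ (fun x y => ⟨brPow x y, brPow_mem x.2 y.2⟩)
    (fun x x' y => by
      apply Subtype.ext
      change brPow (x.1 + x'.1) y.1 = brPow x.1 y.1 + brPow x'.1 y.1
      rw [map_add, LinearMap.add_apply])
    (fun c x y => by
      apply Subtype.ext
      change brPow (c • x.1) y.1 = c • brPow x.1 y.1
      rw [map_smul, LinearMap.smul_apply])
    (fun x y y' => by
      apply Subtype.ext
      change brPow x.1 (y.1 + y'.1) = brPow x.1 y.1 + brPow x.1 y'.1
      rw [map_add])
    (fun c x y => by
      apply Subtype.ext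
      change brPow x.1 (c • y.1) = c • brPow x.1 y.1
      rw [map_smul])

lemma brP_coe (x y : PP R) : (brP x y : PowSer (EE R)) = brPow x.1 y.1 := rfl

lemma X_smul_apply (i : Fin 3) (x : PowSer (EE R)) (γ : Fin 3 →₀ ℕ) :
    ((MvPowerSeries.X i : MvPowerSeries (Fin 3) R) • x) γ =
      ∑ p ∈ Finset.HasAntidiagonal.antidiagonal γ, if p.1 = Finsupp.single i 1 then x p.2 else 0 := by
  rw [MvPowerSeries.X, PowSer.monomial_smul]
  simp

lemma brPow_X_smul_left (i : Fin 3) (x y : PowSer (EE R)) :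
    brPow ((MvPowerSeries.X i : MvPowerSeries (Fin 3) R) • x) y =
      (MvPowerSeries.X i : MvPowerSeries (Fin 3) R) • brPow x y := by
  ext γ
  simp only [brPow_apply, X_smul_apply, map_sum, LinearMap.sum_apply]
  rw [PowSer.triple γ (fun a b c => brE (if a = Finsupp.single i 1 then x b else 0) (y c))]
  refine Finset.sum_congr rfl fun p _ => ?_
  split_ifs <;> simp

lemma brPow_X_smul_right (i : Fin 3) (x y : PowSer (EE R)) :
    brPow x ((MvPowerSeries.X i : MvPowerSeries (Fin 3) R) • y) =
      (MvPowerSeries.X i : MvPowerSeries (Fin 3) R) • brPow x y := by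
  ext γ
  simp only [brPow_apply, X_smul_apply, map_sum]
  rw [← PowSer.triple γ (fun a b c => brE (x a) (if b = Finsupp.single i 1 then y c else 0))]
  have h := PowSer.triple γ (fun a b c => if a = Finsupp.single i 1 then brE (x b) (y c) else 0)
  have h' : ∑ p ∈ Finset.HasAntidiagonal.antidiagonal γ, ∑ q ∈ Finset.HasAntidiagonal.antidiagonal p.1,
      brE (x q.1) (if q.2 = Finsupp.single i 1 then y p.2 else 0) =
      ∑ p ∈ Finset.HasAntidiagonal.antidiagonal γ, ∑ q ∈ Finset.HasAntidiagonal.antidiagonal p.1,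
      if q.1 = Finsupp.single i 1 then brE (x q.2) (y p.2) else 0 := by
    refine Finset.sum_congr rfl fun p _ => ?_
    conv_lhs => rw [← Finset.HasAntidiagonal.map_swap_antidiagonal, Finset.sum_map]
    refine Finset.sum_congr rfl fun q _ => ?_
    simp only [Function.Embedding.coeFn_mk, Prod.fst_swap, Prod.snd_swap]
    split_ifs <;> simp
  rw [h', h]
  refine Finset.sum_congr rfl fun p _ => ?_
  split_ifs <;> simp

variable (R) in
/-- The ideal `(s₁, s₂, s₃)` of the Rees algebra, whose elements are the sums
`s₁x₁ + s₂x₂ + s₃x₃`. -/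
def JJ : Submodule (MvPowerSeries (Fin 3) R) (PP R) :=
  Ideal.span (Set.range (MvPowerSeries.X : Fin 3 → MvPowerSeries (Fin 3) R)) • ⊤

lemma JJ_induction {p : PP R → Prop} (h0 : p 0) (hadd : ∀ x y, p x → p y → p (x + y))
    (hX : ∀ i (x : PP R), p ((MvPowerSeries.X i : MvPowerSeries (Fin 3) R) • x)) {x : PP R}
    (hx : x ∈ JJ R) : p x := by
  refine Submodule.smul_induction_on hx ?_ hadd
  intro r hr n _
  refine Submodule.closure_induction (p := fun r _ => p (r • n)) ?_ ?_ ?_ hr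
  · rw [zero_smul]; exact h0
  · intro a b _ _ ha hb; rw [add_smul]; exact hadd _ _ ha hb
  · rintro a _ ⟨i, rfl⟩
    rw [smul_assoc, smul_comm]
    exact hX i _

lemma X_smul_mem_JJ (i : Fin 3) (x : PP R) :
    (MvPowerSeries.X i : MvPowerSeries (Fin 3) R) • x ∈ JJ R :=
  Submodule.smul_mem_smul (Ideal.subset_span ⟨i, rfl⟩) trivial

lemma brP_X_smul (i : Fin 3) (x y : PP R) :
    brP x ((MvPowerSeries.X i : MvPowerSeries (Fin 3) R) • y) =
        (MvPowerSeries.X i : MvPowerSeries (Fin 3) R) • brP x y := by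
  apply Subtype.ext
  rw [brP_coe, Submodule.coe_smul, Submodule.coe_smul, brPow_X_smul_right]
  rfl

lemma brP_X_smul' (i : Fin 3) (x y : PP R) :
    brP ((MvPowerSeries.X i : MvPowerSeries (Fin 3) R) • x) y =
        (MvPowerSeries.X i : MvPowerSeries (Fin 3) R) • brP x y := by
  apply Subtype.ext
  rw [brP_coe, Submodule.coe_smul, Submodule.coe_smul, brPow_X_smul_left]
  rfl

lemma brP_mem_JJ {n : PP R} (hn : n ∈ JJ R) (x : PP R) : brP x n ∈ JJ R ∧ brP n x ∈ JJ R := by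
  refine JJ_induction (p := fun n => brP x n ∈ JJ R ∧ brP n x ∈ JJ R) ?_ ?_ ?_ hn
  · rw [map_zero, map_zero, LinearMap.zero_apply]; exact ⟨zero_mem _, zero_mem _⟩
  · intro a b ha hb
    rw [map_add, map_add, LinearMap.add_apply]
    exact ⟨add_mem ha.1 hb.1, add_mem ha.2 hb.2⟩
  · intro i y
    rw [brP_X_smul, brP_X_smul']
    exact ⟨X_smul_mem_JJ _ _, X_smul_mem_JJ _ _⟩

variable (R) in
/-- The associated graded `A = P / (s₁, s₂, s₃)`. -/
def AA : Type _ := PP R ⧸ JJ R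

instance : AddCommGroup (AA R) := inferInstanceAs (AddCommGroup (PP R ⧸ JJ R))
instance : Module (MvPowerSeries (Fin 3) R) (AA R) :=
  inferInstanceAs (Module (MvPowerSeries (Fin 3) R) (PP R ⧸ JJ R))
instance : Module R (AA R) := inferInstanceAs (Module R (PP R ⧸ JJ R))
instance : Module ℝ (AA R) := inferInstanceAs (Module ℝ (PP R ⧸ JJ R))
instance : IsScalarTower R (MvPowerSeries (Fin 3) R) (AA R) :=
  inferInstanceAs (IsScalarTower R (MvPowerSeries (Fin 3) R) (PP R ⧸ JJ R))
instance : IsScalarTower ℝ (MvPowerSeries (Fin 3) R) (AA R) :=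
  inferInstanceAs (IsScalarTower ℝ (MvPowerSeries (Fin 3) R) (PP R ⧸ JJ R))

/-- The canonical surjection `P → A`. -/
def toA : PP R →ₗ[MvPowerSeries (Fin 3) R] AA R := (JJ R).mkQ

lemma toA_surjective : Function.Surjective (toA (R := R)) := Submodule.mkQ_surjective _

lemma toA_eq_zero {l : PP R} : toA l = 0 ↔ l ∈ JJ R := by
  exact Submodule.Quotient.mk_eq_zero (JJ R)

lemma toA_smul_real (c : ℝ) (l : PP R) : toA (c • l) = c • toA l :=
  ((toA (R := R)).restrictScalars ℝ).map_smul c l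

/-- A real linear map on `P` that vanishes on the ideal descends to `A`. -/
def descendA {V : Type*} [AddCommGroup V] [Module ℝ V] (f : PP R →ₗ[ℝ] V)
    (hf : ∀ l ∈ JJ R, f l = 0) : AA R →ₗ[ℝ] V :=
  ((JJ R).restrictScalars ℝ).liftQ f hf ∘ₗ
    (Submodule.Quotient.restrictScalarsEquiv ℝ (JJ R)).symm.toLinearMap

lemma descendA_toA {V : Type*} [AddCommGroup V] [Module ℝ V] (f : PP R →ₗ[ℝ] V)
    (hf : ∀ l ∈ JJ R, f l = 0) (l : PP R) : descendA f hf (toA l) = f l := rfl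

/-- `[x, -]` on `A` for `x ∈ P`. -/
def brA₁ (x : PP R) : AA R →ₗ[ℝ] AA R :=
  descendA ((toA (R := R)).restrictScalars ℝ ∘ₗ brP x)
    (fun _ hl => toA_eq_zero.2 (brP_mem_JJ hl x).1)

lemma brA₁_toA (x y : PP R) : brA₁ x (toA y) = toA (brP x y) := rfl

/-- `x ↦ [x, -]` as a linear map from `P` to the endomorphisms of `A`. -/
def brA₂ : PP R →ₗ[ℝ] AA R →ₗ[ℝ] AA R where
  toFun := brA₁
  map_add' x x' := by
    refine LinearMap.ext fun y => ?_
    obtain ⟨y, rfl⟩ := toA_surjective y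
    change toA (brP (x + x') y) = toA (brP x y) + toA (brP x' y)
    rw [map_add, LinearMap.add_apply, map_add]
  map_smul' c x := by
    refine LinearMap.ext fun y => ?_
    obtain ⟨y, rfl⟩ := toA_surjective y
    change toA (brP (c • x) y) = c • toA (brP x y)
    rw [map_smul, LinearMap.smul_apply, toA_smul_real]

/-- The bracket of `A`, induced by that of `P`, see `brA_toA`. -/
def brA : AA R →ₗ[ℝ] AA R →ₗ[ℝ] AA R :=
  descendA brA₂ (fun l hl => by
    refine LinearMap.ext fun y => ?_
    obtain ⟨y, rfl⟩ := toA_surjective y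
    rw [LinearMap.zero_apply]
    exact toA_eq_zero.2 (brP_mem_JJ hl y).2)

lemma brA_toA (x y : PP R) : brA (toA x) (toA y) = toA (brP x y) := rfl

end Algebra7

section Algebra8

variable {R : Type*} [CommRing R] [Algebra ℝ R]

variable (R) in
/-- `θ_i` for `i = 1, 2, 3`; the elements of `Fin 3` stand for the indices `1, 2, 3`. -/
abbrev th (i : Fin 3) : Ext R := theta R i.succ

variable (R) in
/-- `θ₀`. -/
abbrev th0 : Ext R := theta R 0

/-- The injection of `Der(C^∞)` into `CDerEnd(W)`: the derivation acts on the coefficients, and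
annihilates the basis elements `θ_a`. -/
def inj (X : Derivation ℝ R R) : CDerEnd R := ⟨(X, 0), 0, by simp⟩

/-- `σ₀ ∈ CEnd(W)`, the identity of `W`. -/
def sig0 : CDerEnd R := ⟨(0, 1), 2, by rw [Matrix.transpose_one, mul_one, one_mul, two_smul]⟩

/-- The boost `σ_i`: `θ₀ ↦ θ_i`, `θ_i ↦ θ₀`, and `0` on the other two basis elements. -/
def sig (i : Fin 3) : CDerEnd R := rot 0 i.succ

/-- The rotation `σ_{ij}`: `θ_i ↦ -θ_j`, `θ_j ↦ θ_i`, and `0` on the other two basis elements. -/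
def sigR (i j : Fin 3) : CDerEnd R := rot i.succ j.succ

lemma sig0_theta (a : Fin 4) : extDer (sig0 (R := R)).1 (theta R a) = theta R a := by
  rw [extDer_theta]
  simp [sig0, Matrix.one_apply]

lemma sig_theta (i : Fin 3) : extDer (sig (R := R) i).1 (th0 R) = th R i ∧
    extDer (sig (R := R) i).1 (th R i) = th0 R ∧
    ∀ j ≠ i, extDer (sig (R := R) i).1 (th R j) = 0 := by
  refine ⟨?_, ?_, fun j hj => ?_⟩ <;> rw [extDer_theta, Fin.sum_univ_four]
  · fin_cases i <;> simp [sig, rot, rotMat_apply, eta] <;> rfl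
  · fin_cases i <;> simp [sig, rot, rotMat_apply, eta]
  · fin_cases i <;> fin_cases j <;> simp at hj <;> simp [sig, rot, rotMat_apply]

lemma sigR_theta (i j : Fin 3) (h : i ≠ j) : extDer (sigR (R := R) i j).1 (th0 R) = 0 ∧
    extDer (sigR (R := R) i j).1 (th R i) = - th R j ∧
    extDer (sigR (R := R) i j).1 (th R j) = th R i ∧
    ∀ k, k ≠ i → k ≠ j → extDer (sigR (R := R) i j).1 (th R k) = 0 := by
  refine ⟨?_, ?_, ?_, fun k hk hk' => ?_⟩ <;> rw [extDer_theta, Fin.sum_univ_four]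
  · fin_cases i <;> fin_cases j <;> simp [sigR, rot, rotMat_apply]
  · fin_cases i <;> fin_cases j <;> simp at h <;> simp [sigR, rot, rotMat_apply, eta] <;> rfl
  · fin_cases i <;> fin_cases j <;> simp at h <;> simp [sigR, rot, rotMat_apply, eta] <;> rfl
  · fin_cases i <;> fin_cases j <;> simp at h <;> fin_cases k <;> simp at hk hk' <;>
      simp [sigR, rot, rotMat_apply]

lemma sigR_eq_bracket (i j : Fin 3) (h : i ≠ j) : ⁅sig (R := R) i, sig (R := R) j⁆ = sigR (R := R) i j := by
  refine Subtype.ext (Prod.ext ?_ ?_)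
  · exact lie_self (0 : Derivation ℝ R R)
  · ext a b
    simp only [coe_bracket, bracketC, sig, sigR, rot, Matrix.add_apply, Matrix.sub_apply,
      Matrix.map_apply, Derivation.zero_apply, sub_zero, zero_add, Matrix.mul_apply,
      Fin.sum_univ_four, rotMat_apply]
    fin_cases i <;> fin_cases j <;> simp at h <;> fin_cases a <;> fin_cases b <;> simp [eta]

/-- The element `u δ` of `L`. -/
abbrev el (u : Ext R) (δ : CDerEnd R) : Lie R := u ⊗ₜ[R] δ

/-- `α` with entry `1` at `i` and `0` elsewhere. -/
abbrev e1 (i : Fin 3) : Fin 3 →₀ ℕ := Finsupp.single i 1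

/-- The table of generators of `G_αE_G`. Here `TableEntry α k l` means that `l` is one of the
generators of `G_αE_G`, and it is homogeneous of degree `k`. The triple `(i, i + 1, i + 2)`, with
addition modulo `3`, is the cyclic triple `(i, j, k)`. -/
inductive TableEntry : (Fin 3 →₀ ℕ) → ℕ → Lie R → Prop
  | g000_D (X : Derivation ℝ R R) : TableEntry 0 0 (el 1 (inj X))
  | g000_a : TableEntry 0 0 (el 1 sig0)
  | g000_b (i : Fin 3) : TableEntry 0 1 (el (th0 R) sig0 + el (th R i) (sig i))
  | g000_c : TableEntry 0 2 (∑ i, (el (th R (i + 1) * th R (i + 2)) (sigR (i + 1) (i + 2)) +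
      (2 : ℝ) • el (th0 R * th R i) (sig i)))
  | g200 (i : Fin 3) : TableEntry (2 • e1 i) 1 (- el (th R i) (sigR (i + 1) (i + 2)) +
      el (th R (i + 1)) (sigR (i + 2) i) + el (th R (i + 2)) (sigR i (i + 1)))
  | g011_a (i : Fin 3) : TableEntry (e1 (i + 1) + e1 (i + 2)) 0 (el 1 (sig i))
  | g011_b (i : Fin 3) : TableEntry (e1 (i + 1) + e1 (i + 2)) 0 (el 1 (sigR (i + 1) (i + 2)))
  | g011_D (i : Fin 3) (X : Derivation ℝ R R) :
      TableEntry (e1 (i + 1) + e1 (i + 2)) 1 (el (th R i) (inj X))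
  | g011_c (i : Fin 3) : TableEntry (e1 (i + 1) + e1 (i + 2)) 1
      (el (th0 R) (sig i) + el (th R i) sig0)
  | g011_d (i : Fin 3) : TableEntry (e1 (i + 1) + e1 (i + 2)) 1
      (el (th R (i + 1)) (sig (i + 2)) + el (th R (i + 2)) (sig (i + 1)))
  | g011_e (i : Fin 3) : TableEntry (e1 (i + 1) + e1 (i + 2)) 1
      (el (th R (i + 2)) (sigR (i + 2) i))
  | g011_f (i : Fin 3) : TableEntry (e1 (i + 1) + e1 (i + 2)) 1
      (el (th R (i + 1)) (sigR i (i + 1)))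
  | g011_g (i : Fin 3) : TableEntry (e1 (i + 1) + e1 (i + 2)) 2
      (el (th0 R * th R (i + 1)) (sigR i (i + 1)) + el (th R i * th R (i + 1)) (sig (i + 1)))
  | g211_a (i : Fin 3) : TableEntry (2 • e1 i + e1 (i + 1) + e1 (i + 2)) 1
      (el (th R (i + 1)) (sig (i + 2)) - el (th R (i + 2)) (sig (i + 1)))
  | g211_D (i : Fin 3) (X : Derivation ℝ R R) :
      TableEntry (2 • e1 i + e1 (i + 1) + e1 (i + 2)) 2 (el (th R (i + 1) * th R (i + 2)) (inj X))
  | g211_b (i : Fin 3) : TableEntry (2 • e1 i + e1 (i + 1) + e1 (i + 2)) 2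
      (el (th0 R * th R (i + 1)) (sig (i + 2)) - el (th0 R * th R (i + 2)) (sig (i + 1)) -
        (2 : ℝ) • el (th R (i + 1) * th R (i + 2)) sig0)
  | g211_c (i : Fin 3) : TableEntry (2 • e1 i + e1 (i + 1) + e1 (i + 2)) 2
      (el (th0 R * th R (i + 1)) (sig (i + 2)) + el (th0 R * th R (i + 2)) (sig (i + 1)) -
        (2 : ℝ) • el (th R i * th R (i + 1)) (sigR (i + 2) i))
  | g222_a : TableEntry (∑ i, 2 • e1 i) 2
      (∑ i, (el (th0 R * th R i) (sigR (i + 1) (i + 2)) -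
        (2 : ℝ) • el (th R (i + 1) * th R (i + 2)) (sig i)))
  | g222_D (X : Derivation ℝ R R) :
      TableEntry (∑ i, 2 • e1 i) 3 (el (th R 0 * th R 1 * th R 2) (inj X))
  | g222_b : TableEntry (∑ i, 2 • e1 i) 3
      ((∑ i, el (th0 R * th R (i + 1) * th R (i + 2)) (sig i)) +
        (3 : ℝ) • el (th R 0 * th R 1 * th R 2) sig0)

variable (R) in
/-- The degree `k` part of `G_αE_G`, the `C^∞`-span of the entries of the table. -/
def GEG (α : Fin 3 →₀ ℕ) (k : ℕ) : Submodule R (EE R) :=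
  Submodule.span R {x | ∃ l, TableEntry α k l ∧ x = toE l}

variable (R) in
/-- The degree `k` part of `G_αE = G_αE_G ⊕ θ₀ G_αE_G`. -/
def GE (α : Fin 3 →₀ ℕ) (k : ℕ) : Submodule R (EE R) :=
  GEG R α k ⊔ Submodule.span R {x | ∃ k' l, k' + 1 = k ∧ TableEntry α k' l ∧ x = th0 R • toE l}

open Classical in
/-- The power series `s^α x` with a single term. -/
def single (α : Fin 3 →₀ ℕ) (x : EE R) : PowSer (EE R) := fun β => if β = α then x else 0

lemma single_mem {α : Fin 3 →₀ ℕ} {x : EE R} (h : x ∈ fil3 R α) : single α x ∈ PP R := by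
  intro β
  unfold single
  split_ifs with hβ
  · rw [hβ]; exact h
  · exact zero_mem _

open Classical in
/-- The class of `s^α x` in `A`, for `x ∈ F_αE`. -/
def cls (α : Fin 3 →₀ ℕ) (x : EE R) : AA R :=
  if h : x ∈ fil3 R α then toA ⟨single α x, single_mem h⟩ else 0

lemma cls_of_mem {α : Fin 3 →₀ ℕ} {x : EE R} (h : x ∈ fil3 R α) :
    cls α x = toA ⟨single α x, single_mem h⟩ := dif_pos h

/-- The class of `s^α f l` in `A`, for a function `f`, and `l ∈ L` whose image in `E` is in `F_αE`. -/
def mon (α : Fin 3 →₀ ℕ) (f : R) (l : Lie R) : AA R := cls α (f • toE l)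

variable (R) in
/-- The degree `k` part of `G_αA`, the copy `s^α G_αE` of `G_αE` in `A`. -/
def GA (α : Fin 3 →₀ ℕ) (k : ℕ) : Submodule R (AA R) := Submodule.span R (cls α '' GE R α k)

variable (R) in
/-- The degree `k` part of `G_αA_G`, the copy `s^α G_αE_G` of `G_αE_G` in `A`. -/
def GAG (α : Fin 3 →₀ ℕ) (k : ℕ) : Submodule R (AA R) := Submodule.span R (cls α '' GEG R α k)

variable (R) in
/-- The part of `E` of degree `k`. -/
def degE (k : ℕ) : Submodule R (EE R) :=
  Submodule.span R {x | ∃ u ∈ ⋀[R]^k (Fin 4 → R), ∃ δ, x = toE (el u δ)}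

variable (R) in
/-- The part of `P` of degree `k`. -/
def degP (k : ℕ) : Set (PP R) := {x | ∀ α, x.1 α ∈ degE R k}

variable (R) in
/-- The part of `A` of degree `k`. -/
def degA (k : ℕ) : Set (AA R) := toA '' degP R k

/-- `θ₀D₀`, for a vector field `D₀`. -/
def lD (D₀ : Derivation ℝ R R) : Lie R := el (th0 R) (inj D₀)

/-- `θ₀σ₀ + θ_iσ_i`. -/
def lS (i : Fin 3) : Lie R := el (th0 R) sig0 + el (th R i) (sig i)

/-- Automorphisms of the real graded Lie algebra `A`. -/
structure IsAutA (φ : Module.End ℝ (AA R)) : Prop where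
  bijective : Function.Bijective φ
  bracket : ∀ x y, φ (brA x y) = brA (φ x) (φ y)
  degree : ∀ k, φ '' degA R k = degA R k

/-- `ℝ[[s₁, s₂, s₃]]`-linear automorphisms of the graded Lie algebra `P`. -/
structure IsAutP (Φ : PP R ≃ₗ[MvPowerSeries (Fin 3) ℝ] PP R) : Prop where
  bracket : ∀ x y, Φ (brP x y) = brP (Φ x) (Φ y)
  degree : ∀ k, Φ '' degP R k = degP R k

/-- The exponential of a nilpotent operator. -/
def nilExp {V : Type*} [AddCommGroup V] [Module ℝ V] (a : Module.End ℝ V) : Module.End ℝ V :=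
  ∑ n ∈ Finset.range (nilpotencyClass a), (n.factorial : ℝ)⁻¹ • a ^ n

/-- `exp([x, -])` on `A`. -/
def expAd (x : AA R) : Module.End ℝ (AA R) := nilExp (brA x)

/-- The affine gauge subspace `θ₀D₀ + A_G¹`, for a vector field `D₀`. -/
def affineGauge (D₀ : Derivation ℝ R R) : Set (AA R) :=
  {y | ∃ a ∈ ⨆ α, GAG R α 1, y = mon 0 1 (lD D₀) + a}

/-- The functions `γ_i⁰` are the coefficients of `y ∈ θ₀D₀ + A_G¹` in front of
`-(θ₀σ₀ + θ_iσ_i)`: the sum `y - θ₀D₀ + ∑ γ_i⁰ (θ₀σ₀ + θ_iσ_i)` has only components with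
`α ≠ 000`. -/
def HasGamma0 (D₀ : Derivation ℝ R R) (y : AA R) (γ : Fin 3 → R) : Prop :=
  y - mon 0 1 (lD D₀) +
    ∑ i, mon 0 (γ i) (lS i) ∈
      ⨆ α, ⨆ _ : α ≠ 0, GAG R α 1

end Algebra8

section Base

open scoped Manifold ContDiff

/-- The ring `C^∞(ℝ × S, ℝ)` of smooth functions on the base manifold. -/
abbrev Fun (S : Type*) [TopologicalSpace S] [ChartedSpace (EuclideanSpace ℝ (Fin 3)) S] : Type _ :=
  C^∞⟮(𝓘(ℝ, ℝ)).prod (𝓡 3), ℝ × S; ℝ⟯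

variable {S : Type*} [TopologicalSpace S] [ChartedSpace (EuclideanSpace ℝ (Fin 3)) S]

lemma slice_smooth (f : Fun S) (x : S) : ContMDiff 𝓘(ℝ, ℝ) 𝓘(ℝ, ℝ) ∞ (fun t => f (t, x)) :=
  f.contMDiff.comp (contMDiff_id.prodMk contMDiff_const)

lemma slice_diff (f : Fun S) (p : ℝ × S) : DifferentiableAt ℝ (fun t => f (t, p.2)) p.1 :=
  (slice_smooth f p.2).contDiff.differentiable (by simp) p.1

/-- `e^f`. -/
def expFun (f : Fun S) : Fun S := ⟨fun p => Real.exp (f p), Real.contDiff_exp.contMDiff.comp f.contMDiff⟩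

variable [IsManifold (𝓡 3) ∞ S]

lemma d0_smooth (f : Fun S) : ContMDiff ((𝓘(ℝ, ℝ)).prod (𝓡 3)) 𝓘(ℝ, ℝ) ∞
    (fun p : ℝ × S => deriv (fun t => f (t, p.2)) p.1) := by
  intro p
  have : IsManifold (𝓡 3) 1 S := IsManifold.of_le (n := ∞) (by simp)
  have h := ContMDiffAt.mfderiv (I := 𝓘(ℝ, ℝ)) (I' := 𝓘(ℝ, ℝ)) (J := (𝓘(ℝ, ℝ)).prod (𝓡 3))
    (m := ∞) (n := ∞) (x₀ := p) (fun (q : ℝ × S) (t : ℝ) => f (t, q.2)) (fun q => q.1) ?_ ?_ ?_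
  · have e :  _ = _ := inTangentCoordinates_model_space (I := 𝓘(ℝ, ℝ)) (I' := 𝓘(ℝ, ℝ))
      (fun q : ℝ × S => q.1) (fun q => f (q.1, q.2))
      (fun q => (mfderiv 𝓘(ℝ, ℝ) 𝓘(ℝ, ℝ) (fun t : ℝ => f (t, q.2)) q.1 : ℝ →L[ℝ] ℝ)) p
    rw [e] at h
    have h2 := h.clm_apply (contMDiffAt_const (c := (1 : ℝ)))
    refine h2.congr_of_eventuallyEq (Filter.Eventually.of_forall fun q => ?_)
    have e' : mfderiv 𝓘(ℝ, ℝ) 𝓘(ℝ, ℝ) (fun t : ℝ => f (t, q.2)) q.1 =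
        fderiv ℝ (fun t : ℝ => f (t, q.2)) q.1 := mfderiv_eq_fderiv
    exact (fderiv_apply_one_eq_deriv.symm.trans (DFunLike.congr_fun e'.symm (1 : ℝ)))
  · exact (f.contMDiff.comp (contMDiff_snd.prodMk (contMDiff_snd.comp contMDiff_fst))).contMDiffAt
  · exact contMDiffAt_fst
  · simp

variable (S) in
/-- The vector field `D₀ = ∂/∂t`, the partial derivative along the first factor of `ℝ × S`. -/
def D0 : Derivation ℝ (Fun S) (Fun S) :=
  Derivation.mk'
    { toFun := fun f => ⟨fun p => deriv (fun t => f (t, p.2)) p.1, d0_smooth f⟩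
      map_add' := fun f g => by
        ext p
        exact deriv_add (slice_diff f p) (slice_diff g p)
      map_smul' := fun c f => by
        ext p
        exact deriv_const_mul c (slice_diff f p) }
    (fun f g => by
      ext p
      change deriv (fun t => f (t, p.2) * g (t, p.2)) p.1 = f p * deriv (fun t => g (t, p.2)) p.1 +
        g p * deriv (fun t => f (t, p.2)) p.1
      have := deriv_mul (slice_diff f p) (slice_diff g p)
      refine this.trans ?_
      ring)

lemma D0_apply (f : Fun S) (p : ℝ × S) : D0 S f p = deriv (fun t => f (t, p.2)) p.1 := rfl

end Base

end BKL

end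

open BKL
open scoped Manifold ContDiff

open scoped TensorProduct

namespace BKL

/-! ### Monomials and coefficient functionals in the exterior algebra. -/

section ExteriorMonomials

variable {R : Type*} [CommRing R]

/-! One mechanism gives the automorphisms. If `x` is a sum of terms `s^α δ` with `α ≠ 000` and `δ`
of exterior degree `0`, then `[x, -]` is a derivation without signs that strictly raises the order
in `s`. On the Rees algebra `P` its exponential therefore converges coefficient by coefficient, has
the inverse `exp(-[x, -])`, and respects brackets by the binomial form of Leibniz' rule
(`pow_brP_brP`, `expP_brP`). It is linear over real power series in `s`, hence preserves the ideal
`(s₁, s₂, s₃)` and descends to `A`.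

Nilpotency on `A` comes from stationarity of the filtration. Only two basis elements have positive
weight, so `F_{p+1} ⊆ F_p` for `p ≥ 2` (`fil_le_pred`). Hence a coefficient with an index entry `≥
3` lies in the ideal (`mem_JJ_of_forall_le_two`), total order `7` is zero in `A`, and `[x, -]⁷ = 0`.

That the table lies in the filtration reduces to a finite check: a first order operator is
controlled by its symbol and its value at `1` (`toE_mem_triFil`). For the entries without a vector
field this is integer arithmetic with monomials, which is decided by evaluation
(`tableEntry_mem_fil3`). In the explicit formulas the second bracket carries `s^{2α}` but has its
coefficient in `F_{000}E`; it is zero in `A`, and the exponential stops after the linear term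
(`expAd_cls_zero`).

For the gauge conditions write `y = θ₀D₀ - ∑ γ_l(θ₀σ₀ + θ_lσ_l) + v`, with `v` in the pieces `α ≠
000`. The part `v` never leaves the gauge subspace, because the bracket of the generator with a
table entry of degree `1` and nonzero index is, modulo lower steps, again in the span of the table
(`brE_sig_mem_gaugeFil`, `brE_sigR_mem_gaugeFil`). What remains modulo the gauge subspace sits at
index `e_j + e_k`: it is `-(D₀f - (γ_j + γ_k)f) θ₀σ_i` for the boost and `-D₀f θ₀σ_{jk}` for the
rotation. The functionals `boostForm` and `rotForm` vanish on the lower steps and on the gauge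
entries of that index, but not on `θ₀σ_i` and `θ₀σ_{jk}` respectively, so the remainder has to be
zero. Functionals of the same kind give uniqueness of the `γ_l` and the failure to preserve the
grading. The equivalent condition with `μ` is an integrating factor. -/

lemma mono_nil : mono R [] = 1 := by simp [mono]

lemma mono_singleton (a : Fin 4) : mono R [a] = theta R a := by simp [mono]

lemma theta_mul_self (a : Fin 4) : theta R a * theta R a = 0 :=
  ExteriorAlgebra.ι_sq_zero _

lemma theta_mul_swap (a b : Fin 4) : theta R a * theta R b = -(theta R b * theta R a) :=
  eq_neg_of_add_eq_zero_left (ExteriorAlgebra.ι_add_mul_swap _ _)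

/-- The form on which alternating forms can be evaluated and on which repeated factors are seen to
vanish. -/
lemma mono_eq_ιMulti (l : List (Fin 4)) :
    mono R l = ExteriorAlgebra.ιMulti R l.length (fun i => Pi.single (l.get i) (1 : R)) := by
  rw [ExteriorAlgebra.ιMulti_apply, mono]
  congr 1
  apply List.ext_get
  · simp
  · intro n h1 h2
    simp [theta]

lemma mono_eq_zero_of_not_nodup {l : List (Fin 4)} (h : ¬ l.Nodup) : mono R l = 0 := by
  rw [mono_eq_ιMulti]
  refine ExteriorAlgebra.ιMulti_eq_zero_of_not_inj fun hinj => h ?_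
  rw [List.nodup_iff_injective_get]
  intro i j hij
  exact hinj (by simp only [hij])

lemma wtL_cons (m : Fin 3) (a : Fin 4) (l : List (Fin 4)) :
    wtL m (a :: l) = wt m a + wtL m l := by simp [wtL]

/-- In each of the three decompositions exactly two basis elements have weight `1`, and each can
occur only once. -/
lemma wtL_le_two_of_nodup (m : Fin 3) {l : List (Fin 4)} (h : l.Nodup) : wtL m l ≤ 2 := by
  have h1 : wtL m l = ∑ a ∈ l.toFinset, wt m a := by
    rw [wtL, List.sum_toFinset _ h]
  have h2 : ∀ m, ∑ a, wt m a = 2 := by decide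
  rw [h1, ← h2 m]
  exact Finset.sum_le_sum_of_subset (Finset.subset_univ _)

lemma mono_mem_extFil {m : Fin 3} {q : ℕ} {l : List (Fin 4)} (h : wtL m l ≤ q)
    (h' : wtL m l % 2 = q % 2) : mono R l ∈ extFil R m q :=
  Submodule.subset_span ⟨l, h, h', rfl⟩

lemma theta_mem_extFil (m : Fin 3) (a : Fin 4) : theta R a ∈ extFil R m (wt m a) := by
  rw [← mono_singleton]
  exact mono_mem_extFil (by simp [wtL]) (by simp [wtL])

lemma mul_mem_extFil {m : Fin 3} {q q' : ℕ} {u u' : Ext R} (hu : u ∈ extFil R m q)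
    (hu' : u' ∈ extFil R m q') : u * u' ∈ extFil R m (q + q') := by
  induction hu using Submodule.span_induction with
  | zero => rw [zero_mul]; exact zero_mem _
  | add x y _ _ hx hy => rw [add_mul]; exact add_mem hx hy
  | smul r x _ hx => rw [smul_mul_assoc]; exact Submodule.smul_mem _ _ hx
  | mem x hx =>
    obtain ⟨l, h1, h2, rfl⟩ := hx
    induction hu' using Submodule.span_induction with
    | zero => rw [mul_zero]; exact zero_mem _
    | add x y _ _ hx hy => rw [mul_add]; exact add_mem hx hy
    | smul r x _ hx => rw [mul_smul_comm]; exact Submodule.smul_mem _ _ hx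
    | mem x hx =>
      obtain ⟨l', h1', h2', rfl⟩ := hx
      rw [← mono_append]
      have : wtL m (l ++ l') = wtL m l + wtL m l' := by simp [wtL]
      exact mono_mem_extFil (by omega) (by omega)

/-- A nonzero monomial has weight at most `2`, so a weight with the parity of `q` cannot exceed `q`
once `q ≥ 1`. For `q = 0` this fails, since weight `2` is then new. -/
lemma extFil_add_two_le (m : Fin 3) {q : ℕ} (hq : 1 ≤ q) : extFil R m (q + 2) ≤ extFil R m q := by
  rw [extFil, Submodule.span_le]
  rintro _ ⟨l, h1, h2, rfl⟩
  by_cases h : l.Nodup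
  · have := wtL_le_two_of_nodup m h
    exact mono_mem_extFil (by omega) (by omega)
  · rw [mono_eq_zero_of_not_nodup h]; exact zero_mem _

/-- The alternating forms whose only nonzero member is the `2 × 2` minor with rows `a`, `b`. -/
noncomputable def minorForms (R : Type*) [CommRing R] (a b : Fin 4) :
    ∀ n : ℕ, (Fin 4 → R) [⋀^Fin n]→ₗ[R] R
  | 2 => Matrix.detRowAlternating.compLinearMap
      (LinearMap.pi ![LinearMap.proj a, LinearMap.proj b])
  | _ => 0

/-- The coefficient of `θ_aθ_b` (for `a ≠ b`). -/
noncomputable def coef2 (R : Type*) [CommRing R] (a b : Fin 4) : Ext R →ₗ[R] R :=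
  ExteriorAlgebra.liftAlternating (minorForms R a b)

lemma coef2_theta_mul_theta (a b c d : Fin 4) :
    coef2 R a b (theta R c * theta R d) =
      (if a = c then if b = d then 1 else 0 else 0) -
        (if a = d then if b = c then 1 else 0 else 0) := by
  have h : theta R c * theta R d =
      ExteriorAlgebra.ιMulti R 2 ![(Pi.single c 1 : Fin 4 → R), Pi.single d 1] := by
    simp [ExteriorAlgebra.ιMulti_apply, theta]
  rw [h, coef2, ExteriorAlgebra.liftAlternating_apply_ιMulti, minorForms,
    AlternatingMap.compLinearMap_apply]
  refine (Matrix.det_fin_two _).trans ?_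
  simp [Pi.single_apply]
  grind

lemma coef2_mono_of_length_ne {a b : Fin 4} {l : List (Fin 4)} (h : l.length ≠ 2) :
    coef2 R a b (mono R l) = 0 := by
  rw [mono_eq_ιMulti, coef2, ExteriorAlgebra.liftAlternating_apply_ιMulti, minorForms]
  · rfl
  · exact h

/-- The tool for showing that something is not in a step of the filtration: `θ_aθ_b` has a definite
weight, and a step contains only monomials of admissible weight and parity. -/
lemma coef2_eq_zero {m : Fin 3} {q : ℕ} {a b : Fin 4} {z : Ext R} (hz : z ∈ extFil R m q)
    (h : q < wt m a + wt m b ∨ q % 2 ≠ (wt m a + wt m b) % 2) : coef2 R a b z = 0 := by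
  induction hz using Submodule.span_induction with
  | zero => exact map_zero _
  | add x y _ _ hx hy => rw [map_add, hx, hy, add_zero]
  | smul r x _ hx => rw [map_smul, hx, smul_zero]
  | mem x hx =>
    obtain ⟨l, h1, h2, rfl⟩ := hx
    by_cases hl : l.length = 2
    · obtain ⟨c, d, rfl⟩ := List.length_eq_two.1 hl
      have e : mono R [c, d] = theta R c * theta R d := by simp [mono]
      have w : wtL m [c, d] = wt m c + wt m d := by simp [wtL]
      rw [e, coef2_theta_mul_theta]
      rw [w] at h1 h2
      split_ifs <;> subst_vars <;> first | omega | simp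
    · exact coef2_mono_of_length_ne hl

end ExteriorMonomials

/-! ### Checking the filtration on the symbol, and its stationarity. -/

section Criterion

variable {R : Type*} [CommRing R] [Algebra ℝ R]

omit [Algebra ℝ R] in
lemma extPiece_mul_theta {m : Fin 3} {a : ZMod 2} {k : ℕ} {u : Ext R} (hu : u ∈ extPiece R m a k)
    (i : Fin 4) : u * theta R i = (-1 : ℤ) ^ k • (theta R i * u) := by
  have := extPiece_comm (theta_mem_extPiece (R := R) m i) hu
  rwa [one_mul] at this

/-- Leibniz' rule for `ωδ`. Moving `ω` past one factor of degree `1` costs the sign in both terms;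
the second term is the symbol, recorded by `ract` with `ω` on the right. -/
lemma repL_theta_mul (c : ℕ) {m : Fin 3} {e : ZMod 2} {k : ℕ} {l : Lie R}
    (hl : l ∈ lPiece R m e k) (i : Fin 4) (z : Ext R) :
    repL c l (theta R i * z) =
      (-1 : ℤ) ^ k • (theta R i * repL c l z + ract (theta R i) l * z) := by
  refine lPiece_induction (p := fun l => repL c l (theta R i * z) =
    (-1 : ℤ) ^ k • (theta R i * repL c l z + ract (theta R i) l * z)) ?_ ?_ ?_ hl
  · simp
  · intro x y hx hy
    simp only [map_add, LinearMap.add_apply, hx, hy, mul_add, add_mul, smul_add]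
    abel
  · intro a b u δ _ hu hδ
    have h1 := extPiece_mul_theta hu i
    have h2 : u * extDer δ.1 (theta R i) = (-1 : ℤ) ^ k • (extDer δ.1 (theta R i) * u) := by
      rw [extDer_theta, Finset.mul_sum, Finset.sum_mul, Finset.smul_sum]
      refine Finset.sum_congr rfl fun j _ => ?_
      rw [mul_smul_comm, smul_mul_assoc, extPiece_mul_theta hu j, smul_comm]
    rw [repL_tmul, repL_tmul, ract_tmul, actTr_mul, mul_add, ← mul_assoc, ← mul_assoc, h1, h2,
      smul_mul_assoc, smul_mul_assoc, smul_add, mul_assoc]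

/-- Functions are central, so differentiating the coefficient costs no sign; the extra term is the
symbol at a function. -/
lemma repL_smul_arg (c : ℕ) (l : Lie R) (r : R) (z : Ext R) :
    repL c l (r • z) = r • repL c l z + ract (algebraMap R _ r) l * z := by
  induction l using TensorProduct.induction_on with
  | zero => simp
  | add a b ha hb =>
    simp only [map_add, LinearMap.add_apply, ha, hb, add_mul, smul_add]; abel
  | tmul u δ =>
    rw [repL_tmul, repL_tmul, ract_tmul, Algebra.smul_def, actTr_mul, extDer_algebraMap, mul_add,
      Algebra.smul_def]
    rw [← mul_assoc, ← Algebra.commutes, mul_assoc, ← mul_assoc u, ← Algebra.commutes (δ.1.1 r) u]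

/-- A first order operator is determined by its symbol, so the stabilizer condition only has to be
checked on functions, on the `θ_a` and on `1`. -/
lemma toE_mem_triFil {m : Fin 3} {p k : ℕ} {l : Lie R} (hl : l ∈ lPiece R m p k)
    (h0 : ∀ r : R, ract (algebraMap R _ r) l ∈ extFil R m p)
    (h1 : ∀ a, ract (theta R a) l ∈ extFil R m (p + wt m a))
    (h2 : ∀ c < 2, repL c l 1 ∈ extFil R m p) : toE l ∈ triFil R m p := by
  -- Leibniz' rule, one letter at a time: the letter times the value on the rest, and the symbol at
  -- the letter times the rest, have the same weight bound.
  have hm : ∀ c < 2, ∀ w : List (Fin 4), repL c l (mono R w) ∈ extFil R m (wtL m w + p) := by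
    intro c hc w
    induction w with
    | nil => rw [mono_nil]; simpa [wtL] using h2 c hc
    | cons a w ih =>
      rw [mono_cons, repL_theta_mul c hl, wtL_cons]
      refine zsmul_mem (add_mem ?_ ?_) _
      · rw [add_assoc]; exact mul_mem_extFil (theta_mem_extFil m a) ih
      · have := mul_mem_extFil (h1 a) (mono_mem_extFil (R := R) (m := m) (l := w) le_rfl rfl)
        rwa [show p + wt m a + wtL m w = wt m a + wtL m w + p by ring] at this
  refine Submodule.mem_iSup_of_mem k ⟨⟨l, hl, rfl⟩, fun c hc q z hz => ?_⟩
  rw [repE_toE]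
  -- `hm` uses the exact weight of the monomial, whereas `q` may exceed that weight by an even
  -- number.
  have h2q : ∀ {q q' : ℕ} {z : Ext R}, z ∈ extFil R m q → q ≤ q' → q % 2 = q' % 2 →
      z ∈ extFil R m q' := by
    intro q q' z hz h h'
    refine Submodule.span_mono ?_ hz
    rintro _ ⟨l, a, b, rfl⟩
    exact ⟨l, by omega, by omega, rfl⟩
  induction hz using Submodule.span_induction with
  | zero => rw [map_zero]; exact zero_mem _
  | add x y _ _ hx hy => rw [map_add]; exact add_mem hx hy
  | smul r x hx' hx =>
    rw [repL_smul_arg, add_comm q]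
    refine add_mem (Submodule.smul_mem _ _ (by rwa [add_comm])) (mul_mem_extFil (h0 r) hx')
  | mem x hx =>
    obtain ⟨w, a, b, rfl⟩ := hx
    exact h2q (hm c hc w) (by omega) (by omega)

lemma triFil_le_fil {m : Fin 3} {p q : ℕ} (h : q ≤ p) : triFil R m q ≤ fil R m p :=
  le_iSup₂_of_le (f := fun r (_ : r ≤ p) => triFil R m r) q h le_rfl

lemma smul_mem_lPiece {m : Fin 3} {a e : ZMod 2} {j k : ℕ} {u : Ext R} {l : Lie R}
    (hu : u ∈ extPiece R m a j) (hl : l ∈ lPiece R m e k) :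
    u • l ∈ lPiece R m (a + e) (j + k) := by
  refine lPiece_induction (p := fun l => u • l ∈ lPiece R m (a + e) (j + k)) ?_ ?_ ?_ hl
  · rw [smul_zero]; exact zero_mem _
  · intro x y hx hy; rw [smul_add]; exact add_mem hx hy
  · intro a' b u' δ hab hu' hδ
    rw [TensorProduct.smul_tmul', smul_eq_mul]
    exact Submodule.subset_span ⟨_, _, _, _, by rw [← hab, add_assoc], mul_mem_extPiece hu hu', hδ,
      rfl⟩

/-- `θ₀` lies in `W₀` for all three decompositions, so it has weight `0`. This is why `θ₀ G_αE_G`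
can be put at the same index as `G_αE_G`. -/
lemma th0_smul_mem_triFil {m : Fin 3} {p : ℕ} {x : EE R} (hx : x ∈ triFil R m p) :
    th0 R • x ∈ triFil R m p := by
  have hw : wt m 0 = 0 := rfl
  rw [triFil] at hx
  induction hx using Submodule.iSup_induction' with
  | zero => rw [smul_zero]; exact zero_mem _
  | add x x' _ _ h h' => rw [smul_add]; exact add_mem h h'
  | mem k x hx =>
    obtain ⟨⟨x, hx1, rfl⟩, hx2⟩ := hx
    refine Submodule.mem_iSup_of_mem (1 + k) ⟨⟨th0 R • x, ?_, (toE (R := R)).map_smul _ _⟩, ?_⟩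
    · have := smul_mem_lPiece (theta_mem_extPiece (R := R) m 0) hx1
      simpa [hw] using this
    · intro c hc q z hz
      have := mul_mem_extFil (theta_mem_extFil (R := R) m 0) (hx2 c hc q z hz)
      rw [hw, zero_add] at this
      change repE c (th0 R • toE x) z ∈ _
      rw [← map_smul, repE_toE, repL_smul]
      exact this

lemma th0_smul_mem_fil {m : Fin 3} {p : ℕ} {x : EE R} (hx : x ∈ fil R m p) :
    th0 R • x ∈ fil R m p := by
  rw [fil] at hx
  induction hx using Submodule.iSup_induction' with
  | zero => rw [smul_zero]; exact zero_mem _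
  | add x x' _ _ h h' => rw [smul_add]; exact add_mem h h'
  | mem q x hx =>
    induction hx using Submodule.iSup_induction' with
    | zero => rw [smul_zero]; exact zero_mem _
    | add x x' _ _ h h' => rw [smul_add]; exact add_mem h h'
    | mem hq x hx => exact triFil_le_fil hq (th0_smul_mem_triFil hx)

lemma th0_smul_mem_fil3 {α : Fin 3 →₀ ℕ} {x : EE R} (hx : x ∈ fil3 R α) :
    th0 R • x ∈ fil3 R α :=
  ⟨⟨th0_smul_mem_fil hx.1.1, th0_smul_mem_fil hx.1.2⟩, th0_smul_mem_fil hx.2⟩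

lemma mem_fil3 {α : Fin 3 →₀ ℕ} {x : EE R} (h : ∀ m, x ∈ fil R m (α m)) : x ∈ fil3 R α :=
  ⟨⟨h 0, h 1⟩, h 2⟩

lemma fil_of_mem_fil3 {α : Fin 3 →₀ ℕ} {x : EE R} (h : x ∈ fil3 R α) (m : Fin 3) :
    x ∈ fil R m (α m) := by
  fin_cases m
  exacts [h.1.1, h.1.2, h.2]

/-- For `p ≥ 1` every target index `q + p` is at least `1`, where lowering the index of the
filtration of `∧W` by `2` loses nothing. The `ℤ₂`-degree does not change. -/
lemma triFil_add_two_le (m : Fin 3) {p : ℕ} (hp : 1 ≤ p) : triFil R m (p + 2) ≤ triFil R m p := by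
  refine iSup_mono fun k => inf_le_inf ?_ ?_
  · have : ((p + 2 : ℕ) : ZMod 2) = p := by
      push_cast
      rw [show (2 : ZMod 2) = 0 from rfl, add_zero]
    rw [this]
  · intro x hx c hc q z hz
    exact extFil_add_two_le m (by omega) (hx c hc q z hz)

/-- The only new summand of `F_{p+1}` is `F_{⊲p+1}`, which sits inside `F_{⊲p-1}`; this needs `p - 1
≥ 1`. -/
lemma fil_le_pred (m : Fin 3) {p : ℕ} (hp : 2 ≤ p) : fil R m (p + 1) ≤ fil R m p := by
  refine iSup₂_le fun q hq => ?_
  by_cases h : q ≤ p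
  · exact triFil_le_fil h
  · obtain rfl : q = (p - 1) + 2 := by omega
    exact (triFil_add_two_le m (by omega)).trans (triFil_le_fil (by omega))

lemma fil3_add_single_le {α : Fin 3 →₀ ℕ} {i : Fin 3} (h : 2 ≤ α i) :
    fil3 R (α + e1 i) ≤ fil3 R α := by
  intro x hx
  refine mem_fil3 fun m => ?_
  have := fil_of_mem_fil3 hx m
  by_cases hm : i = m
  · subst hm
    rw [Finsupp.add_apply, Finsupp.single_eq_same] at this
    exact fil_le_pred _ h this
  · rwa [Finsupp.add_apply, Finsupp.single_eq_of_ne (Ne.symm hm), add_zero] at this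

end Criterion

/-! ### Decidable membership for integral combinations of monomials. -/

section Normalization

/-- The sign and the list for which `θ_a θ_{b₁} ⋯` is a signed ordered monomial, if `b₁ < b₂ < ⋯`. -/
def insMono (a : Fin 4) : List (Fin 4) → ℤ × List (Fin 4)
  | [] => (1, [a])
  | b :: l =>
    if a = b then (0, b :: l)
    else if a < b then (1, a :: b :: l)
    else (-(insMono a l).1, b :: (insMono a l).2)

/-- Signed reordering of a monomial. -/
def normMono : List (Fin 4) → ℤ × List (Fin 4)
  | [] => (1, [])
  | a :: l => ((normMono l).1 * (insMono a (normMono l).2).1, (insMono a (normMono l).2).2)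

variable {R : Type*} [CommRing R]

/-- True for every list. Sortedness only serves to bring equal monomials to the same list, so that
they can be collected. -/
lemma theta_mul_mono (a : Fin 4) (l : List (Fin 4)) :
    theta R a * mono R l = (insMono a l).1 • mono R (insMono a l).2 := by
  induction l with
  | nil => simp [insMono, mono]
  | cons b l ih =>
    rw [insMono]
    split_ifs with h h'
    · rw [h, mono_cons, ← mul_assoc, theta_mul_self, zero_mul, zero_smul]
    · rw [one_smul, mono_cons a]
    · rw [mono_cons, mono_cons, ← mul_assoc, theta_mul_swap a b, neg_mul, mul_assoc, ih,
        mul_smul_comm, neg_smul]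

lemma mono_eq_normMono (l : List (Fin 4)) :
    mono R l = (normMono l).1 • mono R (normMono l).2 := by
  induction l with
  | nil => simp [normMono]
  | cons a l ih =>
    rw [mono_cons, ih, mul_smul_comm, theta_mul_mono, smul_smul]; rfl

variable (R) in
/-- The element of the exterior algebra given by a list of monomials with coefficients. -/
def evalPoly (P : List (ℤ × List (Fin 4))) : Ext R := (P.map fun t => t.1 • mono R t.2).sum

/-- Reordering of all monomials. -/
def normPoly (P : List (ℤ × List (Fin 4))) : List (ℤ × List (Fin 4)) :=
  P.map fun t => (t.1 * (normMono t.2).1, (normMono t.2).2)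

/-- The coefficient of a monomial. -/
def coefPoly (P : List (ℤ × List (Fin 4))) (l : List (Fin 4)) : ℤ :=
  (P.map fun t => if t.2 = l then t.1 else 0).sum

lemma evalPoly_normPoly (P : List (ℤ × List (Fin 4))) :
    evalPoly R (normPoly P) = evalPoly R P := by
  simp only [evalPoly, normPoly, List.map_map]
  congr 1
  refine List.map_congr_left fun t _ => ?_
  simp only [Function.comp]
  rw [mono_eq_normMono t.2, smul_smul]

/-- Collecting equal monomials turns cancellations into zeros among the integers `coefPoly`. -/
lemma evalPoly_eq_sum (P : List (ℤ × List (Fin 4))) (s : Finset (List (Fin 4)))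
    (hs : ∀ t ∈ P, t.2 ∈ s) : evalPoly R P = ∑ l ∈ s, coefPoly P l • mono R l := by
  induction P with
  | nil => simp [evalPoly, coefPoly]
  | cons t P ih =>
    have h1 : evalPoly R (t :: P) = t.1 • mono R t.2 + evalPoly R P := by simp [evalPoly]
    have h2 : ∀ l, coefPoly (t :: P) l = (if t.2 = l then t.1 else 0) + coefPoly P l := by
      intro l; simp [coefPoly]
    rw [h1, ih fun t' ht' => hs t' (List.mem_cons_of_mem _ ht')]
    simp only [h2, add_smul, Finset.sum_add_distrib, ite_smul, zero_smul]
    rw [Finset.sum_ite_eq, if_pos (hs t List.mem_cons_self)]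

/-- Decides that `evalPoly` is in `F_{⊲q}`. -/
def checkPoly (m : Fin 3) (q : ℕ) (P : List (ℤ × List (Fin 4))) : Bool :=
  (normPoly P).all fun t => decide (coefPoly (normPoly P) t.2 = 0) ||
    (decide (wtL m t.2 ≤ q) && decide (wtL m t.2 % 2 = q % 2))

/-- Only monomials whose total coefficient survives have to satisfy the weight condition. This
matters: an entry such as `-θ_iσ_{jk} + θ_jσ_{ki} + θ_kσ_{ij}` has its index `2e_i` only because
terms of too large weight cancel. -/
lemma evalPoly_mem {m : Fin 3} {q : ℕ} {P : List (ℤ × List (Fin 4))}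
    (h : checkPoly m q P = true) : evalPoly R P ∈ extFil R m q := by
  rw [← evalPoly_normPoly, evalPoly_eq_sum (normPoly P) ((normPoly P).map Prod.snd).toFinset
    (fun t ht => by simpa using ⟨t.1, ht⟩)]
  refine sum_mem fun l hl => ?_
  obtain ⟨t, ht, rfl⟩ : ∃ t ∈ normPoly P, t.2 = l := by simpa using hl
  have := List.all_eq_true.1 h t ht
  simp only [Bool.or_eq_true, Bool.and_eq_true, decide_eq_true_eq] at this
  rcases this with h0 | h0
  · rw [h0, zero_smul]; exact zero_mem _
  · exact zsmul_mem (mono_mem_extFil h0.1 h0.2) _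

end Normalization

/-! ### Elements of `E` without vector fields as lists of terms, and a check for `F_αE`. -/

section Terms

/-- A term `c θ_{a₁} ⋯ θ_{aₙ} δ` where `δ` is `σ₀` (`none`) or an infinitesimal rotation. -/
abbrev Term : Type := ℤ × List (Fin 4) × Option (Fin 4 × Fin 4)

/-- The components of `δ θ_a`. -/
def symOp : Option (Fin 4 × Fin 4) → Fin 4 → List (ℤ × Fin 4)
  | none, a => [(1, a)]
  | some (c, d), a => [(if a = d then (if d = 0 then -1 else 1) else 0, c),
      (if a = c then (if c = 0 then 1 else -1) else 0, d)]

/-- The parity of `δ`. -/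
def wtOp (m : Fin 3) : Option (Fin 4 × Fin 4) → ℕ
  | none => 0
  | some (c, d) => wt m c + wt m d

/-- The symbol at `θ_a`. -/
def symPoly (L : List Term) (a : Fin 4) : List (ℤ × List (Fin 4)) :=
  L.flatMap fun t => (symOp t.2.2 a).map fun s => (t.1 * s.1, s.2 :: t.2.1)

/-- The contribution of the trace. -/
def trPoly (L : List Term) : List (ℤ × List (Fin 4)) :=
  L.map fun t => (if t.2.2 = none then 4 * t.1 else 0, t.2.1)

/-- Decides that a list of terms is in `F_{⊲p}E`. -/
def checkTri (m : Fin 3) (p k : ℕ) (L : List Term) : Bool :=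
  (L.all fun t => decide (t.2.1.length = k) &&
    decide ((wtL m t.2.1 + wtOp m t.2.2) % 2 = p % 2)) &&
  ((List.finRange 4).all fun a => checkPoly m (p + wt m a) (symPoly L a)) &&
  checkPoly m p (trPoly L)

/-- Decides that a list of terms is in some `F_{⊲q}E` with `q ≤ p`. -/
def checkFil (m : Fin 3) (p k : ℕ) (L : List Term) : Bool :=
  (List.range (p + 1)).any fun q => checkTri m q k L

variable {R : Type*} [CommRing R] [Algebra ℝ R]

/-- The element `δ` of `CDerEnd(W)`. -/
def opC : Option (Fin 4 × Fin 4) → CDerEnd R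
  | none => sig0
  | some (c, d) => rot c d

variable (R) in
/-- The element of `L` given by a list of terms. -/
def interp (L : List Term) : Lie R := (L.map fun t => t.1 • el (mono R t.2.1) (opC t.2.2)).sum

lemma opC_mem_cPiece (m : Fin 3) (o : Option (Fin 4 × Fin 4)) :
    opC (R := R) o ∈ cPiece R m (wtOp m o : ZMod 2) := by
  rcases o with _ | ⟨c, d⟩
  · refine ⟨fun i j hij => ?_, fun h => absurd Nat.cast_zero h⟩
    simp only [opC, sig0, Matrix.one_apply]
    rw [if_neg]
    rintro rfl
    exact hij (by simp [wtOp, CharTwo.add_self_eq_zero])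
  · refine ⟨fun i j hij => ?_, fun _ => rfl⟩
    simp only [opC, rot, rotMat_apply]
    simp only [wtOp, Nat.cast_add] at hij
    have : ¬ (i = c ∧ j = d) := by rintro ⟨rfl, rfl⟩; exact hij rfl
    have : ¬ (i = d ∧ j = c) := by rintro ⟨rfl, rfl⟩; exact hij (add_comm _ _)
    grind

lemma extDer_opC (o : Option (Fin 4 × Fin 4)) (a : Fin 4) :
    extDer (opC (R := R) o).1 (theta R a) = ((symOp o a).map fun s => s.1 • theta R s.2).sum := by
  rw [extDer_theta]
  rcases o with _ | ⟨c, d⟩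
  · simp [opC, sig0, symOp, Matrix.one_apply]
  · have e : ∀ c : Fin 4, eta R c = if c = 0 then -1 else 1 := by
      intro c; fin_cases c <;> simp [eta]
    simp only [opC, rot, rotMat_apply, symOp, List.map_cons, List.map_nil, List.sum_cons,
      List.sum_nil, add_zero, sub_smul, Finset.sum_sub_distrib, ite_smul, zero_smul,
      Finset.sum_ite_eq', Finset.mem_univ, if_true, e]
    clear e
    split_ifs <;> subst_vars <;> first | contradiction | simp [sub_eq_add_neg]

/-- Boosts and rotations are traceless, while `σ₀` is the identity in rank `4`. -/
lemma trace_opC (o : Option (Fin 4 × Fin 4)) :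
    (opC (R := R) o).1.2.trace = if o = none then 4 else 0 := by
  rcases o with _ | ⟨c, d⟩
  · simp [opC, sig0, Matrix.trace_one]
  · simp only [opC, rot, rotMat, Matrix.trace_sub]
    by_cases h : c = d
    · subst h; simp
    · rw [Matrix.trace_single_eq_of_ne _ _ _ h, Matrix.trace_single_eq_of_ne _ _ _ (Ne.symm h)]
      simp

lemma interp_cons (t : Term) (L : List Term) :
    interp R (t :: L) = t.1 • el (mono R t.2.1) (opC t.2.2) + interp R L := by simp [interp]

lemma ract_interp (L : List Term) (a : Fin 4) :
    ract (theta R a) (interp R L) = evalPoly R (symPoly L a) := by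
  induction L with
  | nil => simp [interp, symPoly, evalPoly]
  | cons t L ih =>
    have : evalPoly R (symPoly (t :: L) a) =
        evalPoly R ((symOp t.2.2 a).map fun s => (t.1 * s.1, s.2 :: t.2.1)) +
          evalPoly R (symPoly L a) := by
      simp [evalPoly, symPoly]
    rw [interp_cons, map_add, ih, this, map_zsmul, ract_tmul, extDer_opC]
    congr 1
    generalize symOp t.2.2 a = s
    induction s with
    | nil => simp [evalPoly]
    | cons x s ih =>
      have : ∀ x s, evalPoly R (x :: s) = x.1 • mono R x.2 + evalPoly R s := by
        intro x s; simp [evalPoly]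
      rw [List.map_cons, List.map_cons, List.sum_cons, this, add_mul, smul_add, ih, mono_cons,
        smul_mul_assoc, smul_smul]

lemma ract_algebraMap_interp (L : List Term) (r : R) :
    ract (algebraMap R _ r) (interp R L) = 0 := by
  induction L with
  | nil => simp [interp]
  | cons t L ih =>
    have : (opC (R := R) t.2.2).1.1 = 0 := by
      rcases t with ⟨_, _, _ | _⟩ <;> rfl
    rw [interp_cons, map_add, ih, map_zsmul, ract_tmul, extDer_algebraMap, this]
    simp

/-- On `1` only the trace acts, and only in `∧W ⊗ ∧⁴W`; this is all that distinguishes the two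
representations. -/
lemma repL_interp_one (c : ℕ) (L : List Term) :
    repL c (interp R L) 1 = c • evalPoly R (trPoly L) := by
  induction L with
  | nil => simp [interp, trPoly, evalPoly]
  | cons t L ih =>
    have h1 : evalPoly R (trPoly (t :: L)) =
        (if t.2.2 = none then 4 * t.1 else 0 : ℤ) • mono R t.2.1 + evalPoly R (trPoly L) := by
      simp [evalPoly, trPoly]
    have h2 : extDer (opC (R := R) t.2.2).1 1 = 0 := by
      rw [← map_one (algebraMap R (Ext R)), extDer_algebraMap]; simp
    rw [interp_cons, map_add, LinearMap.add_apply, ih, h1, smul_add, map_zsmul,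
      LinearMap.smul_apply, repL_tmul, actTr_apply, h2, trace_opC, zero_add, mul_smul_comm, mul_one]
    congr 1
    split_ifs
    · rw [← Nat.cast_smul_eq_nsmul R, ← Int.cast_smul_eq_zsmul R, ← Int.cast_smul_eq_zsmul R,
        smul_smul, smul_smul]
      congr 1; push_cast; ring
    · simp

lemma interp_mem_lPiece {m : Fin 3} {p k : ℕ} {L : List Term}
    (h : ∀ t ∈ L, t.2.1.length = k ∧ (wtL m t.2.1 + wtOp m t.2.2) % 2 = p % 2) :
    interp R L ∈ lPiece R m p k := by
  refine list_sum_mem fun x hx => ?_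
  obtain ⟨t, ht, rfl⟩ := List.mem_map.1 hx
  refine zsmul_mem ?_ _
  refine Submodule.subset_span ⟨(wtL m t.2.1 : ZMod 2), (wtOp m t.2.2 : ZMod 2), _, _, ?_,
    Submodule.subset_span ⟨_, (h t ht).1, rfl, rfl⟩, opC_mem_cPiece m _, rfl⟩
  rw [← Nat.cast_add]
  exact (ZMod.natCast_eq_natCast_iff' _ _ _).2 (h t ht).2

/-- No vector field occurs, so the symbol at functions vanishes; what is left is the symbol at the
four `θ_a` and the trace, both with integer coefficients. -/
lemma interp_mem_triFil {m : Fin 3} {p k : ℕ} {L : List Term} (h : checkTri m p k L = true) :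
    toE (interp R L) ∈ triFil R m p := by
  simp only [checkTri, Bool.and_eq_true, List.all_eq_true, decide_eq_true_eq] at h
  refine toE_mem_triFil (interp_mem_lPiece h.1.1) (fun r => ?_) (fun a => ?_) fun c _ => ?_
  · rw [ract_algebraMap_interp]; exact zero_mem _
  · rw [ract_interp]; exact evalPoly_mem (h.1.2 a (List.mem_finRange a))
  · rw [repL_interp_one]; exact nsmul_mem (evalPoly_mem h.2) _

/-- For an element that is homogeneous for each of the three `ℤ₂`-gradings, one `F_{⊲q}` with `q ≤
α_m` suffices for each `m`, and no splitting into two parities is needed. -/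
lemma interp_mem_fil3 {α : Fin 3 →₀ ℕ} {k : ℕ} {L : List Term}
    (h : ∀ m, checkFil m (α m) k L = true) : toE (interp R L) ∈ fil3 R α := by
  refine mem_fil3 fun m => ?_
  obtain ⟨q, hq, hq'⟩ := List.any_eq_true.1 (h m)
  exact triFil_le_fil (by simpa [Nat.lt_succ_iff] using hq) (interp_mem_triFil hq')

/-- The symbol of a monomial times `X` lives on functions only, so the weight of the monomial is the
only condition. -/
lemma inj_mem_fil3 {α : Fin 3 →₀ ℕ} (w : List (Fin 4)) (X : Derivation ℝ R R)
    (h : ∀ m, wtL m w ≤ α m) : toE (el (mono R w) (inj X)) ∈ fil3 R α := by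
  refine mem_fil3 fun m => triFil_le_fil (h m) ?_
  have hX : inj X ∈ cPiece R m 0 := ⟨fun _ _ _ => rfl, fun h => absurd rfl h⟩
  refine toE_mem_triFil (k := w.length) (Submodule.subset_span ⟨_, 0, _, _, add_zero _,
    Submodule.subset_span ⟨w, rfl, rfl, rfl⟩, hX, rfl⟩) (fun r => ?_) (fun a => ?_) fun c _ => ?_
  · rw [ract_tmul, extDer_algebraMap, ← Algebra.smul_def]
    exact Submodule.smul_mem _ _ (mono_mem_extFil le_rfl rfl)
  · rw [ract_tmul, extDer_theta]
    simp [inj]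
  · rw [repL_tmul, actTr_apply, ← map_one (algebraMap R (Ext R)), extDer_algebraMap]
    simp [inj]

end Terms

/-! ### The table lies in the filtration. -/

section Table

variable {R : Type*} [CommRing R] [Algebra ℝ R]

lemma e1_apply (i m : Fin 3) : e1 i m = if i = m then 1 else 0 := Finsupp.single_apply

lemma e1_add_apply (i j m : Fin 3) :
    (e1 i + e1 j) m = (if i = m then 1 else 0) + (if j = m then 1 else 0) := by
  rw [Finsupp.add_apply, e1_apply, e1_apply]

lemma two_e1_apply (i m : Fin 3) : (2 • e1 i) m = if i = m then 2 else 0 := by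
  rw [Finsupp.smul_apply, e1_apply]; split_ifs <;> rfl

lemma two_e1_add_apply (i j k m : Fin 3) : (2 • e1 i + e1 j + e1 k) m =
    (if i = m then 2 else 0) + (if j = m then 1 else 0) + (if k = m then 1 else 0) := by
  rw [Finsupp.add_apply, Finsupp.add_apply, e1_apply, e1_apply, two_e1_apply]

lemma sum_two_e1_apply (m : Fin 3) : (∑ i, 2 • e1 i : Fin 3 →₀ ℕ) m = 2 := by
  rw [Finsupp.finsetSum_apply]
  simp only [two_e1_apply]
  simp

/-- The entries of `α` are supplied as an explicit function `a`, on which the check reduces by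
evaluation. -/
lemma interp_mem_fil3' {α : Fin 3 →₀ ℕ} {a : Fin 3 → ℕ} (k : ℕ) (L : List Term) {l : Lie R}
    (hα : ∀ m, α m = a m) (hl : l = interp R L) (h : ∀ m, checkFil m (a m) k L = true) :
    toE l ∈ fil3 R α := by
  rw [hl]
  exact interp_mem_fil3 fun m => by rw [hα]; exact h m

/-- Entries with a vector field `X` are settled by the weight of their monomial. Every other entry
is rewritten as a list of terms with integer coefficients, and the three filtrations are checked by
evaluation. -/
lemma tableEntry_mem_fil3 {α : Fin 3 →₀ ℕ} {k : ℕ} {l : Lie R} (h : TableEntry α k l) :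
    toE l ∈ fil3 R α := by
  cases h with
  | g000_D X =>
    rw [← mono_nil]
    exact inj_mem_fil3 [] X fun m => Nat.zero_le _
  | g000_a =>
    refine interp_mem_fil3' 0 [(1, [], none)] (fun m => rfl) ?_ ?_
    · simp [interp, mono, opC]
    · decide
  | g000_b i =>
    refine interp_mem_fil3' 1 [(1, [0], none), (1, [i.succ], some (0, i.succ))] (fun m => rfl) ?_ ?_
    · simp [interp, mono, opC, sig]
    · revert i; decide
  | g000_c =>
    refine interp_mem_fil3' 2
      ((List.finRange 3).flatMap fun i => [(1, [(i + 1).succ, (i + 2).succ],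
        some ((i + 1).succ, (i + 2).succ)), (2, [0, i.succ], some (0, i.succ))]) (fun m => rfl) ?_ ?_
    · simp [interp, mono, opC, sig, sigR, Fin.sum_univ_three, List.finRange_succ, ofNat_smul_eq_nsmul]
      abel
    · decide
  | g200 i =>
    refine interp_mem_fil3' 1 [(-1, [i.succ], some ((i + 1).succ, (i + 2).succ)),
      (1, [(i + 1).succ], some ((i + 2).succ, i.succ)),
      (1, [(i + 2).succ], some (i.succ, (i + 1).succ))] (two_e1_apply i) ?_ ?_
    · simp [interp, mono, opC, sigR, add_assoc]
    · revert i; decide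
  | g011_a i =>
    refine interp_mem_fil3' 0 [(1, [], some (0, i.succ))] (e1_add_apply _ _) ?_ ?_
    · simp [interp, mono, opC, sig]
    · revert i; decide
  | g011_b i =>
    refine interp_mem_fil3' 0 [(1, [], some ((i + 1).succ, (i + 2).succ))] (e1_add_apply _ _) ?_ ?_
    · simp [interp, mono, opC, sigR]
    · revert i; decide
  | g011_D i X =>
    rw [th, ← mono_singleton]
    refine inj_mem_fil3 _ X fun m => ?_
    rw [e1_add_apply]
    revert i m; decide
  | g011_c i =>
    refine interp_mem_fil3' 1 [(1, [0], some (0, i.succ)), (1, [i.succ], none)]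
      (e1_add_apply _ _) ?_ ?_
    · simp [interp, mono, opC, sig]
    · revert i; decide
  | g011_d i =>
    refine interp_mem_fil3' 1 [(1, [(i + 1).succ], some (0, (i + 2).succ)),
      (1, [(i + 2).succ], some (0, (i + 1).succ))] (e1_add_apply _ _) ?_ ?_
    · simp [interp, mono, opC, sig]
    · revert i; decide
  | g011_e i =>
    refine interp_mem_fil3' 1 [(1, [(i + 2).succ], some ((i + 2).succ, i.succ))]
      (e1_add_apply _ _) ?_ ?_
    · simp [interp, mono, opC, sigR]
    · revert i; decide
  | g011_f i =>
    refine interp_mem_fil3' 1 [(1, [(i + 1).succ], some (i.succ, (i + 1).succ))]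
      (e1_add_apply _ _) ?_ ?_
    · simp [interp, mono, opC, sigR]
    · revert i; decide
  | g011_g i =>
    refine interp_mem_fil3' 2 [(1, [0, (i + 1).succ], some (i.succ, (i + 1).succ)),
      (1, [i.succ, (i + 1).succ], some (0, (i + 1).succ))] (e1_add_apply _ _) ?_ ?_
    · simp [interp, mono, opC, sig, sigR]
    · revert i; decide
  | g211_a i =>
    refine interp_mem_fil3' 1 [(1, [(i + 1).succ], some (0, (i + 2).succ)),
      (-1, [(i + 2).succ], some (0, (i + 1).succ))] (two_e1_add_apply _ _ _) ?_ ?_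
    · simp [interp, mono, opC, sig, sub_eq_add_neg]
    · revert i; decide
  | g211_D i X =>
    have : th R (i + 1) * th R (i + 2) = mono R [(i + 1).succ, (i + 2).succ] := by simp [mono]
    rw [this]
    refine inj_mem_fil3 _ X fun m => ?_
    rw [two_e1_add_apply]
    clear this
    revert i m; decide
  | g211_b i =>
    refine interp_mem_fil3' 2 [(1, [0, (i + 1).succ], some (0, (i + 2).succ)),
      (-1, [0, (i + 2).succ], some (0, (i + 1).succ)), (-2, [(i + 1).succ, (i + 2).succ], none)]
      (two_e1_add_apply _ _ _) ?_ ?_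
    · simp [interp, mono, opC, sig, sub_eq_add_neg, ofNat_smul_eq_nsmul, add_assoc]
    · revert i; decide
  | g211_c i =>
    refine interp_mem_fil3' 2 [(1, [0, (i + 1).succ], some (0, (i + 2).succ)),
      (1, [0, (i + 2).succ], some (0, (i + 1).succ)),
      (-2, [i.succ, (i + 1).succ], some ((i + 2).succ, i.succ))]
      (two_e1_add_apply _ _ _) ?_ ?_
    · simp [interp, mono, opC, sig, sigR, sub_eq_add_neg, ofNat_smul_eq_nsmul, add_assoc]
    · revert i; decide
  | g222_a =>
    refine interp_mem_fil3' 2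
      ((List.finRange 3).flatMap fun i => [(1, [0, i.succ], some ((i + 1).succ, (i + 2).succ)),
        (-2, [(i + 1).succ, (i + 2).succ], some (0, i.succ))]) sum_two_e1_apply ?_ ?_
    · simp [interp, mono, opC, sig, sigR, th, Fin.sum_univ_three, List.finRange_succ,
        ofNat_smul_eq_nsmul]
      abel
    · decide
  | g222_D X =>
    have : th R 0 * th R 1 * th R 2 = mono R [1, 2, 3] := by simp [mono, mul_assoc]; rfl
    rw [this]
    refine inj_mem_fil3 _ X fun m => ?_
    rw [sum_two_e1_apply]
    revert m; decide
  | g222_b =>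
    refine interp_mem_fil3' 3
      ((3, [1, 2, 3], none) :: (List.finRange 3).map fun i =>
        (1, [0, (i + 1).succ, (i + 2).succ], some (0, i.succ))) sum_two_e1_apply ?_ ?_
    · simp [interp, mono, opC, sig, th, Fin.sum_univ_three, List.finRange_succ,
        ofNat_smul_eq_nsmul, mul_assoc]
      abel
    · decide

lemma GEG_le_fil3 (α : Fin 3 →₀ ℕ) (k : ℕ) : GEG R α k ≤ fil3 R α := by
  rw [GEG, Submodule.span_le]
  rintro _ ⟨l, hl, rfl⟩
  exact tableEntry_mem_fil3 hl

lemma GE_le_fil3 (α : Fin 3 →₀ ℕ) (k : ℕ) : GE R α k ≤ fil3 R α := by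
  refine sup_le (GEG_le_fil3 α k) ?_
  rw [Submodule.span_le]
  rintro _ ⟨k', l, _, hl, rfl⟩
  exact th0_smul_mem_fil3 (tableEntry_mem_fil3 hl)

end Table

/-! ### Coefficients of large index lie in the ideal `(s₁, s₂, s₃)`. -/

section LargeIndex

variable {R : Type*} [CommRing R] [Algebra ℝ R]

lemma X_smul_add_single (i : Fin 3) (x : PowSer (EE R)) (γ : Fin 3 →₀ ℕ) :
    ((MvPowerSeries.X i : MvPowerSeries (Fin 3) R) • x) (γ + e1 i) = x γ := by
  rw [X_smul_apply, Finset.sum_eq_single (e1 i, γ)]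
  · simp
  · rintro ⟨a, b⟩ h1 h2
    rw [if_neg]
    rintro rfl
    rw [Finset.HasAntidiagonal.mem_antidiagonal, add_comm γ] at h1
    exact h2 (Prod.ext rfl (add_left_cancel h1))
  · intro h
    exact absurd (Finset.HasAntidiagonal.mem_antidiagonal.2 (add_comm _ _)) h

lemma X_smul_of_eq_zero (i : Fin 3) (x : PowSer (EE R)) {γ : Fin 3 →₀ ℕ} (h : γ i = 0) :
    ((MvPowerSeries.X i : MvPowerSeries (Fin 3) R) • x) γ = 0 := by
  rw [X_smul_apply]
  refine Finset.sum_eq_zero fun p hp => ?_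
  rw [if_neg]
  intro h1
  rw [Finset.HasAntidiagonal.mem_antidiagonal] at hp
  have := congrArg (fun f => f i) hp
  simp [h1, h] at this

lemma sub_single_add_single {γ : Fin 3 →₀ ℕ} {i : Fin 3} (h : γ i ≠ 0) :
    γ - e1 i + e1 i = γ :=
  tsub_add_cancel_of_le (Finsupp.single_le_iff.2 (Nat.one_le_iff_ne_zero.2 h))

/-- An index with `γ_i ≥ 3`, if there is one. -/
def bigIndex (γ : Fin 3 →₀ ℕ) : Fin 3 := if 3 ≤ γ 0 then 0 else if 3 ≤ γ 1 then 1 else 2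

lemma three_le_bigIndex {γ : Fin 3 →₀ ℕ} (h : ∃ i, 3 ≤ γ i) : 3 ≤ γ (bigIndex γ) := by
  rw [bigIndex]
  obtain ⟨i, hi⟩ := h
  split_ifs with h1 h2
  · exact h1
  · exact h2
  · fin_cases i
    exacts [absurd hi h1, absurd hi h2, hi]

open Classical in
/-- The filtration is stationary from index `2` on, so coefficients with an index `≥ 3` are
multiples of `s₁`, `s₂` or `s₃`. -/
lemma mem_JJ_of_forall_le_two {p : PP R} (h : ∀ γ : Fin 3 →₀ ℕ, (∀ i, γ i ≤ 2) → p.1 γ = 0) :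
    p ∈ JJ R := by
  -- Every index with an entry `≥ 3` is assigned to one such entry `i`, and `q i` collects the
  -- coefficients assigned to `i`, shifted down by `e_i`. The condition `2 ≤ γ i` says that the
  -- unshifted entry is `≥ 3`, and it is what keeps the shifted series in `P`.
  let q : Fin 3 → PP R := fun i =>
    ⟨fun γ => if bigIndex (γ + e1 i) = i ∧ 2 ≤ γ i then p.1 (γ + e1 i) else 0, fun γ => by
      dsimp only
      split_ifs with hγ
      · exact fil3_add_single_le hγ.2 (p.2 _)
      · exact zero_mem _⟩
  have hp : p = ∑ i, (MvPowerSeries.X i : MvPowerSeries (Fin 3) R) • q i := by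
    apply Subtype.ext
    have hc : ((∑ i, (MvPowerSeries.X i : MvPowerSeries (Fin 3) R) • q i : PP R) : PowSer (EE R)) =
        ∑ i, (MvPowerSeries.X i : MvPowerSeries (Fin 3) R) • (q i).1 := by
      simp
    rw [hc]
    refine PowSer.ext fun γ => ?_
    have hs : (∑ i, (MvPowerSeries.X i : MvPowerSeries (Fin 3) R) • (q i).1) γ =
        ∑ i, ((MvPowerSeries.X i : MvPowerSeries (Fin 3) R) • (q i).1) γ := by
      simp only [Fin.sum_univ_three, PowSer.add_apply]
    have hi : ∀ i, ((MvPowerSeries.X i : MvPowerSeries (Fin 3) R) • (q i).1) γ =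
        if bigIndex γ = i then (if 3 ≤ γ i then p.1 γ else 0) else 0 := by
      intro i
      by_cases h0 : γ i = 0
      · rw [X_smul_of_eq_zero i _ h0, h0]; simp
      · have h1 := sub_single_add_single h0
        have h2 := X_smul_add_single i (q i).1 (γ - e1 i)
        rw [h1] at h2
        have h3 : (γ - e1 i) i = γ i - 1 := by simp
        have h4 : (2 ≤ γ i - 1) = (3 ≤ γ i) := by
          apply propext; omega
        rw [h2]
        simp only [q, h1, h3, h4, ite_and]
    rw [hs]
    simp only [hi]
    rw [Finset.sum_ite_eq, if_pos (Finset.mem_univ _)]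
    by_cases hb : ∃ i, 3 ≤ γ i
    · rw [if_pos (three_le_bigIndex hb)]
    · push Not at hb
      rw [h γ fun i => Nat.lt_succ_iff.1 (hb i), ite_self]
  rw [hp]
  exact sum_mem fun i _ => X_smul_mem_JJ _ _

/-- Three entries that are at most `2` add up to at most `6`. This is the origin of the exponent `7`
below. -/
lemma mem_JJ_of_degree {p : PP R} (h : ∀ γ : Fin 3 →₀ ℕ, γ.degree < 7 → p.1 γ = 0) :
    p ∈ JJ R := by
  refine mem_JJ_of_forall_le_two fun γ hγ => h γ ?_
  rw [Finsupp.degree_eq_sum, Fin.sum_univ_three]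
  have := hγ 0; have := hγ 1; have := hγ 2
  omega

end LargeIndex

/-! ### Bracketing with elements of exterior degree `0`. -/

section DegreeZero

variable {R : Type*} [CommRing R] [Algebra ℝ R]

lemma actW_sub (δ : Derivation ℝ R R × Matrix (Fin 4) (Fin 4) R) (v w : Fin 4 → R) :
    actW δ (v - w) = actW δ v - actW δ w := by
  ext a; simp [actW, Matrix.mulVec_sub]; ring

lemma actW_single (δ : Derivation ℝ R R × Matrix (Fin 4) (Fin 4) R) (a b : Fin 4) :
    actW δ (Pi.single b 1) a = δ.2 a b := by
  have h0 : δ.1 (if a = b then 1 else 0) = 0 := by split_ifs <;> simp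
  simp [actW, Pi.single_apply, h0]

/-- Matrix entries are read off from the action on a basis vector, where the bracket is an honest
commutator of operators. -/
lemma bracket_leibniz (δ a b : CDerEnd R) : ⁅δ, ⁅a, b⁆⁆ = ⁅⁅δ, a⁆, b⁆ + ⁅a, ⁅δ, b⁆⁆ := by
  refine Subtype.ext (Prod.ext ?_ ?_)
  · exact leibniz_lie δ.1.1 a.1.1 b.1.1
  · ext i j
    have h : ∀ x : CDerEnd R, x.1.2 i j = actW x.1 (Pi.single j 1) i := fun x =>
      (actW_single _ _ _).symm
    have h' : (⁅⁅δ, a⁆, b⁆ + ⁅a, ⁅δ, b⁆⁆ : CDerEnd R).1.2 i j =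
        (⁅⁅δ, a⁆, b⁆ : CDerEnd R).1.2 i j + (⁅a, ⁅δ, b⁆⁆ : CDerEnd R).1.2 i j := rfl
    rw [h', h, h, h]
    simp only [coe_bracket, actW_bracketC, actW_sub, Pi.sub_apply]
    ring

/-- Derivations annihilate the constant `1`, so the last term of the bracket drops out and `δ` acts
by Lie derivative. -/
lemma brL_one_tmul (δ : CDerEnd R) (l : Lie R) : brL (el 1 δ) l = lieL δ l := by
  have : ract (1 : Ext R) l = 0 := by
    induction l using TensorProduct.induction_on with
    | zero => rw [map_zero]
    | add a b ha hb => rw [map_add, ha, hb, add_zero]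
    | tmul u δ =>
      rw [ract_tmul, ← map_one (algebraMap R (Ext R)), extDer_algebraMap]; simp
  rw [brL_apply, brAdd_tmul', this, TensorProduct.zero_tmul, one_smul, sub_zero]

/-- The Jacobi identity in the only case that is needed, with first entry of degree `0`. No signs
occur, so no homogeneity is required of the other two entries. -/
lemma lieL_brL (δ : CDerEnd R) (x y : Lie R) :
    lieL δ (brL x y) = brL (lieL δ x) y + brL x (lieL δ y) := by
  induction x using TensorProduct.induction_on with
  | zero => simp
  | add a b ha hb => simp only [map_add, LinearMap.add_apply, ha, hb]; abel
  | tmul u a =>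
    induction y using TensorProduct.induction_on with
    | zero => simp
    | add a b ha hb => simp only [map_add, ha, hb]; abel
    | tmul v b =>
      simp only [lieL_tmul, brL_apply, brAdd_tmul, map_add, map_sub, LinearMap.add_apply,
        bracket_leibniz δ a b, extDer_mul, coe_bracket, extDer_bracketC, TensorProduct.tmul_add,
        TensorProduct.add_tmul, TensorProduct.sub_tmul, mul_sub, sub_mul]
      abel

lemma brE_one_toE (δ : CDerEnd R) (l : Lie R) :
    brE (toE (el 1 δ)) (toE l) = toE (lieL δ l) := by
  rw [brE_toE, brL_one_tmul]

lemma brE_one_leibniz (δ : CDerEnd R) (x y : EE R) :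
    brE (toE (el 1 δ)) (brE x y) =
      brE (brE (toE (el 1 δ)) x) y + brE x (brE (toE (el 1 δ)) y) := by
  obtain ⟨x, rfl⟩ := toE_surjective x
  obtain ⟨y, rfl⟩ := toE_surjective y
  rw [brE_toE, brE_one_toE, brE_one_toE, brE_one_toE, brE_toE, brE_toE, lieL_brL, map_add]

lemma extDer_mem_exteriorPower (δ : Derivation ℝ R R × Matrix (Fin 4) (Fin 4) R) {k : ℕ}
    {u : Ext R} (hu : u ∈ ⋀[R]^k (Fin 4 → R)) : extDer δ u ∈ ⋀[R]^k (Fin 4 → R) := by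
  induction hu using Submodule.pow_induction_on_left' with
  | algebraMap r =>
    rw [extDer_algebraMap]
    change _ ∈ LinearMap.range (ExteriorAlgebra.ι R (M := Fin 4 → R)) ^ 0
    rw [pow_zero]
    exact Submodule.algebraMap_mem _
  | add x y i hx hy h h' => rw [map_add]; exact add_mem h h'
  | mem_mul m hm i x hx ih =>
    obtain ⟨w, rfl⟩ := hm
    rw [extDer_mul, extDer_ι]
    change _ ∈ LinearMap.range (ExteriorAlgebra.ι R (M := Fin 4 → R)) ^ (i + 1)
    rw [pow_succ']
    exact add_mem (Submodule.mul_mem_mul ⟨_, rfl⟩ ih) (Submodule.mul_mem_mul ⟨_, rfl⟩ hx)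

lemma lieL_smul_fun (δ : CDerEnd R) (r : R) (l : Lie R) :
    lieL δ (r • l) = r • lieL δ l + δ.1.1 r • l := by
  induction l using TensorProduct.induction_on with
  | zero => simp
  | add a b ha hb => rw [smul_add, map_add, ha, hb, map_add, smul_add, smul_add]; abel
  | tmul u δ' =>
    rw [TensorProduct.smul_tmul', lieL_tmul, lieL_tmul, extDer_smul_fun]
    simp only [TensorProduct.add_tmul, TensorProduct.smul_tmul', smul_add]
    abel

lemma brE_one_smul_fun (δ : CDerEnd R) (r : R) (x : EE R) :
    brE (toE (el 1 δ)) (r • x) = r • brE (toE (el 1 δ)) x + δ.1.1 r • x := by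
  obtain ⟨x, rfl⟩ := toE_surjective x
  rw [← toE_smul_fun, brE_one_toE, lieL_smul_fun, map_add, toE_smul_fun, toE_smul_fun, brE_one_toE]

lemma brE_one_mem_degE (δ : CDerEnd R) {k : ℕ} {x : EE R} (hx : x ∈ degE R k) :
    brE (toE (el 1 δ)) x ∈ degE R k := by
  induction hx using Submodule.span_induction with
  | zero => rw [map_zero]; exact zero_mem _
  | add x y _ _ hx hy => rw [map_add]; exact add_mem hx hy
  | smul r x hx' hx =>
    rw [brE_one_smul_fun]
    exact add_mem (Submodule.smul_mem _ _ hx) (Submodule.smul_mem _ _ hx')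
  | mem x hx =>
    obtain ⟨u, hu, δ', rfl⟩ := hx
    rw [brE_one_toE, lieL_tmul, map_add]
    exact add_mem (Submodule.subset_span ⟨u, hu, _, rfl⟩)
      (Submodule.subset_span ⟨_, extDer_mem_exteriorPower _ hu, _, rfl⟩)

end DegreeZero

/-- Regroups a square of indices into the triangle `n + m < N`; it serves to multiply truncated
exponentials. -/
lemma sum_range_range_eq_sum_antidiagonal {V : Type*} [AddCommMonoid V] (N : ℕ) (f : ℕ → ℕ → V)
    (h : ∀ n m, N ≤ n + m → f n m = 0) :
    ∑ n ∈ Finset.range N, ∑ m ∈ Finset.range N, f n m =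
      ∑ k ∈ Finset.range N, ∑ p ∈ Finset.HasAntidiagonal.antidiagonal k, f p.1 p.2 := by
  simp only [Finset.Nat.sum_antidiagonal_eq_sum_range_succ f]
  rw [Finset.sum_range_diag_flip]
  refine Finset.sum_congr rfl fun n _ => ?_
  refine (Finset.sum_subset (Finset.range_subset_range.2 (Nat.sub_le _ _)) fun m _ hm => ?_).symm
  refine h n m ?_
  rw [Finset.mem_range] at hm
  omega

/-! ### The exponential of a nilpotent operator. -/

section NilpotentExponential

/-- Terms beyond the nilpotency class are zero, so any exponent that kills the operator may serve as
the bound; below it is `7` for all generators at once. -/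
lemma nilExp_eq_sum {V : Type*} [AddCommGroup V] [Module ℝ V] {a : Module.End ℝ V} {N : ℕ}
    (h : a ^ N = 0) : nilExp a = ∑ n ∈ Finset.range N, (n.factorial : ℝ)⁻¹ • a ^ n := by
  have hn : IsNilpotent a := ⟨N, h⟩
  refine Finset.sum_subset (Finset.range_subset_range.2 (csInf_le' h)) fun n _ hn' => ?_
  rw [Finset.mem_range, not_lt] at hn'
  rw [pow_eq_zero_of_le hn' (pow_nilpotencyClass hn), smul_zero]

end NilpotentExponential

/-! ### The exponential on the Rees algebra `P`. -/

section PowerSeriesExponential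

variable {R : Type*} [CommRing R] [Algebra ℝ R]

/-- Elements `∑_{α ≠ 0} s^α x_α` of `P` of degree `0`. -/
structure IsGenerator (x : PP R) : Prop where
  zero : x.1 0 = 0
  degree_zero : ∀ α, ∃ δ, x.1 α = toE (el 1 δ)

/-- The power series starts in order `N`. -/
def VanishesBelow (N : ℕ) (p : PP R) : Prop := ∀ γ : Fin 3 →₀ ℕ, γ.degree < N → p.1 γ = 0

/-- The coefficient of `x` at `000` is zero, so each bracket with `x` gains at least one order in
`s`. -/
lemma brP_vanishesBelow {x p : PP R} (hx : x.1 0 = 0) {N : ℕ} (hp : VanishesBelow N p) :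
    VanishesBelow (N + 1) (brP x p) := by
  intro γ hγ
  rw [brP_coe, brPow_apply]
  refine Finset.sum_eq_zero fun a ha => ?_
  rw [Finset.HasAntidiagonal.mem_antidiagonal] at ha
  by_cases h0 : a.1 = 0
  · rw [h0, hx, map_zero, LinearMap.zero_apply]
  · have h1 : a.1.degree ≠ 0 := fun h => h0 ((Finsupp.degree_eq_zero_iff _).1 h)
    have h2 : a.1.degree + a.2.degree = γ.degree := by rw [← ha, map_add]
    rw [hp a.2 (by omega), map_zero]

lemma pow_brP_vanishesBelow {x p : PP R} (hx : x.1 0 = 0) {N : ℕ} (hp : VanishesBelow N p)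
    (n : ℕ) : VanishesBelow (N + n) ((brP x ^ n) p) := by
  induction n with
  | zero => exact hp
  | succ n ih => rw [pow_succ', Module.End.mul_apply]; exact brP_vanishesBelow hx ih

lemma pow_brP_apply_eq_zero {x : PP R} (hx : x.1 0 = 0) (p : PP R) {n : ℕ} {γ : Fin 3 →₀ ℕ}
    (h : γ.degree < n) : ((brP x ^ n) p).1 γ = 0 :=
  pow_brP_vanishesBelow hx (N := 0) (fun _ h => absurd h (Nat.not_lt_zero _)) n γ (by omega)

lemma brPow_conv_smul_right (c : MvPowerSeries (Fin 3) ℝ) (x y : PowSer (EE R)) :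
    brPow x (c • y) = c • brPow x y := by
  refine PowSer.ext fun γ => ?_
  simp only [brPow_apply, PowSer.conv_apply, map_sum, map_smul, Finset.smul_sum]
  rw [← PowSer.triple γ (fun a b d => MvPowerSeries.coeff b c • brE (x a) (y d)),
    ← PowSer.triple γ (fun a b d => MvPowerSeries.coeff a c • brE (x b) (y d))]
  refine Finset.sum_congr rfl fun p _ => ?_
  conv_lhs => rw [← Finset.HasAntidiagonal.map_swap_antidiagonal, Finset.sum_map]
  rfl

lemma coe_conv_smul (c : MvPowerSeries (Fin 3) ℝ) (p : PP R) :
    ((c • p : PP R) : PowSer (EE R)) = c • (p : PowSer (EE R)) := rfl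

lemma brP_conv_smul (c : MvPowerSeries (Fin 3) ℝ) (x p : PP R) :
    brP x (c • p) = c • brP x p := by
  apply Subtype.ext
  rw [brP_coe, coe_conv_smul, coe_conv_smul, brPow_conv_smul_right]
  rfl

lemma pow_brP_conv_smul (c : MvPowerSeries (Fin 3) ℝ) (x p : PP R) (n : ℕ) :
    (brP x ^ n) (c • p) = c • (brP x ^ n) p := by
  induction n with
  | zero => rfl
  | succ n ih => rw [pow_succ', Module.End.mul_apply, Module.End.mul_apply, ih, brP_conv_smul]

lemma brP_leibniz {x : PP R} (hx : IsGenerator x) (y z : PP R) :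
    brP x (brP y z) = brP (brP x y) z + brP y (brP x z) := by
  apply Subtype.ext
  refine PowSer.ext fun γ => ?_
  change brPow x.1 (brPow y.1 z.1) γ = brPow (brPow x.1 y.1) z.1 γ + brPow y.1 (brPow x.1 z.1) γ
  simp only [brPow_apply, map_sum, LinearMap.sum_apply]
  -- All three terms become sums over `γ = a + b + c` with `x` taken at `a`, `y` at `b` and `z` at
  -- `c`; then Leibniz' rule in `E` applies term by term.
  rw [PowSer.triple γ (fun a b c => brE (brE (x.1 a) (y.1 b)) (z.1 c)),
    ← PowSer.triple γ (fun a b c => brE (y.1 a) (brE (x.1 b) (z.1 c)))]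
  have h : ∑ p ∈ Finset.HasAntidiagonal.antidiagonal γ,
      ∑ q ∈ Finset.HasAntidiagonal.antidiagonal p.1, brE (y.1 q.1) (brE (x.1 q.2) (z.1 p.2)) =
      ∑ p ∈ Finset.HasAntidiagonal.antidiagonal γ,
        ∑ q ∈ Finset.HasAntidiagonal.antidiagonal p.1, brE (y.1 q.2) (brE (x.1 q.1) (z.1 p.2)) := by
    refine Finset.sum_congr rfl fun p _ => ?_
    conv_lhs => rw [← Finset.HasAntidiagonal.map_swap_antidiagonal, Finset.sum_map]
    rfl
  rw [h, PowSer.triple γ (fun a b c => brE (y.1 b) (brE (x.1 a) (z.1 c))),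
    ← Finset.sum_add_distrib]
  refine Finset.sum_congr rfl fun p _ => ?_
  rw [← Finset.sum_add_distrib]
  refine Finset.sum_congr rfl fun q _ => ?_
  obtain ⟨δ, hδ⟩ := hx.degree_zero p.1
  rw [hδ, brE_one_leibniz]

/-- Pascal's recursion turns Leibniz' rule into its binomial form, the reason why the exponential of
a derivation respects brackets. -/
lemma pow_brP_brP {x : PP R} (hx : IsGenerator x) (y z : PP R) (n : ℕ) :
    (brP x ^ n) (brP y z) = ∑ p ∈ Finset.HasAntidiagonal.antidiagonal n,
      n.choose p.1 • brP ((brP x ^ p.1) y) ((brP x ^ p.2) z) := by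
  induction n with
  | zero => simp
  | succ n ih =>
    rw [Finset.sum_antidiagonal_choose_succ_nsmul
      (fun i j => brP ((brP x ^ i) y) ((brP x ^ j) z)), pow_succ', Module.End.mul_apply, ih,
      map_sum, ← Finset.sum_add_distrib]
    refine Finset.sum_congr rfl fun p hp => ?_
    rw [map_nsmul, brP_leibniz hx, smul_add, add_comm, pow_succ' _ p.1, pow_succ' _ p.2,
      Module.End.mul_apply, Module.End.mul_apply]
    -- One half of Pascal's recursion carries `n.choose p.2`; the symmetry of the binomial
    -- coefficient identifies it with `n.choose p.1`.
    rw [← Finset.HasAntidiagonal.mem_antidiagonal.1 hp, Nat.choose_symm_add]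

lemma brP_mem_degP {x p : PP R} (hx : IsGenerator x) {k : ℕ} (hp : p ∈ degP R k) :
    brP x p ∈ degP R k := by
  intro γ
  rw [brP_coe, brPow_apply]
  refine sum_mem fun a _ => ?_
  obtain ⟨δ, hδ⟩ := hx.degree_zero a.1
  rw [hδ]
  exact brE_one_mem_degE δ (hp a.2)

lemma pow_brP_mem_degP {x p : PP R} (hx : IsGenerator x) {k : ℕ} (hp : p ∈ degP R k) (n : ℕ) :
    (brP x ^ n) p ∈ degP R k := by
  induction n with
  | zero => exact hp
  | succ n ih => rw [pow_succ', Module.End.mul_apply]; exact brP_mem_degP hx ih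

/-- The partial sum `∑_{n < N} φ_n [x, -]ⁿ p`. -/
noncomputable def partialSum (x : PP R) (φ : ℕ → ℝ) (N : ℕ) (p : PP R) : PP R :=
  ∑ n ∈ Finset.range N, φ n • (brP x ^ n) p

lemma coe_sum_apply {ι : Type*} (s : Finset ι) (f : ι → PP R) (γ : Fin 3 →₀ ℕ) :
    (∑ i ∈ s, f i : PP R).1 γ = ∑ i ∈ s, (f i).1 γ := by
  classical
  induction s using Finset.induction_on with
  | empty => rfl
  | insert i s hi ih => rw [Finset.sum_insert hi, Finset.sum_insert hi, ← ih]; rfl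

lemma coe_smul_apply (c : ℝ) (p : PP R) (γ : Fin 3 →₀ ℕ) : (c • p : PP R).1 γ = c • p.1 γ := rfl

lemma partialSum_apply (x : PP R) (φ : ℕ → ℝ) (N : ℕ) (p : PP R) (γ : Fin 3 →₀ ℕ) :
    (partialSum x φ N p).1 γ = ∑ n ∈ Finset.range N, φ n • ((brP x ^ n) p).1 γ := by
  rw [partialSum, coe_sum_apply]; rfl

lemma partialSum_apply_eq {x : PP R} (hx : x.1 0 = 0) (φ : ℕ → ℝ) {N : ℕ} (p : PP R)
    {γ : Fin 3 →₀ ℕ} (h : γ.degree < N) :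
    (partialSum x φ N p).1 γ = (partialSum x φ (γ.degree + 1) p).1 γ := by
  rw [partialSum_apply, partialSum_apply]
  refine (Finset.sum_subset (Finset.range_subset_range.2 h) fun n _ hn => ?_).symm
  rw [pow_brP_apply_eq_zero hx, smul_zero]
  rw [Finset.mem_range] at hn
  omega

/-- The convergent series `∑ φ_n [x, -]ⁿ`. -/
noncomputable def seriesAct (x : PP R) (hx : x.1 0 = 0) (φ : ℕ → ℝ) : PP R →ₗ[MvPowerSeries (Fin 3) ℝ] PP R where
  -- The coefficient of `s^γ` sees only the terms with `n ≤ |γ|`, so truncating at `γ.degree + 1` is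
  -- exact.
  toFun p := ⟨fun γ => (partialSum x φ (γ.degree + 1) p).1 γ, fun γ => (partialSum x φ _ p).2 γ⟩
  map_add' p q := by
    apply Subtype.ext
    refine PowSer.ext fun γ => ?_
    change (partialSum x φ _ (p + q)).1 γ = (partialSum x φ _ p + partialSum x φ _ q).1 γ
    simp only [partialSum, map_add, smul_add, Finset.sum_add_distrib]
  map_smul' c p := by
    apply Subtype.ext
    refine PowSer.ext fun γ => ?_
    have h : partialSum x φ (γ.degree + 1) (c • p) = c • partialSum x φ (γ.degree + 1) p := by
      simp only [partialSum, pow_brP_conv_smul, Finset.smul_sum]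
      refine Finset.sum_congr rfl fun n _ => Subtype.ext (PowSer.ext fun γ => ?_)
      simp only [coe_smul_apply, coe_conv_smul, PowSer.conv_apply, Finset.smul_sum]
      exact Finset.sum_congr rfl fun _ _ => smul_comm _ _ _
    change (partialSum x φ (γ.degree + 1) (c • p)).1 γ = _
    rw [h]
    change (c • (partialSum x φ (γ.degree + 1) p).1) γ = (c • _ : PowSer (EE R)) γ
    rw [PowSer.conv_apply, PowSer.conv_apply]
    refine Finset.sum_congr rfl fun a ha => ?_
    rw [Finset.HasAntidiagonal.mem_antidiagonal] at ha
    congr 1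
    refine partialSum_apply_eq hx φ p ?_
    rw [← ha, map_add]
    omega

variable {x : PP R} (hx : x.1 0 = 0)

lemma seriesAct_apply (φ : ℕ → ℝ) {N : ℕ} (p : PP R) {γ : Fin 3 →₀ ℕ} (h : γ.degree < N) :
    (seriesAct x hx φ p).1 γ = ∑ n ∈ Finset.range N, φ n • ((brP x ^ n) p).1 γ := by
  rw [← partialSum_apply, partialSum_apply_eq hx φ p h]
  rfl

lemma seriesAct_sub_partialSum (φ : ℕ → ℝ) (N : ℕ) (p : PP R) :
    VanishesBelow N (seriesAct x hx φ p - partialSum x φ N p) := by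
  intro γ hγ
  change (seriesAct x hx φ p).1 γ - (partialSum x φ N p).1 γ = 0
  rw [seriesAct_apply hx φ p hγ, partialSum_apply, sub_self]

/-- Convergent series in the single operator `[x, -]` compose by the Cauchy product of their
coefficients. -/
lemma seriesAct_seriesAct (φ ψ : ℕ → ℝ) (p : PP R) :
    seriesAct x hx φ (seriesAct x hx ψ p) =
      seriesAct x hx (fun n => ∑ a ∈ Finset.HasAntidiagonal.antidiagonal n, φ a.1 * ψ a.2) p := by
  apply Subtype.ext
  refine PowSer.ext fun γ => ?_
  have hN : γ.degree < γ.degree + 1 := Nat.lt_succ_self _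
  generalize γ.degree + 1 = N at hN
  have h1 : ∀ n, ((brP x ^ n) (seriesAct x hx ψ p)).1 γ =
      ∑ m ∈ Finset.range N, ψ m • ((brP x ^ (n + m)) p).1 γ := by
    intro n
    -- The tail of the inner series starts in order `N > |γ|` and cannot reach the coefficient at
    -- `γ`, so the inner series may be replaced by its partial sum.
    have h2 := pow_brP_vanishesBelow hx (seriesAct_sub_partialSum hx ψ N p) n γ (by omega)
    rw [map_sub] at h2
    have h3 : ((brP x ^ n) (seriesAct x hx ψ p)).1 γ = ((brP x ^ n) (partialSum x ψ N p)).1 γ :=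
      sub_eq_zero.1 h2
    rw [h3, partialSum, map_sum, coe_sum_apply]
    refine Finset.sum_congr rfl fun m _ => ?_
    rw [map_smul, coe_smul_apply, pow_add, Module.End.mul_apply]
  rw [seriesAct_apply hx φ _ hN, seriesAct_apply hx _ _ hN]
  simp only [h1, Finset.smul_sum, smul_smul]
  rw [sum_range_range_eq_sum_antidiagonal N (fun n m => (φ n * ψ m) • ((brP x ^ (n + m)) p).1 γ)
    fun n m h => by rw [pow_brP_apply_eq_zero hx p (by omega), smul_zero]]
  refine Finset.sum_congr rfl fun k _ => ?_
  rw [Finset.sum_smul]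
  refine Finset.sum_congr rfl fun a ha => ?_
  rw [Finset.HasAntidiagonal.mem_antidiagonal.1 ha]

lemma seriesAct_one (p : PP R) : seriesAct x hx (fun n => if n = 0 then 1 else 0) p = p := by
  apply Subtype.ext
  refine PowSer.ext fun γ => ?_
  rw [seriesAct_apply hx _ _ (Nat.lt_succ_self _), Finset.sum_eq_single 0]
  · simp
  · intro n _ hn; rw [if_neg hn, zero_smul]
  · intro h; exact absurd (Finset.mem_range.2 (Nat.succ_pos _)) h

/-- Comparison of coefficients in `exp(t) · exp(-t) = 1`. -/
lemma sum_exp_mul_exp_neg (n : ℕ) : ∑ a ∈ Finset.HasAntidiagonal.antidiagonal n,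
    (a.1.factorial : ℝ)⁻¹ * ((-1) ^ a.2 * (a.2.factorial : ℝ)⁻¹) = if n = 0 then 1 else 0 := by
  have h := congrArg (PowerSeries.coeff n) (PowerSeries.exp_mul_exp_neg_eq_one (A := ℝ))
  rw [PowerSeries.coeff_mul, PowerSeries.coeff_one] at h
  rw [← h]
  refine Finset.sum_congr rfl fun a _ => ?_
  simp [PowerSeries.evalNegHom, PowerSeries.coeff_rescale, PowerSeries.coeff_exp]

lemma sum_exp_neg_mul_exp (n : ℕ) : ∑ a ∈ Finset.HasAntidiagonal.antidiagonal n,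
    ((-1) ^ a.1 * (a.1.factorial : ℝ)⁻¹) * (a.2.factorial : ℝ)⁻¹ = if n = 0 then 1 else 0 := by
  rw [← sum_exp_mul_exp_neg]
  conv_rhs => rw [← Finset.HasAntidiagonal.map_swap_antidiagonal, Finset.sum_map]
  exact Finset.sum_congr rfl fun a _ => mul_comm _ _

/-- The automorphism `exp([x, -])` of `P`. -/
noncomputable def expP (x : PP R) (hx : x.1 0 = 0) : PP R ≃ₗ[MvPowerSeries (Fin 3) ℝ] PP R :=
  LinearEquiv.ofLinearMap (seriesAct x hx fun n => (n.factorial : ℝ)⁻¹)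
    (seriesAct x hx fun n => (-1) ^ n * (n.factorial : ℝ)⁻¹)
    (LinearMap.ext fun p => by
      rw [LinearMap.comp_apply, seriesAct_seriesAct]
      simp only [sum_exp_mul_exp_neg, seriesAct_one, LinearMap.id_apply])
    (LinearMap.ext fun p => by
      rw [LinearMap.comp_apply, seriesAct_seriesAct]
      simp only [sum_exp_neg_mul_exp, seriesAct_one, LinearMap.id_apply])

lemma seriesAct_mem_degP (hg : IsGenerator x) (φ : ℕ → ℝ) {k : ℕ} {p : PP R} (hp : p ∈ degP R k) :
    seriesAct x hx φ p ∈ degP R k := by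
  intro γ
  rw [seriesAct_apply hx φ p (Nat.lt_succ_self _)]
  refine sum_mem fun n _ => ?_
  have := pow_brP_mem_degP hg hp n γ
  rw [← algebraMap_smul R (φ n)]
  exact Submodule.smul_mem _ _ this

lemma expP_apply (p : PP R) {N : ℕ} {γ : Fin 3 →₀ ℕ} (h : γ.degree < N) :
    (expP x hx p).1 γ = ∑ n ∈ Finset.range N, (n.factorial : ℝ)⁻¹ • ((brP x ^ n) p).1 γ :=
  seriesAct_apply hx _ p h

/-- Dividing the binomial formula by `n!` leaves `1/(p! q!)`, so both sides are the same double sum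
of brackets. At the coefficient of `s^γ` the terms with total order above `|γ|` vanish, which
reconciles the triangular sum with the square one. -/
lemma expP_brP (hg : IsGenerator x) (y z : PP R) :
    expP x hx (brP y z) = brP (expP x hx y) (expP x hx z) := by
  apply Subtype.ext
  refine PowSer.ext fun γ => ?_
  have hN : γ.degree < γ.degree + 1 := Nat.lt_succ_self _
  generalize γ.degree + 1 = N at hN
  set E : ℕ → PP R → PP R := fun n p => (n.factorial : ℝ)⁻¹ • (brP x ^ n) p with hE
  have h1 : (expP x hx (brP y z)).1 γ = ∑ n ∈ Finset.range N,
      ∑ p ∈ Finset.HasAntidiagonal.antidiagonal n, (brP (E p.1 y) (E p.2 z)).1 γ := by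
    rw [expP_apply hx _ hN]
    refine Finset.sum_congr rfl fun n _ => ?_
    rw [pow_brP_brP hg, coe_sum_apply, Finset.smul_sum]
    refine Finset.sum_congr rfl fun p hp => ?_
    rw [← Finset.HasAntidiagonal.mem_antidiagonal.1 hp, ← Nat.cast_smul_eq_nsmul ℝ,
      coe_smul_apply, smul_smul]
    simp only [hE, map_smul, LinearMap.smul_apply, coe_smul_apply, smul_smul]
    congr 1
    have a0 := Nat.cast_ne_zero (R := ℝ).2 (Nat.factorial_ne_zero (p.1 + p.2))
    have a1 := Nat.cast_ne_zero (R := ℝ).2 (Nat.factorial_ne_zero p.1)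
    have a2 := Nat.cast_ne_zero (R := ℝ).2 (Nat.factorial_ne_zero p.2)
    rw [Nat.cast_add_choose]
    field_simp
  have h2 : (brP (expP x hx y) (expP x hx z)).1 γ = ∑ n ∈ Finset.range N,
      ∑ m ∈ Finset.range N, (brP (E n y) (E m z)).1 γ := by
    rw [brP_coe, brPow_apply]
    have : ∀ a ∈ Finset.HasAntidiagonal.antidiagonal γ,
        brE ((expP x hx y).1 a.1) ((expP x hx z).1 a.2) = ∑ n ∈ Finset.range N,
          ∑ m ∈ Finset.range N, brE ((E n y).1 a.1) ((E m z).1 a.2) := by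
      intro a ha
      have hd : a.1.degree + a.2.degree = γ.degree := by
        rw [← Finset.HasAntidiagonal.mem_antidiagonal.1 ha, map_add]
      rw [expP_apply hx y (N := N) (by omega), expP_apply hx z (N := N) (by omega)]
      simp only [map_sum, LinearMap.sum_apply]
      rw [Finset.sum_comm]
      rfl
    rw [Finset.sum_congr rfl this, Finset.sum_comm]
    refine Finset.sum_congr rfl fun n _ => ?_
    rw [Finset.sum_comm]
    rfl
  rw [h1, h2, sum_range_range_eq_sum_antidiagonal N fun n m => (brP (E n y) (E m z)).1 γ]
  intro n m hnm
  rw [brP_coe, brPow_apply]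
  refine Finset.sum_eq_zero fun a ha => ?_
  have hd : a.1.degree + a.2.degree = γ.degree := by
    rw [← Finset.HasAntidiagonal.mem_antidiagonal.1 ha, map_add]
  by_cases h : a.1.degree < n
  · simp only [hE, coe_smul_apply, pow_brP_apply_eq_zero hx y h, smul_zero, map_zero,
      LinearMap.zero_apply]
  · simp only [hE, coe_smul_apply, pow_brP_apply_eq_zero hx z (show a.2.degree < m by omega),
      smul_zero, map_zero]

lemma isAutP_expP (hg : IsGenerator x) : IsAutP (expP x hx) where
  bracket := expP_brP hx hg
  degree k := by
    refine Set.Subset.antisymm ?_ fun p hp => ?_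
    · rintro _ ⟨p, hp, rfl⟩
      exact seriesAct_mem_degP hx hg _ hp
    · exact ⟨(expP x hx).symm p, seriesAct_mem_degP hx hg _ hp, LinearEquiv.apply_symm_apply _ p⟩

end PowerSeriesExponential

/-! ### Passing to the associated graded algebra `A`. -/

section Quotient

variable {R : Type*} [CommRing R] [Algebra ℝ R] {x : PP R}

lemma pow_brA_toA (x p : PP R) (n : ℕ) : (brA (toA x) ^ n) (toA p) = toA ((brP x ^ n) p) := by
  induction n with
  | zero => rfl
  | succ n ih =>
    rw [pow_succ', Module.End.mul_apply, ih, brA_toA, pow_succ', Module.End.mul_apply]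

/-- Seven brackets raise the order in `s` to at least `7`, where everything is in the ideal. -/
lemma pow_seven_brA (hx : x.1 0 = 0) : (brA (toA x) : Module.End ℝ (AA R)) ^ 7 = 0 := by
  refine LinearMap.ext fun a => ?_
  obtain ⟨p, rfl⟩ := toA_surjective a
  rw [pow_brA_toA, LinearMap.zero_apply, toA_eq_zero]
  exact mem_JJ_of_degree fun γ hγ => pow_brP_apply_eq_zero hx p hγ

/-- Truncating the exponential series after seven terms changes it only in order `≥ 7`, hence only
within the ideal; in `A` the finite exponential is left. -/
lemma toA_expP (hx : x.1 0 = 0) (p : PP R) : toA (expP x hx p) = expAd (toA x) (toA p) := by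
  rw [expAd, nilExp_eq_sum (pow_seven_brA hx), LinearMap.sum_apply]
  have h := toA_eq_zero.2 (mem_JJ_of_degree
    (seriesAct_sub_partialSum hx (fun n => (n.factorial : ℝ)⁻¹) 7 p))
  rw [map_sub, sub_eq_zero] at h
  refine h.trans ?_
  rw [partialSum, map_sum]
  refine Finset.sum_congr rfl fun n _ => ?_
  rw [toA_smul_real, LinearMap.smul_apply, pow_brA_toA]

/-- The ideal consists of sums of multiples of the `s_i`, and these are real power series. Linearity
over `ℝ[[s₁, s₂, s₃]]` is therefore enough, which matters because `exp([x, -])` need not be linear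
over functions. -/
lemma equiv_mem_JJ (Φ : PP R ≃ₗ[MvPowerSeries (Fin 3) ℝ] PP R) {p : PP R} (hp : p ∈ JJ R) :
    Φ p ∈ JJ R := by
  refine JJ_induction (p := fun p => Φ p ∈ JJ R) ?_ ?_ ?_ hp
  · rw [map_zero]; exact zero_mem _
  · intro p q h h'; rw [map_add]; exact add_mem h h'
  · intro i p
    have h : ∀ p : PP R, (MvPowerSeries.X i : MvPowerSeries (Fin 3) R) • p =
        (MvPowerSeries.X i : MvPowerSeries (Fin 3) ℝ) • p := by
      intro p
      rw [← algebraMap_smul (MvPowerSeries (Fin 3) R) (MvPowerSeries.X i : MvPowerSeries (Fin 3) ℝ) p]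
      congr 1
      rw [MvPowerSeries.algebraMap_apply'', MvPowerSeries.map_X]
    rw [h, map_smul, ← h]
    exact X_smul_mem_JJ i _

/-- All properties are inherited from `P`. For injectivity one uses that the inverse on `P`
preserves the ideal as well. -/
lemma isAutA_expAd (hg : IsGenerator x) : IsAutA (expAd (toA x)) where
  bijective := by
    refine ⟨(injective_iff_map_eq_zero _).2 fun a ha => ?_, fun a => ?_⟩
    · obtain ⟨p, rfl⟩ := toA_surjective a
      rw [← toA_expP hg.zero, toA_eq_zero] at ha
      have := equiv_mem_JJ (expP x hg.zero).symm ha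
      rw [LinearEquiv.symm_apply_apply] at this
      exact toA_eq_zero.2 this
    · obtain ⟨p, rfl⟩ := toA_surjective a
      exact ⟨toA ((expP x hg.zero).symm p), by
        rw [← toA_expP hg.zero, LinearEquiv.apply_symm_apply]⟩
  bracket a b := by
    obtain ⟨p, rfl⟩ := toA_surjective a
    obtain ⟨q, rfl⟩ := toA_surjective b
    rw [brA_toA, ← toA_expP hg.zero, ← toA_expP hg.zero, ← toA_expP hg.zero, expP_brP _ hg, brA_toA]
  degree k := by
    rw [degA, Set.image_image]
    simp only [← toA_expP hg.zero]
    rw [← Set.image_image (fun p => toA p) (expP x hg.zero), (isAutP_expP hg.zero hg).degree]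

end Quotient

/-! ### Classes of `s^α x`, and functionals on `A`. -/

section Classes

variable {R : Type*} [CommRing R] [Algebra ℝ R]

lemma toA_smul_fun (r : R) (p : PP R) : toA (r • p) = r • toA p :=
  ((toA (R := R)).restrictScalars R).map_smul r p

lemma single_apply (α γ : Fin 3 →₀ ℕ) (x : EE R) :
    single α x γ = if γ = α then x else 0 := rfl

lemma cls_add {α : Fin 3 →₀ ℕ} {x y : EE R} (hx : x ∈ fil3 R α) (hy : y ∈ fil3 R α) :
    cls α (x + y) = cls α x + cls α y := by
  rw [cls_of_mem hx, cls_of_mem hy, cls_of_mem (add_mem hx hy), ← map_add]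
  congr 1
  refine Subtype.ext (PowSer.ext fun γ => ?_)
  change single α (x + y) γ = single α x γ + single α y γ
  simp only [single_apply]
  split_ifs <;> simp

lemma cls_smul {α : Fin 3 →₀ ℕ} {x : EE R} (r : R) (hx : x ∈ fil3 R α) :
    cls α (r • x) = r • cls α x := by
  rw [cls_of_mem hx, cls_of_mem (Submodule.smul_mem _ r hx), ← toA_smul_fun]
  congr 1
  refine Subtype.ext (PowSer.ext fun γ => ?_)
  change single α (r • x) γ = r • single α x γ
  simp only [single_apply]
  split_ifs <;> simp

lemma cls_zero (α : Fin 3 →₀ ℕ) : cls α (0 : EE R) = 0 := by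
  have := cls_smul (R := R) (α := α) 0 (zero_mem (fil3 R α))
  rwa [zero_smul, zero_smul] at this

lemma cls_neg {α : Fin 3 →₀ ℕ} {x : EE R} (hx : x ∈ fil3 R α) : cls α (-x) = -cls α x := by
  rw [← neg_one_smul R x, cls_smul _ hx, neg_one_smul]

lemma cls_sub {α : Fin 3 →₀ ℕ} {x y : EE R} (hx : x ∈ fil3 R α) (hy : y ∈ fil3 R α) :
    cls α (x - y) = cls α x - cls α y := by
  rw [sub_eq_add_neg, cls_add hx (neg_mem hy), cls_neg hy, ← sub_eq_add_neg]

/-- Taking classes is linear over functions on `F_αE`, so the classes of a submodule already form a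
submodule. -/
lemma mem_span_cls_image {α : Fin 3 →₀ ℕ} {M : Submodule R (EE R)} (hM : M ≤ fil3 R α)
    {a : AA R} : a ∈ Submodule.span R (cls α '' (M : Set (EE R))) ↔ ∃ e ∈ M, a = cls α e := by
  refine ⟨fun h => ?_, ?_⟩
  · induction h using Submodule.span_induction with
    | zero => exact ⟨0, zero_mem _, (cls_zero α).symm⟩
    | add x y _ _ hx hy =>
      obtain ⟨e, he, rfl⟩ := hx
      obtain ⟨e', he', rfl⟩ := hy
      exact ⟨_, add_mem he he', (cls_add (hM he) (hM he')).symm⟩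
    | smul r x _ hx =>
      obtain ⟨e, he, rfl⟩ := hx
      exact ⟨_, Submodule.smul_mem _ r he, (cls_smul r (hM he)).symm⟩
    | mem x hx =>
      obtain ⟨e, he, rfl⟩ := hx
      exact ⟨e, he, rfl⟩
  · rintro ⟨e, he, rfl⟩
    exact Submodule.subset_span ⟨e, he, rfl⟩

lemma mem_GA {α : Fin 3 →₀ ℕ} {k : ℕ} {a : AA R} :
    a ∈ GA R α k ↔ ∃ e ∈ GE R α k, a = cls α e := mem_span_cls_image (GE_le_fil3 α k)

lemma mem_GAG {α : Fin 3 →₀ ℕ} {k : ℕ} {a : AA R} :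
    a ∈ GAG R α k ↔ ∃ e ∈ GEG R α k, a = cls α e := mem_span_cls_image (GEG_le_fil3 α k)

lemma brA_cls {α β : Fin 3 →₀ ℕ} {x y : EE R} (hx : x ∈ fil3 R α) (hy : y ∈ fil3 R β) :
    brA (cls α x) (cls β y) = cls (α + β) (brE x y) := by
  rw [cls_of_mem hx, cls_of_mem hy, cls_of_mem (brE_mem_fil3 hx hy), brA_toA]
  congr 1
  refine Subtype.ext (PowSer.ext fun γ => ?_)
  change brPow (single α x) (single β y) γ = single (α + β) (brE x y) γ
  rw [brPow_apply]
  simp only [single_apply]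
  split_ifs with h
  · rw [Finset.sum_eq_single (α, β)]
    · simp
    · rintro ⟨a, b⟩ h1 h2
      dsimp only
      split_ifs with ha hb
      · exact absurd (Prod.ext ha hb) h2
      all_goals simp
    · intro h'
      exact absurd (Finset.HasAntidiagonal.mem_antidiagonal.2 h.symm) h'
  · refine Finset.sum_eq_zero fun p hp => ?_
    rw [Finset.HasAntidiagonal.mem_antidiagonal] at hp
    split_ifs with ha hb
    · exact absurd (by rw [← hp, ha, hb]) h
    all_goals simp

variable (R) in
/-- The sum of the lower steps of the filtration, which vanishes in the associated graded. -/
noncomputable def lowFil (α : Fin 3 →₀ ℕ) : Submodule R (EE R) := ⨆ β, ⨆ _ : β < α, fil3 R β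

lemma fil3_le_lowFil {α β : Fin 3 →₀ ℕ} (h : β < α) : fil3 R β ≤ lowFil R α :=
  le_iSup₂_of_le (f := fun γ (_ : γ < α) => fil3 R γ) β h le_rfl

lemma lowFil_le_fil3 (α : Fin 3 →₀ ℕ) : lowFil R α ≤ fil3 R α :=
  iSup₂_le fun _ h => fil3_mono h.le

/-- Some entry of `α` can be lowered without falling below `β`, so `s^α x = s_i · s^{α-e_i} x` with
the second factor still in `P`. -/
lemma cls_eq_zero_of_mem_fil3 {α β : Fin 3 →₀ ℕ} (h : β < α) {x : EE R} (hx : x ∈ fil3 R β) :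
    cls α x = 0 := by
  have hi : ∃ i, β i < α i := by
    by_contra! hc
    exact absurd (le_antisymm h.le (fun i => hc i)) h.ne
  obtain ⟨i, hi⟩ := hi
  have h1 : α - e1 i + e1 i = α := sub_single_add_single (by omega)
  have h2 : β ≤ α - e1 i := by
    intro m
    have := h.le m
    by_cases hm : i = m
    · subst hm; simp; omega
    · rw [Finsupp.tsub_apply, e1_apply, if_neg hm]; simpa using this
  have h3 : x ∈ fil3 R (α - e1 i) := fil3_mono h2 hx
  rw [cls_of_mem (fil3_mono h.le hx), toA_eq_zero]
  have : (⟨single α x, single_mem (fil3_mono h.le hx)⟩ : PP R) =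
      (MvPowerSeries.X i : MvPowerSeries (Fin 3) R) • ⟨single (α - e1 i) x, single_mem h3⟩ := by
    refine Subtype.ext (PowSer.ext fun γ => ?_)
    change single α x γ = ((MvPowerSeries.X i : MvPowerSeries (Fin 3) R) • single (α - e1 i) x) γ
    by_cases h0 : γ i = 0
    · rw [X_smul_of_eq_zero i _ h0, single_apply, if_neg]
      rintro rfl
      omega
    · have h4 := sub_single_add_single h0
      have h5 := X_smul_add_single i (single (α - e1 i) x) (γ - e1 i)
      rw [h4] at h5
      rw [h5, single_apply, single_apply]
      congr 1
      apply propext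
      constructor
      · rintro rfl; rfl
      · intro h; rw [← h4, h, h1]
  rw [this]
  exact X_smul_mem_JJ _ _

lemma cls_eq_zero_of_mem_lowFil {α : Fin 3 →₀ ℕ} {x : EE R} (hx : x ∈ lowFil R α) :
    cls α x = 0 := by
  have h : x ∈ fil3 R α ∧ cls α x = 0 := by
    rw [lowFil] at hx
    induction hx using Submodule.iSup_induction' with
    | zero => exact ⟨zero_mem _, cls_zero α⟩
    | add x y _ _ h h' => exact ⟨add_mem h.1 h'.1, by rw [cls_add h.1 h'.1, h.2, h'.2, add_zero]⟩
    | mem β x hx =>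
      induction hx using Submodule.iSup_induction' with
      | zero => exact ⟨zero_mem _, cls_zero α⟩
      | add x y _ _ h h' =>
        exact ⟨add_mem h.1 h'.1, by rw [cls_add h.1 h'.1, h.2, h'.2, add_zero]⟩
      | mem hβ x hx => exact ⟨fil3_mono hβ.le hx, cls_eq_zero_of_mem_fil3 hβ hx⟩
  exact h.2

/-- A functional that vanishes on the lower steps of the filtration, applied to the coefficient
of `s^α`. -/
noncomputable def coefA {V : Type*} [AddCommGroup V] [Module ℝ V] (α : Fin 3 →₀ ℕ)
    (F : EE R →ₗ[ℝ] V) (hF : ∀ x ∈ lowFil R α, F x = 0) : AA R →ₗ[ℝ] V :=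
  descendA
    { toFun := fun p => F (p.1 α)
      map_add' := fun p q => F.map_add (p.1 α) (q.1 α)
      map_smul' := fun c p => F.map_smul c (p.1 α) }
    (fun p hp => by
      change F (p.1 α) = 0
      refine JJ_induction (p := fun p => F (p.1 α) = 0) (map_zero F)
        (fun p q h h' => ?_) (fun i p => ?_) hp
      · change F (p.1 α + q.1 α) = 0
        rw [map_add, h, h', add_zero]
      · change F (((MvPowerSeries.X i : MvPowerSeries (Fin 3) R) • p.1) α) = 0
        -- At `α` the series `s_i p` has the coefficient of `p` at `α - e_i`, an element of a lower
        -- step, or zero if `α` has no room at `i`.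
        by_cases h0 : α i = 0
        · rw [X_smul_of_eq_zero i _ h0, map_zero]
        · have h1 := sub_single_add_single h0
          have h2 := X_smul_add_single i p.1 (α - e1 i)
          rw [h1] at h2
          rw [h2]
          refine hF _ (fil3_le_lowFil ?_ (p.2 _))
          refine lt_of_le_of_ne tsub_le_self fun h => ?_
          have := congrArg (fun f => f i) h
          simp only [Finsupp.tsub_apply, Finsupp.single_eq_same] at this
          omega)

lemma coefA_cls {V : Type*} [AddCommGroup V] [Module ℝ V] {α : Fin 3 →₀ ℕ}
    {F : EE R →ₗ[ℝ] V} (hF : ∀ x ∈ lowFil R α, F x = 0) {β : Fin 3 →₀ ℕ} {x : EE R}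
    (hx : x ∈ fil3 R β) : coefA α F hF (cls β x) = if α = β then F x else 0 := by
  rw [cls_of_mem hx]
  change F (single β x α) = _
  rw [single_apply]
  split_ifs <;> simp

/-- In degree `0` there is no room for a multiple of `θ₀`, and the table entries of degree `0` are
single elements `δ` with coefficient `1`. -/
lemma exists_eq_toE_of_mem_GE_zero {α : Fin 3 →₀ ℕ} {e : EE R} (he : e ∈ GE R α 0) :
    ∃ δ, e = toE (el 1 δ) := by
  have hs : {x : EE R | ∃ k' l, k' + 1 = 0 ∧ TableEntry α k' l ∧ x = th0 R • toE l} = ∅ := by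
    ext; simp
  rw [GE, hs, Submodule.span_empty, sup_bot_eq] at he
  induction he using Submodule.span_induction with
  | zero => exact ⟨0, by rw [el, TensorProduct.tmul_zero, map_zero]⟩
  | add x y _ _ hx hy =>
    obtain ⟨δ, rfl⟩ := hx
    obtain ⟨δ', rfl⟩ := hy
    exact ⟨δ + δ', by rw [el, el, el, TensorProduct.tmul_add, map_add]⟩
  | smul r x _ hx =>
    obtain ⟨δ, rfl⟩ := hx
    exact ⟨r • δ, by rw [el, el, TensorProduct.tmul_smul, toE_smul_fun]⟩
  | mem x hx =>
    obtain ⟨l, hl, rfl⟩ := hx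
    cases hl <;> exact ⟨_, rfl⟩

lemma exists_isGenerator {a : AA R} (ha : a ∈ ⨆ α, ⨆ _ : α ≠ 0, GA R α 0) :
    ∃ p, IsGenerator p ∧ toA p = a := by
  have h0 : ∃ p : PP R, IsGenerator p ∧ toA p = 0 := by
    refine ⟨0, ⟨rfl, fun α => ⟨0, ?_⟩⟩, map_zero _⟩
    rw [el, TensorProduct.tmul_zero, map_zero]; rfl
  have hadd : ∀ a b : AA R, (∃ p, IsGenerator p ∧ toA p = a) → (∃ p, IsGenerator p ∧ toA p = b) →
      ∃ p, IsGenerator p ∧ toA p = a + b := by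
    rintro _ _ ⟨p, hp, rfl⟩ ⟨q, hq, rfl⟩
    refine ⟨p + q, ⟨?_, fun α => ?_⟩, map_add _ _ _⟩
    · change p.1 0 + q.1 0 = 0
      rw [hp.zero, hq.zero, add_zero]
    · obtain ⟨δ, hδ⟩ := hp.degree_zero α
      obtain ⟨δ', hδ'⟩ := hq.degree_zero α
      refine ⟨δ + δ', ?_⟩
      change p.1 α + q.1 α = _
      rw [hδ, hδ', el, el, el, TensorProduct.tmul_add, map_add]
  induction ha using Submodule.iSup_induction' with
  | zero => exact h0
  | add a b _ _ h h' => exact hadd a b h h'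
  | mem α a ha =>
    induction ha using Submodule.iSup_induction' with
    | zero => exact h0
    | add a b _ _ h h' => exact hadd a b h h'
    | mem hα a ha =>
      obtain ⟨e, he, rfl⟩ := mem_GA.1 ha
      obtain ⟨δ, rfl⟩ := exists_eq_toE_of_mem_GE_zero he
      refine ⟨⟨single α (toE (el 1 δ)), single_mem (GE_le_fil3 α 0 he)⟩, ⟨?_, fun γ => ?_⟩,
        (cls_of_mem (GE_le_fil3 α 0 he)).symm⟩
      · change single α _ 0 = 0
        rw [single_apply, if_neg (Ne.symm hα)]
      · change ∃ δ', single α _ γ = _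
        rw [single_apply]
        split_ifs
        · exact ⟨δ, rfl⟩
        · exact ⟨0, by rw [el, TensorProduct.tmul_zero, map_zero]⟩

/-- Elements of degree zero in the sum of the pieces with `α ≠ 000` generate nilpotent
automorphisms of `A`, induced by automorphisms of `P`. -/
theorem isAutA_of_mem_GA {a : AA R} (ha : a ∈ ⨆ α, ⨆ _ : α ≠ 0, GA R α 0) :
    IsNilpotent (brA a : Module.End ℝ (AA R)) ∧ IsAutA (expAd a) ∧
      ∃ Φ : PP R ≃ₗ[MvPowerSeries (Fin 3) ℝ] PP R, IsAutP Φ ∧ ∀ p, toA (Φ p) = expAd a (toA p) := by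
  obtain ⟨p, hp, rfl⟩ := exists_isGenerator ha
  exact ⟨⟨7, pow_seven_brA hp.zero⟩, isAutA_expAd hp, expP p hp.zero, isAutP_expP _ hp,
    toA_expP hp.zero⟩

end Classes

/-! ### Commutators of boosts, rotations, `σ₀` and vector fields. -/

section Brackets

variable {R : Type*} [CommRing R] [Algebra ℝ R]

lemma add_one_add_one (i : Fin 3) : i + 1 + 1 = i + 2 := by decide +revert
lemma add_one_add_two (i : Fin 3) : i + 1 + 2 = i := by decide +revert
lemma add_two_add_one (i : Fin 3) : i + 2 + 1 = i := by decide +revert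
lemma add_two_add_two (i : Fin 3) : i + 2 + 2 = i + 1 := by decide +revert

lemma rot_swap (a b : Fin 4) : rot (R := R) b a = -rot a b := by
  refine Subtype.ext (Prod.ext (neg_zero (G := Derivation ℝ R R)).symm ?_)
  exact (neg_sub (Matrix.single a b (eta R b)) (Matrix.single b a (eta R a))).symm

lemma rot_self (a : Fin 4) : rot (R := R) a a = 0 :=
  Subtype.ext (Prod.ext rfl (sub_self (Matrix.single a a (eta R a))))

/-- The conformal factor of an infinitesimal rotation is zero, so `bracket_rot` applies without
correction term. All structure constants of `so(W)` used below are instances. -/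
lemma bracket_rot_rot (a b c d : Fin 4) : ⁅rot (R := R) a b, rot (R := R) c d⁆ =
    (if c = b then eta R c • rot a d else 0) - (if c = a then eta R c • rot b d else 0) +
      (if d = b then eta R d • rot c a else 0) - (if d = a then eta R d • rot c b else 0) := by
  have h : gram R * (rot (R := R) a b).1.2 + (rot (R := R) a b).1.2.transpose * gram R =
      (0 : R) • gram R := by
    rw [zero_smul]
    ext i j
    simp only [gram, rot, Matrix.add_apply, Matrix.diagonal_mul, Matrix.mul_diagonal,
      Matrix.transpose_apply, rotMat_apply, Matrix.zero_apply]
    grind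
  have hM : ∀ i j, (rot (R := R) a b).1.2 i j = (if i = a then (if j = b then eta R j else 0) else 0) -
      (if i = b then (if j = a then eta R j else 0) else 0) := rotMat_apply a b
  have e : ∀ i j (v : CDerEnd R), (rot (R := R) a b).1.2 i j • v =
      (if i = a then (if j = b then eta R j • v else 0) else 0) -
        (if i = b then (if j = a then eta R j • v else 0) else 0) := by
    intro i j v
    rw [hM]
    refine (sub_smul _ _ v).trans ?_
    congr 1 <;> split_ifs <;> first | rfl | exact zero_smul R v
  rw [bracket_rot _ h, zero_smul, sub_zero]
  simp only [e]
  rw [Finset.sum_add_distrib, Finset.sum_sub_distrib, Finset.sum_sub_distrib,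
    Finset.sum_ite_eq', Finset.sum_ite_eq', Finset.sum_ite_eq', Finset.sum_ite_eq']
  simp only [Finset.mem_univ, if_true]
  abel

lemma neg_one_smul_rot (a b : Fin 4) : (-1 : R) • rot (R := R) a b = -rot a b :=
  neg_one_smul R (rot (R := R) a b)

lemma bracket_rot_sig0 (a b : Fin 4) : ⁅rot (R := R) a b, sig0 (R := R)⁆ = 0 := by
  refine Subtype.ext (Prod.ext (lie_self (0 : Derivation ℝ R R)) ?_)
  ext i j
  simp [coe_bracket, bracketC, rot, sig0]

lemma bracket_rot_inj (a b : Fin 4) (X : Derivation ℝ R R) :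
    ⁅rot (R := R) a b, inj X⁆ = 0 := by
  refine Subtype.ext (Prod.ext (zero_lie X) ?_)
  ext i j
  have : X (rotMat a b i j) = 0 := by
    rw [rotMat_apply]; split_ifs <;> simp [der_eta]
  simp [coe_bracket, bracketC, rot, inj, this]

lemma bracket_sig_sig_self (i : Fin 3) : ⁅sig (R := R) i, sig (R := R) i⁆ = 0 := by
  fin_cases i <;> simp [sig, bracket_rot_rot, rot_self]

lemma bracket_sig_sig_add_one (i : Fin 3) :
    ⁅sig (R := R) i, sig (R := R) (i + 1)⁆ = sigR i (i + 1) := by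
  fin_cases i <;> simp [sig, sigR, bracket_rot_rot, eta, neg_one_smul_rot]

lemma bracket_sig_sig_add_two (i : Fin 3) :
    ⁅sig (R := R) i, sig (R := R) (i + 2)⁆ = -sigR (i + 2) i := by
  fin_cases i <;> simp [sig, sigR, bracket_rot_rot, eta, neg_one_smul_rot] <;> rw [rot_swap]

lemma bracket_sig_sigR (i : Fin 3) :
    ⁅sig (R := R) i, sigR (R := R) i (i + 1)⁆ = sig (i + 1) := by
  fin_cases i <;> simp [sig, sigR, bracket_rot_rot, eta]

lemma bracket_sig_sigR_add_two (i : Fin 3) :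
    ⁅sig (R := R) i, sigR (R := R) (i + 2) i⁆ = -sig (i + 2) := by
  fin_cases i <;> simp [sig, sigR, bracket_rot_rot, eta] <;> rw [rot_swap]

lemma bracket_sig_sigR_add_one (i : Fin 3) :
    ⁅sig (R := R) i, sigR (R := R) (i + 1) (i + 2)⁆ = 0 := by
  fin_cases i <;> simp [sig, sigR, bracket_rot_rot]

lemma bracket_sigR_sig (i : Fin 3) :
    ⁅sigR (R := R) (i + 1) (i + 2), sig (R := R) i⁆ = 0 := by
  fin_cases i <;> simp [sig, sigR, bracket_rot_rot]

lemma bracket_sigR_sig_add_one (i : Fin 3) :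
    ⁅sigR (R := R) (i + 1) (i + 2), sig (R := R) (i + 1)⁆ = -sig (i + 2) := by
  fin_cases i <;> simp [sig, sigR, bracket_rot_rot, eta]

lemma bracket_sigR_sig_add_two (i : Fin 3) :
    ⁅sigR (R := R) (i + 1) (i + 2), sig (R := R) (i + 2)⁆ = sig (i + 1) := by
  fin_cases i <;> simp [sig, sigR, bracket_rot_rot, eta]

lemma bracket_sigR_sigR_self (i : Fin 3) :
    ⁅sigR (R := R) (i + 1) (i + 2), sigR (R := R) (i + 1) (i + 2)⁆ = 0 := by
  fin_cases i <;> simp [sigR, bracket_rot_rot, rot_self]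

lemma bracket_sigR_sigR_add_two (i : Fin 3) :
    ⁅sigR (R := R) (i + 1) (i + 2), sigR (R := R) (i + 2) i⁆ = -sigR i (i + 1) := by
  fin_cases i <;> simp [sigR, bracket_rot_rot, eta] <;> rw [rot_swap]

lemma bracket_sigR_sigR (i : Fin 3) :
    ⁅sigR (R := R) (i + 1) (i + 2), sigR (R := R) i (i + 1)⁆ = sigR (i + 2) i := by
  fin_cases i <;> simp [sigR, bracket_rot_rot, eta] <;> rw [rot_swap] <;> simp

lemma sig_th0 (i : Fin 3) : extDer (sig (R := R) i).1 (th0 R) = th R i := (sig_theta i).1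
lemma sig_th (i : Fin 3) : extDer (sig (R := R) i).1 (th R i) = th0 R := (sig_theta i).2.1
lemma sig_th_add_one (i : Fin 3) : extDer (sig (R := R) i).1 (th R (i + 1)) = 0 :=
  (sig_theta i).2.2 _ (by decide +revert)
lemma sig_th_add_two (i : Fin 3) : extDer (sig (R := R) i).1 (th R (i + 2)) = 0 :=
  (sig_theta i).2.2 _ (by decide +revert)

lemma sigR_th0 (i : Fin 3) : extDer (sigR (R := R) (i + 1) (i + 2)).1 (th0 R) = 0 :=
  (sigR_theta _ _ (by decide +revert)).1
lemma sigR_th (i : Fin 3) : extDer (sigR (R := R) (i + 1) (i + 2)).1 (th R i) = 0 :=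
  (sigR_theta _ _ (by decide +revert)).2.2.2 i (by decide +revert) (by decide +revert)
lemma sigR_th_add_one (i : Fin 3) :
    extDer (sigR (R := R) (i + 1) (i + 2)).1 (th R (i + 1)) = -th R (i + 2) :=
  (sigR_theta _ _ (by decide +revert)).2.1
lemma sigR_th_add_two (i : Fin 3) :
    extDer (sigR (R := R) (i + 1) (i + 2)).1 (th R (i + 2)) = th R (i + 1) :=
  (sigR_theta _ _ (by decide +revert)).2.2.1

lemma fun_smul_el_one (f : R) (δ : CDerEnd R) : f • toE (el 1 δ) = toE (el 1 (f • δ)) := by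
  rw [← toE_smul_fun, el, el, TensorProduct.tmul_smul]

/-- The bracket of `fδ`, for `δ` annihilating functions, with `gl`. -/
lemma brE_fun_smul {δ : CDerEnd R} (hδ : δ.1.1 = 0) (f g : R) (l : Lie R) :
    brE (f • toE (el 1 δ)) (g • toE l) =
      (f * g) • toE (lieL δ l) - g • toE (el (ract (algebraMap R _ f) l) δ) := by
  have h : ∀ l : Lie R, lieL (f • δ) l = f • lieL δ l - el (ract (algebraMap R _ f) l) δ := by
    intro l
    induction l using TensorProduct.induction_on with
    | zero => simp [el]
    | add a b ha hb =>
      rw [map_add, ha, hb, map_add, map_add, el, el, el, TensorProduct.add_tmul, smul_add]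
      abel
    | tmul u δ' =>
      rw [lieL_tmul, lieL_tmul, ract_tmul, smul_bracket, Submodule.coe_smul, extDer_smul_left,
        extDer_algebraMap, ← Algebra.smul_def, TensorProduct.tmul_sub, TensorProduct.tmul_smul,
        TensorProduct.tmul_smul, smul_add, el, TensorProduct.smul_tmul', TensorProduct.smul_tmul']
      abel
  rw [fun_smul_el_one, brE_one_smul_fun, brE_one_toE, h, map_sub, smul_sub, toE_smul_fun, smul_smul,
    mul_comm f, Submodule.coe_smul, Prod.smul_fst, hδ, smul_zero, Derivation.zero_apply, zero_smul,
    add_zero]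

end Brackets

/-! ### Elements of `F_αE` and of the gauge subspace. -/

section Members

variable {R : Type*} [CommRing R] [Algebra ℝ R]

lemma th0_inj_mem (X : Derivation ℝ R R) : toE (el (th0 R) (inj X)) ∈ fil3 R 0 := by
  have := th0_smul_mem_fil3 (tableEntry_mem_fil3 (TableEntry.g000_D X))
  rwa [← map_smul, TensorProduct.smul_tmul', smul_eq_mul, mul_one] at this

lemma th0_sig0_mem : toE (el (th0 R) sig0) ∈ fil3 R 0 := by
  have := th0_smul_mem_fil3 (tableEntry_mem_fil3 (R := R) TableEntry.g000_a)
  rwa [← map_smul, TensorProduct.smul_tmul', smul_eq_mul, mul_one] at this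

/-- The difference of the entry `θ₀σ₀ + θ_iσ_i` and of `θ₀` times the entry `σ₀`. Both summands have
index `000`, although only their sum is a gauge entry. -/
lemma th_sig_mem (i : Fin 3) : toE (el (th R i) (sig i)) ∈ fil3 R 0 := by
  have := sub_mem (tableEntry_mem_fil3 (R := R) (TableEntry.g000_b i)) th0_sig0_mem
  rwa [← map_sub, add_sub_cancel_left] at this

lemma th0_sig_mem (i : Fin 3) :
    toE (el (th0 R) (sig i)) ∈ fil3 R (e1 (i + 1) + e1 (i + 2)) := by
  have := th0_smul_mem_fil3 (tableEntry_mem_fil3 (R := R) (TableEntry.g011_a i))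
  rwa [← map_smul, TensorProduct.smul_tmul', smul_eq_mul, mul_one] at this

lemma th0_sigR_mem (i : Fin 3) :
    toE (el (th0 R) (sigR (i + 1) (i + 2))) ∈ fil3 R (e1 (i + 1) + e1 (i + 2)) := by
  have := th0_smul_mem_fil3 (tableEntry_mem_fil3 (R := R) (TableEntry.g011_b i))
  rwa [← map_smul, TensorProduct.smul_tmul', smul_eq_mul, mul_one] at this

lemma th_sig0_mem (i : Fin 3) :
    toE (el (th R i) sig0) ∈ fil3 R (e1 (i + 1) + e1 (i + 2)) := by
  have := sub_mem (tableEntry_mem_fil3 (R := R) (TableEntry.g011_c i)) (th0_sig_mem i)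
  rwa [← map_sub, add_sub_cancel_left] at this

lemma mem_of_two_smul_mem {M : Submodule R (EE R)} {x : EE R} (h : x + x ∈ M) : x ∈ M := by
  have h1 : (algebraMap ℝ R 2⁻¹) • (x + x) = x := by
    rw [algebraMap_smul, ← two_smul ℝ x, smul_smul]; norm_num
  rw [← h1]
  exact Submodule.smul_mem _ _ h

lemma lt_of_forall {α β : Fin 3 →₀ ℕ} (h : (∀ m, α m ≤ β m) ∧ ∃ m, α m < β m) : α < β := by
  refine lt_of_le_of_ne h.1 ?_
  rintro rfl
  obtain ⟨m, hm⟩ := h.2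
  exact lt_irrefl _ hm

/-- By stationarity from index `2` on, an entry `≥ 3` can be lowered by one; such an index
contributes nothing to the associated graded. -/
lemma fil3_le_lowFil_of_three_le {α : Fin 3 →₀ ℕ} {i : Fin 3} (h : 3 ≤ α i) :
    fil3 R α ≤ lowFil R α := by
  have h1 := sub_single_add_single (γ := α) (i := i) (by omega)
  have h2 : (α - e1 i) i = α i - 1 := by simp
  have h3 : fil3 R (α - e1 i + e1 i) ≤ fil3 R (α - e1 i) := fil3_add_single_le (by omega)
  rw [h1] at h3
  refine h3.trans (fil3_le_lowFil (lt_of_le_of_ne tsub_le_self fun h => ?_))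
  rw [h] at h2
  omega

variable (R) in
/-- The part of `F_αE` that is represented in `G_αA_G` in degree `1`. -/
noncomputable def gaugeFil (α : Fin 3 →₀ ℕ) : Submodule R (EE R) := GEG R α 1 ⊔ lowFil R α

lemma gaugeFil_of_lt {α β : Fin 3 →₀ ℕ} (h : β < α) {x : EE R} (hx : x ∈ fil3 R β) :
    x ∈ gaugeFil R α := Submodule.mem_sup_right (fil3_le_lowFil h hx)

lemma gaugeFil_of_entry {α : Fin 3 →₀ ℕ} {l : Lie R} (h : TableEntry α 1 l) :
    toE l ∈ gaugeFil R α := Submodule.mem_sup_left (Submodule.subset_span ⟨l, h, rfl⟩)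

lemma pair_lt (i : Fin 3) : e1 (i + 1) + e1 (i + 2) < 2 • e1 i + e1 (i + 1) + e1 (i + 2) :=
  lt_of_forall (by simp only [e1_add_apply, two_e1_add_apply]; decide +revert)

/-- In the index `2e_i + e_j + e_k` both `θ_jσ_k` and `θ_kσ_j` are in the gauge subspace. -/
lemma th_sig_mem_gaugeFil (i : Fin 3) :
    toE (el (th R (i + 1)) (sig (i + 2))) ∈ gaugeFil R (2 • e1 i + e1 (i + 1) + e1 (i + 2)) ∧
      toE (el (th R (i + 2)) (sig (i + 1))) ∈ gaugeFil R (2 • e1 i + e1 (i + 1) + e1 (i + 2)) := by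
  -- The sum `θ_jσ_k + θ_kσ_j` comes from the lower index `e_j + e_k`, the difference is the entry
  -- of the index itself; `2` is invertible.
  have h1 := gaugeFil_of_lt (pair_lt i) (tableEntry_mem_fil3 (R := R) (TableEntry.g011_d i))
  have h2 := gaugeFil_of_entry (R := R) (TableEntry.g211_a i)
  rw [map_add] at h1
  rw [map_sub] at h2
  constructor
  · refine mem_of_two_smul_mem ?_
    have := add_mem h1 h2
    convert this using 1; abel
  · refine mem_of_two_smul_mem ?_
    have := sub_mem h1 h2
    convert this using 1; abel

/-- Rotational elements in terms of the entries with index `2e_j` and `2e_k`. -/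
lemma th_sigR_mem_lowFil (i : Fin 3) {α : Fin 3 →₀ ℕ} (h1 : 2 • e1 (i + 1) < α)
    (h2 : 2 • e1 (i + 2) < α) :
    toE (el (th R i) (sigR (i + 1) (i + 2))) ∈ lowFil R α ∧
      toE (el (th R (i + 2)) (sigR i (i + 1))) - toE (el (th R (i + 1)) (sigR (i + 2) i)) ∈
        lowFil R α := by
  -- The entries of index `2e_j` and `2e_k` agree in `θ_iσ_{jk}` and have opposite signs at
  -- `θ_jσ_{ki}` and `θ_kσ_{ij}`; half the sum and half the difference are the two claims.
  have a1 := fil3_le_lowFil h1 (tableEntry_mem_fil3 (R := R) (TableEntry.g200 (i + 1)))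
  have a2 := fil3_le_lowFil h2 (tableEntry_mem_fil3 (R := R) (TableEntry.g200 (i + 2)))
  simp only [add_one_add_one, add_one_add_two, add_two_add_one, add_two_add_two, map_add,
    map_neg] at a1 a2
  constructor
  · refine mem_of_two_smul_mem ?_
    have := add_mem a1 a2
    convert this using 1; abel
  · refine mem_of_two_smul_mem ?_
    have := sub_mem a1 a2
    convert this using 1; abel

lemma th_sigR_add_mem_lowFil (i : Fin 3) {α : Fin 3 →₀ ℕ} (h0 : 2 • e1 i < α)
    (h1 : 2 • e1 (i + 1) < α) (h2 : 2 • e1 (i + 2) < α) :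
    toE (el (th R (i + 2)) (sigR i (i + 1))) + toE (el (th R (i + 1)) (sigR (i + 2) i)) ∈
      lowFil R α := by
  have a0 := fil3_le_lowFil h0 (tableEntry_mem_fil3 (R := R) (TableEntry.g200 i))
  have a1 := (th_sigR_mem_lowFil (R := R) i h1 h2).1
  simp only [map_add, map_neg] at a0
  have := add_mem a0 a1
  convert this using 1; abel

end Members

/-! ### Boosts and rotations preserve the gauge subspace away from index `000`. -/

section Invariance

variable {R : Type*} [CommRing R] [Algebra ℝ R]

lemma sig_fst (i : Fin 3) : (sig (R := R) i).1.1 = 0 := rfl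
lemma sigR_fst (i j : Fin 3) : (sigR (R := R) i j).1.1 = 0 := rfl
lemma sig0_fst : (sig0 (R := R)).1.1 = 0 := rfl
lemma inj_fst (X : Derivation ℝ R R) : (inj X).1.1 = X := rfl

lemma bracket_sig_sig0 (i : Fin 3) : ⁅sig (R := R) i, sig0 (R := R)⁆ = 0 := bracket_rot_sig0 _ _
lemma bracket_sigR_sig0 (i j : Fin 3) : ⁅sigR (R := R) i j, sig0 (R := R)⁆ = 0 :=
  bracket_rot_sig0 _ _
lemma bracket_sig_inj (i : Fin 3) (X : Derivation ℝ R R) : ⁅sig (R := R) i, inj X⁆ = 0 :=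
  bracket_rot_inj _ _ _
lemma bracket_sigR_inj (i j : Fin 3) (X : Derivation ℝ R R) : ⁅sigR (R := R) i j, inj X⁆ = 0 :=
  bracket_rot_inj _ _ _

lemma ract_algebraMap_tmul (f : R) (u : Ext R) (δ : CDerEnd R) :
    ract (algebraMap R _ f) (u ⊗ₜ[R] δ) = δ.1.1 f • u := by
  rw [ract_tmul, extDer_algebraMap, ← Algebra.smul_def]

variable (R) in
/-- Elements of the gauge subspace with the index `2e_i + e_j + e_k`, for `(i, j, k)` cyclic. -/
structure PairAtoms (i j k : Fin 3) (γ : Fin 3 →₀ ℕ) : Prop where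
  inj : ∀ X, toE (el (th R i) (inj X)) ∈ gaugeFil R γ
  boost : toE (el (th0 R) (sig i)) ∈ gaugeFil R γ
  rot : toE (el (th0 R) (sigR j k)) ∈ gaugeFil R γ
  dil : toE (el (th R i) sig0) ∈ gaugeFil R γ
  rotk : toE (el (th R k) (sigR k i)) ∈ gaugeFil R γ
  rotj : toE (el (th R j) (sigR i j)) ∈ gaugeFil R γ
  jk : toE (el (th R j) (sig k)) ∈ gaugeFil R γ
  kj : toE (el (th R k) (sig j)) ∈ gaugeFil R γ

/-- All but the last two elements have index `e_j + e_k`, hence lie in a lower step. For `θ_jσ_k`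
and `θ_kσ_j` separately the entry of the index itself is needed. -/
lemma pairAtoms (i : Fin 3) :
    PairAtoms R i (i + 1) (i + 2) (2 • e1 i + e1 (i + 1) + e1 (i + 2)) := by
  have h := fun {x} => gaugeFil_of_lt (R := R) (pair_lt i) (x := x)
  exact ⟨fun X => h (tableEntry_mem_fil3 (TableEntry.g011_D i X)), h (th0_sig_mem i),
    h (th0_sigR_mem i), h (th_sig0_mem i), h (tableEntry_mem_fil3 (TableEntry.g011_e i)),
    h (tableEntry_mem_fil3 (TableEntry.g011_f i)), (th_sig_mem_gaugeFil i).1,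
    (th_sig_mem_gaugeFil i).2⟩

lemma gaugeFil_atoms_zero {γ : Fin 3 →₀ ℕ} (hγ : 0 < γ) :
    (∀ X, toE (el (th0 R) (inj X)) ∈ gaugeFil R γ) ∧
    toE (el (th0 R) sig0) ∈ gaugeFil R γ ∧
    ∀ i, toE (el (th R i) (sig i)) ∈ gaugeFil R γ :=
  ⟨fun X => gaugeFil_of_lt hγ (th0_inj_mem X), gaugeFil_of_lt hγ th0_sig0_mem,
    fun i => gaugeFil_of_lt hγ (th_sig_mem i)⟩

lemma brE_mem_gaugeFil_of {δ : CDerEnd R} (hδ : δ.1.1 = 0) {l : Lie R} {γ : Fin 3 →₀ ℕ} (f g : R)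
    (h1 : toE (lieL δ l) ∈ gaugeFil R γ)
    (h2 : toE (el (ract (algebraMap R _ f) l) δ) ∈ gaugeFil R γ) :
    brE (f • toE (el 1 δ)) (g • toE l) ∈ gaugeFil R γ := by
  rw [brE_fun_smul hδ]
  exact sub_mem (Submodule.smul_mem _ _ h1) (Submodule.smul_mem _ _ h2)

lemma brE_mem_gaugeFil_of_three_le {δ : CDerEnd R} {l : Lie R} {α β : Fin 3 →₀ ℕ} (f g : R)
    (h1 : toE (el 1 δ) ∈ fil3 R α) (h2 : toE l ∈ fil3 R β) (m : Fin 3) (h : 3 ≤ (α + β) m) :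
    brE (f • toE (el 1 δ)) (g • toE l) ∈ gaugeFil R (α + β) :=
  Submodule.mem_sup_right (fil3_le_lowFil_of_three_le h
    (brE_mem_fil3 (Submodule.smul_mem _ _ h1) (Submodule.smul_mem _ _ h2)))

lemma fin3_cases (i i' : Fin 3) : i' = i ∨ i' = i + 1 ∨ i' = i + 2 := by decide +revert

lemma idx_one (i : Fin 3) : e1 (i + 1) + e1 (i + 2) + (e1 (i + 2) + e1 i) =
    2 • e1 (i + 2) + e1 i + e1 (i + 1) := by rw [two_nsmul]; abel

lemma idx_two (i : Fin 3) : e1 (i + 1) + e1 (i + 2) + (e1 i + e1 (i + 1)) =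
    2 • e1 (i + 1) + e1 (i + 2) + e1 i := by rw [two_nsmul]; abel

lemma idx_pos (i : Fin 3) (β : Fin 3 →₀ ℕ) : 0 < e1 (i + 1) + e1 (i + 2) + β :=
  lt_of_lt_of_le (lt_of_forall ⟨fun _ => Nat.zero_le _, i + 1, by
    simp only [e1_add_apply]; decide +revert⟩) (self_le_add_right _ β)

/-- The index is `2e_j + 2e_k`, above `2e_j` and `2e_k`, whose entries combine to these elements. -/
lemma gaugeFil_atoms_pair (i : Fin 3) :
    toE (el (th R i) (sigR (i + 1) (i + 2))) ∈
        gaugeFil R (e1 (i + 1) + e1 (i + 2) + (e1 (i + 1) + e1 (i + 2))) ∧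
      toE (el (th R (i + 2)) (sigR i (i + 1))) - toE (el (th R (i + 1)) (sigR (i + 2) i)) ∈
        gaugeFil R (e1 (i + 1) + e1 (i + 2) + (e1 (i + 1) + e1 (i + 2))) := by
  have a0 := th_sigR_mem_lowFil (R := R) i
    (α := e1 (i + 1) + e1 (i + 2) + (e1 (i + 1) + e1 (i + 2)))
    (lt_of_forall (by simp only [Finsupp.add_apply, e1_apply, two_e1_apply]; decide +revert))
    (lt_of_forall (by simp only [Finsupp.add_apply, e1_apply, two_e1_apply]; decide +revert))
  exact ⟨Submodule.mem_sup_right a0.1, Submodule.mem_sup_right a0.2⟩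

lemma gaugeFil_atoms_double (i : Fin 3) :
    toE (el (th0 R) (sigR (i + 1) (i + 2))) ∈ gaugeFil R (e1 (i + 1) + e1 (i + 2) + 2 • e1 i) ∧
      toE (el (th R (i + 1)) (sig (i + 2))) ∈ gaugeFil R (e1 (i + 1) + e1 (i + 2) + 2 • e1 i) ∧
      toE (el (th R (i + 2)) (sig (i + 1))) ∈ gaugeFil R (e1 (i + 1) + e1 (i + 2) + 2 • e1 i) := by
  have h := pairAtoms (R := R) i
  rw [add_assoc, add_comm (2 • e1 i)] at h
  exact ⟨h.rot, h.jk, h.kj⟩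

/-- The index is `222`, above all three of `2e_i`, `2e_j`, `2e_k`. -/
lemma gaugeFil_atoms_all (i : Fin 3) :
    toE (el (th R (i + 1)) (sigR (i + 2) i)) + toE (el (th R (i + 2)) (sigR i (i + 1))) ∈
        gaugeFil R (e1 (i + 1) + e1 (i + 2) + (2 • e1 i + e1 (i + 1) + e1 (i + 2))) := by
  rw [add_comm (toE _)]
  refine Submodule.mem_sup_right (th_sigR_add_mem_lowFil i ?_ ?_ ?_) <;>
    exact lt_of_forall (by simp only [Finsupp.add_apply, e1_apply, two_e1_apply]; decide +revert)

lemma pairAtoms_add_one (i : Fin 3) :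
    PairAtoms R (i + 1) (i + 2) i (e1 (i + 1) + e1 (i + 2) + (e1 i + e1 (i + 1))) := by
  have h := pairAtoms (R := R) (i + 1)
  rwa [add_one_add_one, add_one_add_two, ← idx_two] at h

lemma pairAtoms_add_two (i : Fin 3) :
    PairAtoms R (i + 2) i (i + 1) (e1 (i + 1) + e1 (i + 2) + (e1 (i + 2) + e1 i)) := by
  have h := pairAtoms (R := R) (i + 2)
  rwa [add_two_add_one, add_two_add_two, ← idx_one] at h

/-- For `i' ≠ i` the pair `e_j + e_k` has a `1` at `i'`, which `2e_{i'}` raises to `3`. -/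
lemma three_le_of_ne {i i' : Fin 3} (h : i' ≠ i) (α : Fin 3 →₀ ℕ) :
    3 ≤ (e1 (i + 1) + e1 (i + 2) + (2 • e1 i' + α)) i' := by
  have : 3 ≤ (if i + 1 = i' then 1 else 0) + (if i + 2 = i' then 1 else 0) + 2 := by decide +revert
  simp only [Finsupp.add_apply, e1_apply, two_e1_apply, if_true]
  omega

-- Why the part of `y` away from `000` does not enter the condition on `f`. Entries of index
-- `2e_{i'}` or `2e_{i'} + e_{j'} + e_{k'}` with `i' ≠ i` reach an index entry `3`, where the graded
-- piece is zero. All other brackets are combinations of elements in lower steps or in the table at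
-- the target index. Index `000` has to be excluded: there the bracket produces `θ_iσ₀` without its
-- partner `θ₀σ_i`.
set_option linter.unusedSimpArgs false in
lemma brE_sig_mem_gaugeFil (i : Fin 3) {β : Fin 3 →₀ ℕ} (hβ : β ≠ 0) (f g : R) {l : Lie R}
    (h : TableEntry β 1 l) :
    brE (f • toE (el 1 (sig i))) (g • toE l) ∈ gaugeFil R (e1 (i + 1) + e1 (i + 2) + β) := by
  have hm := tableEntry_mem_fil3 (R := R) (TableEntry.g011_a i)
  have hl := tableEntry_mem_fil3 h
  cases h
  case g000_b => exact absurd rfl hβ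
  case g200 i' =>
    by_cases hi' : i' = i
    · subst hi'
      obtain ⟨a1, a2, a3⟩ := gaugeFil_atoms_double (R := R) i'
      refine brE_mem_gaugeFil_of (sig_fst _) f g ?_ ?_ <;>
        simp only [lieL_tmul, map_add, map_sub, map_neg, add_one_add_one, add_one_add_two,
        add_two_add_one, add_two_add_two, ract_algebraMap_tmul, bracket_sig_sig_self,
        bracket_sig_sig_add_one, bracket_sig_sig_add_two, bracket_sig_sigR,
        bracket_sig_sigR_add_two, bracket_sig_sigR_add_one, bracket_sig_sig0, bracket_sig_inj,
        sig_th0, sig_th, sig_th_add_one, sig_th_add_two, sig_fst, sigR_fst, sig0_fst,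
        inj_fst, TensorProduct.tmul_neg, TensorProduct.neg_tmul, TensorProduct.tmul_zero,
        TensorProduct.zero_tmul, Derivation.zero_apply, zero_smul, add_zero, zero_add, sub_zero,
        neg_zero, sub_self, map_zero, neg_neg, neg_add_eq_sub, ← sub_eq_add_neg, el,
        ← TensorProduct.smul_tmul', toE_smul_fun]
      · exact add_mem (sub_mem (neg_mem a2) a1) a3
      · exact zero_mem _
    · exact brE_mem_gaugeFil_of_three_le f g hm hl i' (three_le_of_ne hi' 0)
  case g211_a i' =>
    by_cases hi' : i' = i
    · subst hi'
      have a := gaugeFil_atoms_all (R := R) i'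
      refine brE_mem_gaugeFil_of (sig_fst _) f g ?_ ?_ <;>
        simp only [lieL_tmul, map_add, map_sub, map_neg, add_one_add_one, add_one_add_two,
        add_two_add_one, add_two_add_two, ract_algebraMap_tmul, bracket_sig_sig_self,
        bracket_sig_sig_add_one, bracket_sig_sig_add_two, bracket_sig_sigR,
        bracket_sig_sigR_add_two, bracket_sig_sigR_add_one, bracket_sig_sig0, bracket_sig_inj,
        sig_th0, sig_th, sig_th_add_one, sig_th_add_two, sig_fst, sigR_fst, sig0_fst,
        inj_fst, TensorProduct.tmul_neg, TensorProduct.neg_tmul, TensorProduct.tmul_zero,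
        TensorProduct.zero_tmul, Derivation.zero_apply, zero_smul, add_zero, zero_add, sub_zero,
        neg_zero, sub_self, map_zero, neg_neg, neg_add_eq_sub, ← sub_eq_add_neg, el,
        ← TensorProduct.smul_tmul', toE_smul_fun]
      · rw [← neg_add']; exact neg_mem a
      · exact zero_mem _
    · rw [add_assoc (2 • e1 i')] at hl ⊢
      exact brE_mem_gaugeFil_of_three_le f g hm hl i' (three_le_of_ne hi' _)
  -- The remaining entries have index `e_{j'} + e_{k'}`. The target is `2e_j + 2e_k` for `i' = i`
  -- and `2e_l` plus the other two unit vectors otherwise, with `l = k` for `i' = i + 1` and `l = j`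
  -- for `i' = i + 2`. After expansion each bracket is a combination of the elements collected here.
  all_goals
    obtain ⟨b1, b2, b3⟩ := gaugeFil_atoms_zero (R := R) (idx_pos i (e1 (i + 1) + e1 (i + 2)))
    obtain ⟨p1, p2⟩ := gaugeFil_atoms_pair (R := R) i
    have p3 := neg_mem p2
    rw [neg_sub] at p3
    obtain ⟨c1, c2, c3, c4, c5, c6, c7, c8⟩ := pairAtoms_add_one (R := R) i
    obtain ⟨d1, d2, d3, d4, d5, d6, d7, d8⟩ := pairAtoms_add_two (R := R) i
    rcases fin3_cases i ‹Fin 3› with rfl | rfl | rfl <;>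
      refine brE_mem_gaugeFil_of (sig_fst _) f g ?_ ?_ <;>
        simp only [lieL_tmul, map_add, map_sub, map_neg, add_one_add_one, add_one_add_two,
        add_two_add_one, add_two_add_two, ract_algebraMap_tmul, bracket_sig_sig_self,
        bracket_sig_sig_add_one, bracket_sig_sig_add_two, bracket_sig_sigR,
        bracket_sig_sigR_add_two, bracket_sig_sigR_add_one, bracket_sig_sig0, bracket_sig_inj,
        sig_th0, sig_th, sig_th_add_one, sig_th_add_two, sig_fst, sigR_fst, sig0_fst,
        inj_fst, TensorProduct.tmul_neg, TensorProduct.neg_tmul, TensorProduct.tmul_zero,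
        TensorProduct.zero_tmul, Derivation.zero_apply, zero_smul, add_zero, zero_add, sub_zero,
        neg_zero, sub_self, map_zero, neg_neg, neg_add_eq_sub, ← sub_eq_add_neg, el,
        ← TensorProduct.smul_tmul', toE_smul_fun] <;>
      repeat' first
        | with_reducible assumption
        | with_reducible exact zero_mem _
        | with_reducible exact b3 _
        | with_reducible exact b1 _
        | with_reducible exact c1 _
        | with_reducible exact d1 _
        | with_reducible refine Submodule.smul_mem _ _ ?_
        | with_reducible refine neg_mem ?_
        | with_reducible refine add_mem ?_ ?_
        | with_reducible refine sub_mem ?_ ?_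

-- The scheme is that for boosts. The entries of index `2e_i` and `2e_i + e_j + e_k` are invariant
-- under rotations in the `jk`-plane, so there the bracket is zero.
set_option linter.unusedSimpArgs false in
lemma brE_sigR_mem_gaugeFil (i : Fin 3) {β : Fin 3 →₀ ℕ} (hβ : β ≠ 0) (f g : R) {l : Lie R}
    (h : TableEntry β 1 l) :
    brE (f • toE (el 1 (sigR (i + 1) (i + 2)))) (g • toE l) ∈ gaugeFil R (e1 (i + 1) + e1 (i + 2) + β) := by
  have hm := tableEntry_mem_fil3 (R := R) (TableEntry.g011_b i)
  have hl := tableEntry_mem_fil3 h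
  cases h
  case g000_b => exact absurd rfl hβ
  case g200 i' =>
    by_cases hi' : i' = i
    · subst hi'
      refine brE_mem_gaugeFil_of (sigR_fst _ _) f g ?_ ?_ <;>
        simp only [lieL_tmul, map_add, map_sub, map_neg, add_one_add_one, add_one_add_two,
        add_two_add_one, add_two_add_two, ract_algebraMap_tmul, bracket_sigR_sig,
        bracket_sigR_sig_add_one, bracket_sigR_sig_add_two,
        bracket_sigR_sigR_self, bracket_sigR_sigR_add_two, bracket_sigR_sigR, bracket_sigR_sig0, bracket_sigR_inj,
        sigR_th0, sigR_th, sigR_th_add_one, sigR_th_add_two, sig_fst, sigR_fst, sig0_fst,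
        inj_fst, TensorProduct.tmul_neg, TensorProduct.neg_tmul, TensorProduct.tmul_zero,
        TensorProduct.zero_tmul, Derivation.zero_apply, zero_smul, add_zero, zero_add, sub_zero,
        neg_zero, sub_self, map_zero, neg_neg, neg_add_eq_sub, ← sub_eq_add_neg, el,
        ← TensorProduct.smul_tmul', toE_smul_fun]
      · rw [← neg_add', add_comm (toE _), neg_add_cancel]; exact zero_mem _
      · exact zero_mem _
    · exact brE_mem_gaugeFil_of_three_le f g hm hl i' (three_le_of_ne hi' 0)
  case g211_a i' =>
    by_cases hi' : i' = i
    · subst hi'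
      refine brE_mem_gaugeFil_of (sigR_fst _ _) f g ?_ ?_ <;>
        simp only [lieL_tmul, map_add, map_sub, map_neg, add_one_add_one, add_one_add_two,
        add_two_add_one, add_two_add_two, ract_algebraMap_tmul, bracket_sigR_sig,
        bracket_sigR_sig_add_one, bracket_sigR_sig_add_two,
        bracket_sigR_sigR_self, bracket_sigR_sigR_add_two, bracket_sigR_sigR, bracket_sigR_sig0, bracket_sigR_inj,
        sigR_th0, sigR_th, sigR_th_add_one, sigR_th_add_two, sig_fst, sigR_fst, sig0_fst,
        inj_fst, TensorProduct.tmul_neg, TensorProduct.neg_tmul, TensorProduct.tmul_zero,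
        TensorProduct.zero_tmul, Derivation.zero_apply, zero_smul, add_zero, zero_add, sub_zero,
        neg_zero, sub_self, map_zero, neg_neg, neg_add_eq_sub, ← sub_eq_add_neg, el,
        ← TensorProduct.smul_tmul', toE_smul_fun]
      · exact zero_mem _
      · exact zero_mem _
    · rw [add_assoc (2 • e1 i')] at hl ⊢
      exact brE_mem_gaugeFil_of_three_le f g hm hl i' (three_le_of_ne hi' _)
  all_goals
    obtain ⟨b1, b2, b3⟩ := gaugeFil_atoms_zero (R := R) (idx_pos i (e1 (i + 1) + e1 (i + 2)))
    obtain ⟨p1, p2⟩ := gaugeFil_atoms_pair (R := R) i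
    have p3 := neg_mem p2
    rw [neg_sub] at p3
    obtain ⟨c1, c2, c3, c4, c5, c6, c7, c8⟩ := pairAtoms_add_one (R := R) i
    obtain ⟨d1, d2, d3, d4, d5, d6, d7, d8⟩ := pairAtoms_add_two (R := R) i
    rcases fin3_cases i ‹Fin 3› with rfl | rfl | rfl <;>
      refine brE_mem_gaugeFil_of (sigR_fst _ _) f g ?_ ?_ <;>
        simp only [lieL_tmul, map_add, map_sub, map_neg, add_one_add_one, add_one_add_two,
        add_two_add_one, add_two_add_two, ract_algebraMap_tmul, bracket_sigR_sig,
        bracket_sigR_sig_add_one, bracket_sigR_sig_add_two,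
        bracket_sigR_sigR_self, bracket_sigR_sigR_add_two, bracket_sigR_sigR, bracket_sigR_sig0, bracket_sigR_inj,
        sigR_th0, sigR_th, sigR_th_add_one, sigR_th_add_two, sig_fst, sigR_fst, sig0_fst,
        inj_fst, TensorProduct.tmul_neg, TensorProduct.neg_tmul, TensorProduct.tmul_zero,
        TensorProduct.zero_tmul, Derivation.zero_apply, zero_smul, add_zero, zero_add, sub_zero,
        neg_zero, sub_self, map_zero, neg_neg, neg_add_eq_sub, ← sub_eq_add_neg, el,
        ← TensorProduct.smul_tmul', toE_smul_fun] <;>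
      repeat' first
        | with_reducible assumption
        | with_reducible exact zero_mem _
        | with_reducible exact b3 _
        | with_reducible exact b1 _
        | with_reducible exact c1 _
        | with_reducible exact d1 _
        | with_reducible refine Submodule.smul_mem _ _ ?_
        | with_reducible refine neg_mem ?_
        | with_reducible refine add_mem ?_ ?_
        | with_reducible refine sub_mem ?_ ?_

end Invariance

/-! ### Exponentials on `A`: linearity, truncation, and stability of the gauge subspace. -/

section GaugeAutomorphisms

variable {R : Type*} [CommRing R] [Algebra ℝ R]

lemma real_smul_eq (c : ℝ) (a : AA R) : c • a = algebraMap ℝ R c • a := by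
  obtain ⟨p, rfl⟩ := toA_surjective a
  rw [← toA_smul_real, ← toA_smul_fun]
  exact congrArg _ (Subtype.ext (PowSer.ext fun γ => (algebraMap_smul R c (p.1 γ)).symm))

lemma mon_eq_smul {α : Fin 3 →₀ ℕ} (f : R) {l : Lie R} (h : toE l ∈ fil3 R α) :
    mon α f l = f • mon α 1 l := by
  rw [mon, mon, one_smul, cls_smul f h]

lemma mon_mem_GA {α : Fin 3 →₀ ℕ} {k : ℕ} (f : R) {l : Lie R} (h : TableEntry α k l) :
    mon α f l ∈ GA R α k :=
  Submodule.subset_span ⟨_, Submodule.smul_mem _ _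
    (Submodule.mem_sup_left (Submodule.subset_span ⟨l, h, rfl⟩)), rfl⟩

lemma brE_smul_fun {δ : CDerEnd R} (hδ : δ.1.1 = 0) (f r : R) (e : EE R) :
    brE (f • toE (el 1 δ)) (r • e) = r • brE (f • toE (el 1 δ)) e := by
  rw [fun_smul_el_one, brE_one_smul_fun, Submodule.coe_smul, Prod.smul_fst, hδ, smul_zero,
    Derivation.zero_apply, zero_smul, add_zero]

variable {α : Fin 3 →₀ ℕ} {δ : CDerEnd R}

/-- The operator `[s^α fδ, -]` is linear over functions if `δ` annihilates functions. -/
lemma brA_mon_smul (hδ : δ.1.1 = 0) (hm : toE (el 1 δ) ∈ fil3 R α) (f r : R) (a : AA R) :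
    brA (mon α f (el 1 δ)) (r • a) = r • brA (mon α f (el 1 δ)) a := by
  obtain ⟨p, rfl⟩ := toA_surjective a
  rw [mon, cls_of_mem (Submodule.smul_mem _ f hm), ← toA_smul_fun, brA_toA, brA_toA, ← toA_smul_fun]
  congr 1
  refine Subtype.ext (PowSer.ext fun γ => ?_)
  change brPow (single α (f • toE (el 1 δ))) (r • p.1) γ =
    r • brPow (single α (f • toE (el 1 δ))) p.1 γ
  rw [brPow_apply, brPow_apply, Finset.smul_sum]
  refine Finset.sum_congr rfl fun q _ => ?_
  change brE _ (r • p.1 q.2) = _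
  rw [single_apply]
  split_ifs
  · exact brE_smul_fun hδ f r _
  · rw [map_zero, LinearMap.zero_apply, LinearMap.zero_apply, smul_zero]

lemma expAd_cls {x : EE R} (hα : α ≠ 0) (hx : x ∈ fil3 R α) :
    expAd (cls α x) = ∑ n ∈ Finset.range 7, (n.factorial : ℝ)⁻¹ • brA (cls α x) ^ n := by
  rw [expAd, nilExp_eq_sum]
  rw [cls_of_mem hx]
  refine pow_seven_brA ?_
  change single α x 0 = 0
  rw [single_apply, if_neg hα.symm]

lemma expAd_cls_apply {x : EE R} (hα : α ≠ 0) (hx : x ∈ fil3 R α) (a : AA R) :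
    expAd (cls α x) a =
      ∑ n ∈ Finset.range 7, (n.factorial : ℝ)⁻¹ • (brA (cls α x) ^ n : Module.End ℝ (AA R)) a := by
  rw [expAd_cls hα hx, LinearMap.sum_apply]
  rfl

lemma expAd_mon_smul (hα : α ≠ 0) (hδ : δ.1.1 = 0) (hm : toE (el 1 δ) ∈ fil3 R α) (f r : R)
    (a : AA R) : expAd (mon α f (el 1 δ)) (r • a) = r • expAd (mon α f (el 1 δ)) a := by
  have h : ∀ n : ℕ, (brA (mon α f (el 1 δ)) ^ n : Module.End ℝ (AA R)) (r • a) =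
      r • (brA (mon α f (el 1 δ)) ^ n : Module.End ℝ (AA R)) a := by
    intro n
    induction n with
    | zero => rfl
    | succ n ih => rw [pow_succ', Module.End.mul_apply, Module.End.mul_apply, ih,
        brA_mon_smul hδ hm]
  rw [mon, expAd_cls_apply hα (Submodule.smul_mem _ f hm),
    expAd_cls_apply hα (Submodule.smul_mem _ f hm), Finset.smul_sum]
  refine Finset.sum_congr rfl fun n _ => ?_
  rw [real_smul_eq, real_smul_eq, smul_comm r]
  congr 1
  exact h n

/-- If the second iterate of `[x, -]` stays in `F_{000}E`, then the exponential breaks off after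
the linear term. -/
lemma expAd_cls_zero {x e : EE R} (hα : α ≠ 0) (hx : x ∈ fil3 R α) (he : e ∈ fil3 R 0)
    (h : brE x (brE x e) ∈ fil3 R 0) :
    expAd (cls α x) (cls 0 e) = cls 0 e + cls α (brE x e) := by
  have h1 : brA (cls α x) (cls 0 e) = cls α (brE x e) := by rw [brA_cls hx he, add_zero]
  -- At `s^{2α}` a coefficient in `F_{000}E` lies in a lower step, so its class is zero.
  have h2 : brA (cls α x) (cls α (brE x e)) = 0 := by
    have := brE_mem_fil3 hx he
    rw [add_zero] at this
    rw [brA_cls hx this]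
    refine cls_eq_zero_of_mem_fil3 ?_ h
    exact lt_of_lt_of_le (bot_lt_iff_ne_bot.2 hα) (self_le_add_right _ _)
  have h3 : ∀ n : ℕ, (brA (cls α x) ^ (n + 2) : Module.End ℝ (AA R)) (cls 0 e) = 0 := by
    intro n
    rw [pow_add, pow_two, Module.End.mul_apply, Module.End.mul_apply, h1, h2, map_zero]
  rw [expAd_cls_apply hα hx]
  rw [Finset.sum_range_succ', Finset.sum_range_succ']
  simp only [add_assoc, one_add_one_eq_two, h3, smul_zero, Finset.sum_const_zero, zero_add]
  simp [h1, add_comm]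

variable (R) in
/-- The sum of the pieces of `A_G¹` with `α ≠ 000`. -/
noncomputable def gaugePos : Submodule R (AA R) := ⨆ α, ⨆ _ : α ≠ 0, GAG R α 1

lemma GAG_le_gaugePos {γ : Fin 3 →₀ ℕ} (h : γ ≠ 0) : GAG R γ 1 ≤ gaugePos R :=
  le_iSup₂_of_le (f := fun γ (_ : γ ≠ 0) => GAG R γ 1) γ h le_rfl

lemma gaugePos_le : gaugePos R ≤ ⨆ α, GAG R α 1 := 
  iSup₂_le fun γ _ => le_iSup (fun α => GAG R α 1) γ

/-- The summand from the lower steps has class zero, so only the summand from the table survives. -/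
lemma cls_mem_gaugePos {γ : Fin 3 →₀ ℕ} (h : γ ≠ 0) {x : EE R} (hx : x ∈ gaugeFil R γ) :
    cls γ x ∈ gaugePos R := by
  obtain ⟨y, hy, z, hz, rfl⟩ := Submodule.mem_sup.1 hx
  rw [cls_add (GEG_le_fil3 γ 1 hy) (lowFil_le_fil3 γ hz), cls_eq_zero_of_mem_lowFil hz, add_zero]
  exact GAG_le_gaugePos h (mem_GAG.2 ⟨y, hy, rfl⟩)

lemma gaugePos_induction {p : AA R → Prop} (h0 : p 0) (hadd : ∀ a b, p a → p b → p (a + b))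
    (hc : ∀ β : Fin 3 →₀ ℕ, β ≠ 0 → ∀ e ∈ GEG R β 1, p (cls β e)) {a : AA R}
    (ha : a ∈ gaugePos R) : p a := by
  rw [gaugePos] at ha
  induction ha using Submodule.iSup_induction' with
  | zero => exact h0
  | add a b _ _ h h' => exact hadd a b h h'
  | mem α a ha =>
    induction ha using Submodule.iSup_induction' with
    | zero => exact h0
    | add a b _ _ h h' => exact hadd a b h h'
    | mem hα a ha =>
      obtain ⟨e, he, rfl⟩ := mem_GAG.1 ha
      exact hc α hα e he

lemma brA_mem_gaugePos (hδ : δ.1.1 = 0) (hm : toE (el 1 δ) ∈ fil3 R α) (f : R)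
    (h : ∀ {β : Fin 3 →₀ ℕ}, β ≠ 0 → ∀ (f g : R) {l : Lie R}, TableEntry β 1 l →
      brE (f • toE (el 1 δ)) (g • toE l) ∈ gaugeFil R (α + β)) {a : AA R} (ha : a ∈ gaugePos R) :
    brA (mon α f (el 1 δ)) a ∈ gaugePos R := by
  refine gaugePos_induction (p := fun a => brA (mon α f (el 1 δ)) a ∈ gaugePos R) ?_ ?_ ?_ ha
  · rw [map_zero]; exact zero_mem _
  · intro a b ha hb
    rw [map_add]; exact add_mem ha hb
  · intro β hβ e he
    rw [mon, brA_cls (Submodule.smul_mem _ f hm) (GEG_le_fil3 β 1 he)]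
    refine cls_mem_gaugePos (fun h0 => hβ ?_) ?_
    · exact (add_eq_zero.1 h0).2
    -- The bracket is linear over functions in the second argument, so only the table entries
    -- themselves have to be considered.
    · rw [GEG] at he
      induction he using Submodule.span_induction with
      | zero => rw [map_zero]; exact zero_mem _
      | add x y _ _ hx hy => rw [map_add]; exact add_mem hx hy
      | smul r x _ hx => rw [brE_smul_fun hδ]; exact Submodule.smul_mem _ _ hx
      | mem x hx =>
        obtain ⟨l, hl, rfl⟩ := hx
        have := h hβ f 1 hl
        rwa [one_smul] at this

lemma expAd_mem_gaugePos (hα : α ≠ 0) (hδ : δ.1.1 = 0) (hm : toE (el 1 δ) ∈ fil3 R α) (f : R)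
    (h : ∀ {β : Fin 3 →₀ ℕ}, β ≠ 0 → ∀ (f g : R) {l : Lie R}, TableEntry β 1 l →
      brE (f • toE (el 1 δ)) (g • toE l) ∈ gaugeFil R (α + β)) {a : AA R} (ha : a ∈ gaugePos R) :
    expAd (mon α f (el 1 δ)) a ∈ gaugePos R := by
  rw [mon, expAd_cls_apply hα (Submodule.smul_mem _ f hm)]
  refine sum_mem fun n _ => ?_
  rw [real_smul_eq]
  refine Submodule.smul_mem _ _ ?_
  clear * - hδ hm h ha
  induction n with
  | zero => exact ha
  | succ n ih =>
    rw [pow_succ', Module.End.mul_apply]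
    exact brA_mem_gaugePos hδ hm f h ih

end GaugeAutomorphisms

/-! ### Functionals that detect `θ₀σ_i` and `θ₀σ_{jk}`. -/

section Functionals

variable {R : Type*} [CommRing R] [Algebra ℝ R]

variable (R) in
/-- The coefficient of `θ_aθ_b` in `e·z`. -/
noncomputable def coefE (a b : Fin 4) (z : Ext R) : EE R →ₗ[ℝ] R :=
  (coef2 R a b).restrictScalars ℝ ∘ₗ (repE 0).flip z

lemma coefE_smul (a b : Fin 4) (z : Ext R) (r : R) (e : EE R) :
    coefE R a b z (r • e) = r * coefE R a b z e := by
  change coef2 R a b (repE 0 (r • e) z) = r * coef2 R a b (repE 0 e z)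
  rw [repE_smul_fun, LinearMap.smul_apply, map_smul, smul_eq_mul]

lemma coefE_toE (a b : Fin 4) (z u : Ext R) (δ : CDerEnd R) :
    coefE R a b z (toE (el u δ)) = coef2 R a b (u * extDer δ.1 z) := by
  change coef2 R a b (repE 0 (toE (u ⊗ₜ[R] δ)) z) = _
  rw [repE_toE, repL_tmul, actTr_apply, Nat.cast_zero, zero_mul, zero_smul, add_zero]

lemma mem_stab_of_fil_zero {m : Fin 3} {e : EE R} (h : e ∈ fil R m 0) : e ∈ stab R m 0 := by
  have : fil R m 0 ≤ stab R m 0 := by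
    refine iSup₂_le fun q hq => ?_
    obtain rfl := Nat.le_zero.1 hq
    exact iSup_le fun k => inf_le_right
  exact this h

/-- Elements of index `0` preserve every `F_{⊲q}(∧W)`, so the image of `θ_c` cannot contain `θ_aθ_b`
if that has larger weight or other parity. -/
lemma coefE_eq_zero {m : Fin 3} {e : EE R} (h : e ∈ fil R m 0) (a b c : Fin 4)
    (hw : wt m c < wt m a + wt m b ∨ wt m c % 2 ≠ (wt m a + wt m b) % 2) :
    coefE R a b (theta R c) e = 0 :=
  coef2_eq_zero (mem_stab_of_fil_zero h 0 (by norm_num) _ _ (theta_mem_extFil m c)) hw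

lemma add_one_ne (i : Fin 3) : (i + 1 = i) = False := by simp
lemma add_two_ne (i : Fin 3) : (i + 2 = i) = False := by simp
lemma add_two_ne_add_one (i : Fin 3) : (i + 2 = i + 1) = False := by simp
lemma add_one_ne_add_two (i : Fin 3) : (i + 1 = i + 2) = False := by simp

/-- The entries of `e_j + e_k` are `0` and `1`, so a strictly smaller index has lost one of the two
ones. -/
lemma eq_zero_of_lt_pair {i : Fin 3} {β : Fin 3 →₀ ℕ} (h : β < e1 (i + 1) + e1 (i + 2)) :
    β (i + 1) = 0 ∨ β (i + 2) = 0 := by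
  have h0 : β i = 0 ∧ β (i + 1) ≤ 1 ∧ β (i + 2) ≤ 1 := by
    have h1 := h.le i
    have h2 := h.le (i + 1)
    have h3 := h.le (i + 2)
    rw [e1_add_apply] at h1 h2 h3
    simp only [add_one_ne, add_two_ne, add_two_ne_add_one, add_one_ne_add_two, if_true,
      if_false] at h1 h2 h3
    omega
  by_contra! hc
  refine h.not_ge fun m => ?_
  rw [e1_add_apply]
  rcases fin3_cases i m with rfl | rfl | rfl <;>
    simp only [add_one_ne, add_two_ne, add_two_ne_add_one, add_one_ne_add_two, if_true, if_false] <;>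
    omega

variable (R) in
/-- A functional on `E` that detects `θ₀σ_i` in the index `e_j + e_k`. -/
noncomputable def boostForm (i : Fin 3) : EE R →ₗ[ℝ] R := coefE R 0 i.succ (th0 R)

variable (R) in
/-- A functional on `E` that detects `θ₀σ_{jk}` in the index `e_j + e_k`. -/
noncomputable def rotForm (i : Fin 3) : EE R →ₗ[ℝ] R :=
  coefE R 0 (i + 2).succ (th R (i + 1)) - coefE R 0 (i + 1).succ (th R (i + 2))

lemma map_eq_zero_of_mem_lowFil {α : Fin 3 →₀ ℕ} (F : EE R →ₗ[ℝ] R)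
    (h : ∀ β < α, ∀ e ∈ fil3 R β, F e = 0) {e : EE R} (he : e ∈ lowFil R α) : F e = 0 := by
  rw [lowFil] at he
  induction he using Submodule.iSup_induction' with
  | zero => exact map_zero F
  | add x y _ _ hx hy => rw [map_add, hx, hy, add_zero]
  | mem β x hx =>
    induction hx using Submodule.iSup_induction' with
    | zero => exact map_zero F
    | add x y _ _ hx hy => rw [map_add, hx, hy, add_zero]
    | mem hβ x hx => exact h β hβ x hx

/-- For `W₀` spanned by `θ₀, θ_j`, or by `θ₀, θ_k`, a term `θ₀θ_i` in the image of `θ₀` would raise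
the weight from `0` to `1`, which index `0` forbids. -/
lemma boostForm_lowFil (i : Fin 3) : ∀ e ∈ lowFil R (e1 (i + 1) + e1 (i + 2)),
    boostForm R i e = 0 := fun e => map_eq_zero_of_mem_lowFil _ fun β hβ e he => by
  rcases eq_zero_of_lt_pair hβ with h | h
  · have h1 := fil_of_mem_fil3 he (i + 1)
    rw [h] at h1
    refine coefE_eq_zero h1 _ _ _ ?_
    clear * -
    decide +revert
  · have h1 := fil_of_mem_fil3 he (i + 2)
    rw [h] at h1
    refine coefE_eq_zero h1 _ _ _ ?_
    clear * -
    decide +revert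

/-- For `W₀` spanned by `θ₀, θ_j` the elements `θ_j` and `θ₀θ_k` have weights `0` and `1`, and `θ_k`
and `θ₀θ_j` have weights `1` and `0`. The parities differ, so index `0` kills both coefficients;
likewise for `θ_k` in place of `θ_j`. -/
lemma rotForm_lowFil (i : Fin 3) : ∀ e ∈ lowFil R (e1 (i + 1) + e1 (i + 2)),
    rotForm R i e = 0 := fun e => map_eq_zero_of_mem_lowFil _ fun β hβ e he => by
  rw [rotForm, LinearMap.sub_apply, sub_eq_zero]
  rcases eq_zero_of_lt_pair hβ with h | h
  · have h1 := fil_of_mem_fil3 he (i + 1)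
    rw [h] at h1
    rw [coefE_eq_zero h1, coefE_eq_zero h1] <;> clear * - <;> decide +revert
  · have h1 := fil_of_mem_fil3 he (i + 2)
    rw [h] at h1
    rw [coefE_eq_zero h1, coefE_eq_zero h1] <;> clear * - <;> decide +revert

lemma pair_injective {i i' : Fin 3} (h : e1 (i' + 1) + e1 (i' + 2) = e1 (i + 1) + e1 (i + 2)) :
    i' = i := by
  have := DFunLike.congr_fun h i
  rw [e1_add_apply, e1_add_apply] at this
  clear h
  decide +revert

lemma pair_ne_two {i i' : Fin 3} : 2 • e1 i' ≠ e1 (i + 1) + e1 (i + 2) := fun h => by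
  have := DFunLike.congr_fun h i'
  rw [e1_add_apply, two_e1_apply] at this
  revert this
  clear h
  decide +revert

lemma pair_ne_four {i i' : Fin 3} :
    2 • e1 i' + e1 (i' + 1) + e1 (i' + 2) ≠ e1 (i + 1) + e1 (i + 2) := fun h => by
  have := DFunLike.congr_fun h i'
  rw [e1_add_apply, two_e1_add_apply] at this
  revert this
  clear h
  decide +revert

lemma pair_ne_zero (i : Fin 3) : e1 (i + 1) + e1 (i + 2) ≠ 0 := by
  have := idx_pos i 0
  rw [add_zero] at this
  exact this.ne'

lemma inj_theta (X : Derivation ℝ R R) (a : Fin 4) : extDer (inj X).1 (theta R a) = 0 := by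
  rw [extDer_theta]; simp [inj]

/-- A functional vanishes on `G_αE_G` in the index `e_j + e_k` and degree `1` if it vanishes on the
entries of the table. -/
lemma map_eq_zero_of_mem_GEG {i : Fin 3} (F : EE R →ₗ[ℝ] R) (hF : ∀ (r : R) e, F (r • e) = r * F e)
    (hD : ∀ X, F (toE (el (th R i) (inj X))) = 0)
    (hc : F (toE (el (th0 R) (sig i))) + F (toE (el (th R i) sig0)) = 0)
    (hd : F (toE (el (th R (i + 1)) (sig (i + 2)))) + F (toE (el (th R (i + 2)) (sig (i + 1)))) = 0)
    (he : F (toE (el (th R (i + 2)) (sigR (i + 2) i))) = 0)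
    (hf : F (toE (el (th R (i + 1)) (sigR i (i + 1)))) = 0) {e : EE R}
    (h : e ∈ GEG R (e1 (i + 1) + e1 (i + 2)) 1) : F e = 0 := by
  rw [GEG] at h
  induction h using Submodule.span_induction with
  | zero => exact map_zero F
  | add x y _ _ hx hy => rw [map_add, hx, hy, add_zero]
  | smul r x _ hx => rw [hF, hx, mul_zero]
  | mem x hx =>
    obtain ⟨l, hl, rfl⟩ := hx
    generalize hβ : e1 (i + 1) + e1 (i + 2) = β at hl
    cases hl
    case g000_b => exact absurd hβ (pair_ne_zero i)
    case g200 => exact absurd hβ.symm pair_ne_two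
    case g211_a => exact absurd hβ.symm pair_ne_four
    all_goals obtain rfl := pair_injective hβ; simp only [map_add, *]

lemma sigR_theta_zero {i j : Fin 3} (h : i ≠ j) : extDer (sigR (R := R) i j).1 (th0 R) = 0 :=
  (sigR_theta i j h).1

/-- On `θ₀σ_i + θ_iσ₀` the contributions `θ₀θ_i` and `θ_iθ₀` cancel. The other entries send `θ₀` to
nothing that contains `θ₀`. -/
lemma boostForm_GEG (i : Fin 3) : ∀ e ∈ GEG R (e1 (i + 1) + e1 (i + 2)) 1, boostForm R i e = 0 := by
  intro e
  refine map_eq_zero_of_mem_GEG _ (coefE_smul _ _ _) (fun X => ?_) ?_ ?_ ?_ ?_ <;>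
    simp only [coefE_toE]
  · rw [inj_theta, mul_zero, map_zero]
  · simp [sig_th0, sig0_theta, coef2_theta_mul_theta]
  · simp [sig_th0, coef2_theta_mul_theta, (Fin.succ_ne_zero _).symm]
  · rw [sigR_theta_zero (by simp), mul_zero, map_zero]
  · rw [sigR_theta_zero (by simp), mul_zero, map_zero]

lemma boostForm_boost (i : Fin 3) : boostForm R i (toE (el (th0 R) (sig i))) = 1 := by
  rw [boostForm, coefE_toE, sig_th0, coef2_theta_mul_theta]
  simp

/-- The argument is what the boost automorphism adds to `θ₀σ₀ + θ_jσ_j`. A nonzero value shows that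
this class does not vanish, hence that the grading is not preserved. -/
lemma boostForm_dil (i : Fin 3) :
    boostForm R i (toE (el (th R i) sig0 + el (th R (i + 1)) (sigR i (i + 1)))) = -1 := by
  rw [map_add, map_add, boostForm, coefE_toE, coefE_toE, sigR_theta_zero (by simp), sig0_theta,
    mul_zero, map_zero, coef2_theta_mul_theta]
  simp

lemma rotForm_smul (i : Fin 3) (r : R) (e : EE R) : rotForm R i (r • e) = r * rotForm R i e := by
  rw [rotForm, LinearMap.sub_apply, LinearMap.sub_apply, coefE_smul, coefE_smul, mul_sub]

lemma rotForm_toE (i : Fin 3) (u : Ext R) (δ : CDerEnd R) : rotForm R i (toE (el u δ)) =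
    coef2 R 0 (i + 2).succ (u * extDer δ.1 (th R (i + 1))) -
      coef2 R 0 (i + 1).succ (u * extDer δ.1 (th R (i + 2))) := by
  rw [rotForm, LinearMap.sub_apply, coefE_toE, coefE_toE]

lemma rotForm_rot (i : Fin 3) : rotForm R i (toE (el (th0 R) (sigR (i + 1) (i + 2)))) = -2 := by
  rw [rotForm_toE, sigR_th_add_one, sigR_th_add_two, mul_neg, map_neg, coef2_theta_mul_theta,
    coef2_theta_mul_theta]
  simp
  norm_num

/-- The difference in `rotForm` is antisymmetric in `j` and `k`, which kills the symmetric entry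
`θ_jσ_k + θ_kσ_j`. Applied to `θ_j` and `θ_k`, the other entries give nothing with a factor `θ₀`. -/
lemma rotForm_GEG (i : Fin 3) : ∀ e ∈ GEG R (e1 (i + 1) + e1 (i + 2)) 1, rotForm R i e = 0 := by
  have h1 : extDer (sig (R := R) (i + 2)).1 (th R (i + 1)) = 0 := (sig_theta _).2.2 _ (by simp)
  have h2 : extDer (sig (R := R) (i + 1)).1 (th R (i + 2)) = 0 := (sig_theta _).2.2 _ (by simp)
  have h3 := sigR_theta (R := R) (i + 2) i (by simp)
  have h4 := sigR_theta (R := R) i (i + 1) (by simp)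
  have h5 := h3.2.2.2 (i + 1) (by simp) (by simp)
  have h6 := h4.2.2.2 (i + 2) (by simp) (by simp)
  intro e
  refine map_eq_zero_of_mem_GEG _ (rotForm_smul i) (fun X => ?_) ?_ ?_ ?_ ?_ <;>
    simp only [rotForm_toE]
  · simp [inj_theta]
  · simp [sig_th_add_one, sig_th_add_two, sig0_theta, coef2_theta_mul_theta]
  · simp [sig_th, h1, h2, coef2_theta_mul_theta]
  · simp [h3.2.1, h5, coef2_theta_mul_theta]
  · simp [h4.2.2.1, h6, coef2_theta_mul_theta]

/-- A functional that vanishes on `G_αE_G` and on the lower steps detects whether the class of an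
element of `F_αE` is in the gauge subspace. -/
lemma map_eq_zero_of_cls_mem {α : Fin 3 →₀ ℕ} (F : EE R →ₗ[ℝ] R)
    (hlow : ∀ e ∈ lowFil R α, F e = 0) (hG : ∀ e ∈ GEG R α 1, F e = 0) {e : EE R}
    (he : e ∈ fil3 R α) (h : cls α e ∈ ⨆ β, GAG R β 1) : F e = 0 := by
  have key : ∀ a ∈ ⨆ β, GAG R β 1, coefA α F hlow a = 0 := by
    intro a ha
    induction ha using Submodule.iSup_induction' with
    | zero => exact map_zero _
    | add x y _ _ hx hy => rw [map_add, hx, hy, add_zero]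
    | mem β a ha =>
      obtain ⟨e, he, rfl⟩ := mem_GAG.1 ha
      rw [coefA_cls hlow (GEG_le_fil3 β 1 he)]
      split_ifs with hβ
      · subst hβ; exact hG e he
      · rfl
  have := key _ h
  rwa [coefA_cls hlow he, if_pos rfl] at this

end Functionals

/-! ### The two automorphisms on `θ₀D` and on `θ₀σ₀ + θ_lσ_l`. -/

section Formulas

variable {R : Type*} [CommRing R] [Algebra ℝ R]

lemma mon_add {α : Fin 3 →₀ ℕ} (f : R) {l l' : Lie R} (h : toE l ∈ fil3 R α)
    (h' : toE l' ∈ fil3 R α) : mon α f (l + l') = mon α f l + mon α f l' := by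
  rw [mon, map_add, smul_add, cls_add (Submodule.smul_mem _ f h) (Submodule.smul_mem _ f h'), mon, mon]

lemma mon_neg {α : Fin 3 →₀ ℕ} (f : R) {l : Lie R} (h : toE l ∈ fil3 R α) :
    mon α f (-l) = -mon α f l := by
  rw [mon, map_neg, smul_neg, cls_neg (Submodule.smul_mem _ f h), mon]

lemma lS_mem (i : Fin 3) : toE (lS (R := R) i) ∈ fil3 R 0 := tableEntry_mem_fil3 (TableEntry.g000_b i)

lemma lD_mem (D : Derivation ℝ R R) : toE (lD D) ∈ fil3 R 0 := th0_inj_mem D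

lemma boost_mem (i : Fin 3) : toE (el (1 : Ext R) (sig i)) ∈ fil3 R (e1 (i + 1) + e1 (i + 2)) :=
  tableEntry_mem_fil3 (TableEntry.g011_a i)

lemma rot_mem (i : Fin 3) : toE (el (1 : Ext R) (sigR (i + 1) (i + 2))) ∈
    fil3 R (e1 (i + 1) + e1 (i + 2)) := tableEntry_mem_fil3 (TableEntry.g011_b i)

/-- The exponential of `[s^α fδ, -]` on elements that annihilate functions. -/
lemma expAd_mon_apply {α : Fin 3 →₀ ℕ} {δ : CDerEnd R} (hα : α ≠ 0) (hδ : δ.1.1 = 0)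
    (hm : toE (el 1 δ) ∈ fil3 R α) (f : R) {l n : Lie R} (hl : toE l ∈ fil3 R 0)
    (hn : lieL δ l = n) (hn' : toE (lieL δ n) ∈ fil3 R 0) (h0 : ract (algebraMap R _ f) l = 0)
    (h1 : ract (algebraMap R _ f) n = 0) :
    expAd (mon α f (el 1 δ)) (mon 0 1 l) = mon 0 1 l + mon α f n := by
  have e1 : brE (f • toE (el 1 δ)) ((1 : R) • toE l) = f • toE n := by
    rw [brE_fun_smul hδ, h0, hn, el, TensorProduct.zero_tmul, map_zero, smul_zero, sub_zero, mul_one]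
  have e2 : brE (f • toE (el 1 δ)) (f • toE n) = (f * f) • toE (lieL δ n) := by
    rw [brE_fun_smul hδ, h1, el, TensorProduct.zero_tmul, map_zero, smul_zero, sub_zero]
  rw [mon, mon, mon, expAd_cls_zero hα (Submodule.smul_mem _ f hm) (Submodule.smul_mem _ 1 hl), e1]
  rw [e1, e2]
  exact Submodule.smul_mem _ _ hn'

/-- There are two sources of linear terms: `σ_i` turns `θ₀` into `θ_i`, and `D` differentiates `f`.
Bracketing once more gives only multiples of `θ₀D` and `θ_iσ_i`, which are in `F_{000}E`. -/
lemma expAd_boost_lD (i : Fin 3) (f : R) (D : Derivation ℝ R R) :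
    expAd (mon (e1 (i + 1) + e1 (i + 2)) f (el 1 (sig i))) (mon 0 1 (lD D)) =
      mon 0 1 (lD D) - mon (e1 (i + 1) + e1 (i + 2)) (D f) (el (th0 R) (sig i)) +
        mon (e1 (i + 1) + e1 (i + 2)) f (el (th R i) (inj D)) := by
  have h1 : brE (f • toE (el 1 (sig i))) ((1 : R) • toE (lD D)) =
      f • toE (el (th R i) (inj D)) - D f • toE (el (th0 R) (sig i)) := by
    rw [brE_fun_smul (sig_fst i), lD, lieL_tmul, bracket_sig_inj, sig_th0, ract_algebraMap_tmul,
      inj_fst, TensorProduct.tmul_zero, zero_add, mul_one, one_smul, el, ← TensorProduct.smul_tmul',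
      toE_smul_fun]
  have h2 : brE (f • toE (el 1 (sig i))) (f • toE (el (th R i) (inj D))) ∈ fil3 R 0 := by
    rw [brE_fun_smul (sig_fst i), lieL_tmul, bracket_sig_inj, sig_th, ract_algebraMap_tmul,
      inj_fst, TensorProduct.tmul_zero, zero_add, el, ← TensorProduct.smul_tmul', toE_smul_fun]
    exact sub_mem (Submodule.smul_mem _ _ (th0_inj_mem D))
      (Submodule.smul_mem _ _ (Submodule.smul_mem _ _ (th_sig_mem i)))
  have h3 : brE (f • toE (el 1 (sig i))) (D f • toE (el (th0 R) (sig i))) ∈ fil3 R 0 := by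
    rw [brE_fun_smul (sig_fst i), lieL_tmul, bracket_sig_sig_self, sig_th0, ract_algebraMap_tmul,
      sig_fst, TensorProduct.tmul_zero, zero_add, Derivation.zero_apply, zero_smul, el,
      TensorProduct.zero_tmul, map_zero, smul_zero, sub_zero]
    exact Submodule.smul_mem _ _ (th_sig_mem i)
  rw [mon, mon, mon, mon, expAd_cls_zero (pair_ne_zero i) (Submodule.smul_mem _ f (boost_mem i))
    (Submodule.smul_mem _ 1 (lD_mem D)), h1, cls_sub, sub_add_eq_add_sub, add_sub_assoc]
  · exact Submodule.smul_mem _ _ (tableEntry_mem_fil3 (TableEntry.g011_D i D))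
  · exact Submodule.smul_mem _ _ (th0_sig_mem i)
  · rw [h1, map_sub]
    exact sub_mem h2 h3

lemma expAd_boost_lS (i : Fin 3) (f : R) :
    expAd (mon (e1 (i + 1) + e1 (i + 2)) f (el 1 (sig i))) (mon 0 1 (lS i)) =
      mon 0 1 (lS i) + mon (e1 (i + 1) + e1 (i + 2)) f (el (th0 R) (sig i) + el (th R i) sig0) := by
  refine expAd_mon_apply (pair_ne_zero i) (sig_fst i) (boost_mem i) f (lS_mem i) ?_ ?_ ?_ ?_
  · simp only [lS, map_add, lieL_tmul, bracket_sig_sig0, bracket_sig_sig_self, sig_th0, sig_th,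
      TensorProduct.tmul_zero, zero_add]
    exact add_comm _ _
  · simp only [map_add, lieL_tmul, bracket_sig_sig0, bracket_sig_sig_self, sig_th0, sig_th,
      TensorProduct.tmul_zero, zero_add]
    exact add_mem (th_sig_mem i) th0_sig0_mem
  · simp only [lS, map_add, ract_algebraMap_tmul, sig_fst, sig0_fst, Derivation.zero_apply, zero_smul,
      add_zero]
  · simp only [map_add, ract_algebraMap_tmul, sig_fst, sig0_fst, Derivation.zero_apply, zero_smul,
      add_zero]

lemma expAd_boost_lS_add_one (i : Fin 3) (f : R) :
    expAd (mon (e1 (i + 1) + e1 (i + 2)) f (el 1 (sig i))) (mon 0 1 (lS (i + 1))) =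
      mon 0 1 (lS (i + 1)) + mon (e1 (i + 1) + e1 (i + 2)) f
        (el (th R i) sig0 + el (th R (i + 1)) (sigR i (i + 1))) := by
  refine expAd_mon_apply (pair_ne_zero i) (sig_fst i) (boost_mem i) f (lS_mem _) ?_ ?_ ?_ ?_
  · simp only [lS, map_add, lieL_tmul, bracket_sig_sig0, bracket_sig_sig_add_one, sig_th0,
      sig_th_add_one, TensorProduct.tmul_zero, TensorProduct.zero_tmul, zero_add, add_zero]
  · simp only [map_add, lieL_tmul, bracket_sig_sig0, bracket_sig_sigR, sig_th, sig_th_add_one,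
      TensorProduct.tmul_zero, TensorProduct.zero_tmul, zero_add, add_zero]
    exact add_mem th0_sig0_mem (th_sig_mem _)
  · simp only [lS, map_add, ract_algebraMap_tmul, sig_fst, sig0_fst, Derivation.zero_apply, zero_smul,
      add_zero]
  · simp only [map_add, ract_algebraMap_tmul, sigR_fst, sig0_fst, Derivation.zero_apply, zero_smul,
      add_zero]

lemma expAd_boost_lS_add_two (i : Fin 3) (f : R) :
    expAd (mon (e1 (i + 1) + e1 (i + 2)) f (el 1 (sig i))) (mon 0 1 (lS (i + 2))) =
      mon 0 1 (lS (i + 2)) + mon (e1 (i + 1) + e1 (i + 2)) f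
        (el (th R i) sig0 - el (th R (i + 2)) (sigR (i + 2) i)) := by
  refine expAd_mon_apply (pair_ne_zero i) (sig_fst i) (boost_mem i) f (lS_mem _) ?_ ?_ ?_ ?_
  · simp only [lS, map_add, lieL_tmul, bracket_sig_sig0, bracket_sig_sig_add_two, sig_th0,
      sig_th_add_two, TensorProduct.tmul_zero, TensorProduct.tmul_neg, TensorProduct.zero_tmul,
      zero_add, add_zero]
    exact (sub_eq_add_neg _ _).symm
  · simp only [map_sub, map_add, lieL_tmul, bracket_sig_sig0, bracket_sig_sigR_add_two,
      sig_th, sig_th_add_two, TensorProduct.tmul_zero, TensorProduct.tmul_neg,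
      TensorProduct.zero_tmul, zero_add, add_zero, sub_neg_eq_add]
    exact add_mem th0_sig0_mem (th_sig_mem _)
  · simp only [lS, map_add, ract_algebraMap_tmul, sig_fst, sig0_fst, Derivation.zero_apply, zero_smul,
      add_zero]
  · simp only [map_sub, ract_algebraMap_tmul, sigR_fst, sig0_fst, Derivation.zero_apply, zero_smul,
      sub_zero]

lemma expAd_rot_lD (i : Fin 3) (f : R) (D : Derivation ℝ R R) :
    expAd (mon (e1 (i + 1) + e1 (i + 2)) f (el 1 (sigR (i + 1) (i + 2)))) (mon 0 1 (lD D)) =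
      mon 0 1 (lD D) -
        mon (e1 (i + 1) + e1 (i + 2)) (D f) (el (th0 R) (sigR (i + 1) (i + 2))) := by
  have h1 : brE (f • toE (el 1 (sigR (i + 1) (i + 2)))) ((1 : R) • toE (lD D)) =
      -(D f • toE (el (th0 R) (sigR (i + 1) (i + 2)))) := by
    rw [brE_fun_smul (sigR_fst _ _), lD, lieL_tmul, bracket_sigR_inj, sigR_th0,
      ract_algebraMap_tmul, inj_fst, TensorProduct.tmul_zero, TensorProduct.zero_tmul, zero_add,
      map_zero, smul_zero, one_smul, zero_sub, el, ← TensorProduct.smul_tmul', toE_smul_fun]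
  have h3 : brE (f • toE (el 1 (sigR (i + 1) (i + 2))))
      (D f • toE (el (th0 R) (sigR (i + 1) (i + 2)))) = 0 := by
    rw [brE_fun_smul (sigR_fst _ _), lieL_tmul, bracket_sigR_sigR_self, sigR_th0,
      ract_algebraMap_tmul, sigR_fst, TensorProduct.tmul_zero, zero_add, Derivation.zero_apply,
      zero_smul, el, TensorProduct.zero_tmul, map_zero, smul_zero, smul_zero, sub_zero]
  rw [mon, mon, mon, expAd_cls_zero (pair_ne_zero i) (Submodule.smul_mem _ f (rot_mem i))
    (Submodule.smul_mem _ 1 (lD_mem D)), h1, cls_neg, ← sub_eq_add_neg]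
  · exact Submodule.smul_mem _ _ (th0_sigR_mem i)
  · rw [h1, map_neg, h3, neg_zero]
    exact zero_mem _

/-- The rotation `σ_{jk}` annihilates `θ₀` and `θ_i` and commutes with `σ₀` and `σ_i`. -/
lemma expAd_rot_lS (i : Fin 3) (f : R) :
    expAd (mon (e1 (i + 1) + e1 (i + 2)) f (el 1 (sigR (i + 1) (i + 2)))) (mon 0 1 (lS i)) =
      mon 0 1 (lS i) := by
  have h := expAd_mon_apply (pair_ne_zero i) (sigR_fst _ _) (rot_mem i) f (lS_mem i) (n := 0)
    ?_ ?_ ?_ (map_zero _)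
  · rw [h, mon, mon, map_zero, smul_zero, cls_zero, add_zero]
  · simp only [lS, map_add, lieL_tmul, bracket_sigR_sig0, bracket_sigR_sig, sigR_th0, sigR_th,
      TensorProduct.tmul_zero, TensorProduct.zero_tmul, add_zero]
  · rw [map_zero, map_zero]; exact zero_mem _
  · simp only [lS, map_add, ract_algebraMap_tmul, sig_fst, sig0_fst, Derivation.zero_apply, zero_smul,
      add_zero]

/-- The second bracket is a combination of `θ_jσ_j` and `θ_kσ_k`, of index `000`; this ends the
exponential series for the rotation. -/
lemma toE_lieL_rot_mem (i : Fin 3) :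
    toE (lieL (sigR (i + 1) (i + 2)) (el (th R (i + 1)) (sig (i + 2)) +
      el (th R (i + 2)) (sig (i + 1)))) ∈ fil3 R 0 := by
  simp only [map_add, lieL_tmul, bracket_sigR_sig_add_one, bracket_sigR_sig_add_two,
    sigR_th_add_one, sigR_th_add_two, TensorProduct.tmul_neg, TensorProduct.neg_tmul, map_neg]
  exact add_mem (add_mem (th_sig_mem _) (neg_mem (th_sig_mem _)))
    (add_mem (neg_mem (th_sig_mem _)) (th_sig_mem _))

lemma expAd_rot_lS_add_one (i : Fin 3) (f : R) :
    expAd (mon (e1 (i + 1) + e1 (i + 2)) f (el 1 (sigR (i + 1) (i + 2)))) (mon 0 1 (lS (i + 1))) =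
      mon 0 1 (lS (i + 1)) - mon (e1 (i + 1) + e1 (i + 2)) f
        (el (th R (i + 1)) (sig (i + 2)) + el (th R (i + 2)) (sig (i + 1))) := by
  rw [sub_eq_add_neg, ← mon_neg f (tableEntry_mem_fil3 (TableEntry.g011_d i))]
  refine expAd_mon_apply (pair_ne_zero i) (sigR_fst _ _) (rot_mem i) f (lS_mem _) ?_ ?_ ?_ ?_
  · simp only [lS, map_add, lieL_tmul, bracket_sigR_sig0, bracket_sigR_sig_add_one, sigR_th0,
      sigR_th_add_one, TensorProduct.tmul_zero, TensorProduct.tmul_neg, TensorProduct.zero_tmul,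
      TensorProduct.neg_tmul, zero_add]
    exact (neg_add _ _).symm
  · rw [map_neg, map_neg]
    exact neg_mem (toE_lieL_rot_mem i)
  · simp only [lS, map_add, ract_algebraMap_tmul, sig_fst, sig0_fst, Derivation.zero_apply, zero_smul,
      add_zero]
  · simp only [map_neg, map_add, ract_algebraMap_tmul, sig_fst, Derivation.zero_apply, zero_smul,
      add_zero, neg_zero]

lemma expAd_rot_lS_add_two (i : Fin 3) (f : R) :
    expAd (mon (e1 (i + 1) + e1 (i + 2)) f (el 1 (sigR (i + 1) (i + 2)))) (mon 0 1 (lS (i + 2))) =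
      mon 0 1 (lS (i + 2)) + mon (e1 (i + 1) + e1 (i + 2)) f
        (el (th R (i + 1)) (sig (i + 2)) + el (th R (i + 2)) (sig (i + 1))) := by
  refine expAd_mon_apply (pair_ne_zero i) (sigR_fst _ _) (rot_mem i) f (lS_mem _) ?_
    (toE_lieL_rot_mem i) ?_ ?_
  · simp only [lS, map_add, lieL_tmul, bracket_sigR_sig0, bracket_sigR_sig_add_two, sigR_th0,
      sigR_th_add_two, TensorProduct.tmul_zero, TensorProduct.zero_tmul, zero_add]
    exact add_comm _ _
  · simp only [lS, map_add, ract_algebraMap_tmul, sig_fst, sig0_fst, Derivation.zero_apply, zero_smul,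
      add_zero]
  · simp only [map_add, ract_algebraMap_tmul, sig_fst, Derivation.zero_apply, zero_smul,
      add_zero]

end Formulas

/-! ### The affine gauge subspace, the functions `γ_l⁰`, and the gauge conditions. -/

section AffineGauge

variable {R : Type*} [CommRing R] [Algebra ℝ R] {D : Derivation ℝ R R} {y : AA R}

lemma mem_affineGauge_iff {z : AA R} :
    z ∈ affineGauge D ↔ z - mon 0 1 (lD D) ∈ ⨆ α, GAG R α 1 := by
  refine ⟨?_, fun h => ⟨_, h, (add_sub_cancel _ _).symm⟩⟩
  rintro ⟨a, ha, rfl⟩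
  rwa [add_sub_cancel_left]

lemma GEG_zero_eq_sum {e : EE R} (he : e ∈ GEG R 0 1) :
    ∃ γ : Fin 3 → R, e = ∑ i, γ i • toE (lS i) := by
  rw [GEG] at he
  induction he using Submodule.span_induction with
  | zero => exact ⟨0, by simp⟩
  | add x y _ _ hx hy =>
    obtain ⟨γ, rfl⟩ := hx
    obtain ⟨γ', rfl⟩ := hy
    exact ⟨γ + γ', by simp only [Pi.add_apply, add_smul, Finset.sum_add_distrib]⟩
  | smul r x _ hx =>
    obtain ⟨γ, rfl⟩ := hx
    exact ⟨r • γ, by simp only [Pi.smul_apply, smul_eq_mul, mul_smul, Finset.smul_sum]⟩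
  | mem x hx =>
    obtain ⟨l, hl, rfl⟩ := hx
    generalize hβ : (0 : Fin 3 →₀ ℕ) = β at hl
    cases hl
    case g000_b i =>
      refine ⟨Pi.single i 1, ?_⟩
      rw [Finset.sum_eq_single i (fun j _ hj => by rw [Pi.single_eq_of_ne hj, zero_smul])
        (fun h => absurd (Finset.mem_univ i) h), Pi.single_eq_same, one_smul]
      rfl
    case g200 i =>
      have := DFunLike.congr_fun hβ i
      rw [two_e1_apply, if_pos rfl] at this
      exact absurd this (by simp)
    case g211_a i =>
      have := DFunLike.congr_fun hβ i
      rw [two_e1_add_apply, if_pos rfl, Finsupp.zero_apply] at this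
      omega
    all_goals exact absurd hβ.symm (pair_ne_zero _)

lemma cls_sum_lS (γ : Fin 3 → R) :
    cls 0 (∑ i, γ i • toE (lS i)) = ∑ i, mon 0 (γ i) (lS i) := by
  have h : ∀ i, γ i • toE (lS i) ∈ fil3 R 0 := fun i => Submodule.smul_mem _ _ (lS_mem i)
  rw [Fin.sum_univ_three, Fin.sum_univ_three, cls_add (add_mem (h 0) (h 1)) (h 2),
    cls_add (h 0) (h 1)]
  rfl

lemma exists_hasGamma0 (hy : y ∈ affineGauge D) : ∃ γ, HasGamma0 D y γ := by
  obtain ⟨a, ha, rfl⟩ := hy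
  have h : ∃ γ : Fin 3 → R, a + ∑ i, mon 0 (γ i) (lS i) ∈ gaugePos R := by
    induction ha using Submodule.iSup_induction' with
    | zero => exact ⟨0, by simp [mon, cls_zero]⟩
    | add x y _ _ hx hy =>
      obtain ⟨γ, h⟩ := hx
      obtain ⟨γ', h'⟩ := hy
      refine ⟨γ + γ', ?_⟩
      have := add_mem h h'
      rw [← cls_sum_lS] at this ⊢
      rw [← cls_sum_lS] at this
      have hm : ∀ γ : Fin 3 → R, ∑ i, γ i • toE (lS i) ∈ fil3 R 0 := fun γ =>
        sum_mem fun i _ => Submodule.smul_mem _ _ (lS_mem i)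
      simp only [Pi.add_apply, add_smul, Finset.sum_add_distrib]
      rw [cls_add (hm γ) (hm γ')]
      convert this using 1
      abel
    | mem β a ha =>
      by_cases hβ : β = 0
      · subst hβ
        obtain ⟨e, he, rfl⟩ := mem_GAG.1 ha
        obtain ⟨γ, rfl⟩ := GEG_zero_eq_sum he
        -- The functions enter the affine gauge subspace with a minus sign.
        refine ⟨-γ, ?_⟩
        rw [← cls_sum_lS]
        simp only [Pi.neg_apply, neg_smul, Finset.sum_neg_distrib]
        rw [cls_neg (sum_mem fun i _ => Submodule.smul_mem _ _ (lS_mem i)), add_neg_cancel]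
        exact zero_mem _
      · refine ⟨0, ?_⟩
        simpa [mon, cls_zero] using GAG_le_gaugePos hβ ha
  obtain ⟨γ, h⟩ := h
  exact ⟨γ, by rwa [HasGamma0, add_sub_cancel_left]⟩

/-- For `l = i` the terms `θ₀θ_i` and `θ_iθ₀` cancel; otherwise only `θ₀σ₀` contributes. -/
lemma coefE_lS (i l : Fin 3) :
    coefE R 0 i.succ (th R i) (toE (lS l)) = if l = i then 0 else 1 := by
  rw [lS, map_add, map_add, coefE_toE, coefE_toE, sig0_theta, coef2_theta_mul_theta]
  by_cases h : l = i
  · subst h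
    rw [sig_th, coef2_theta_mul_theta]
    simp
  · rw [(sig_theta l).2.2 i (Ne.symm h), mul_zero, map_zero, if_neg h]
    simp [(Fin.succ_ne_zero _).symm]

lemma lowFil_zero : lowFil R 0 = ⊥ := by
  refine le_bot_iff.1 (iSup₂_le fun β hβ => absurd hβ ?_)
  exact not_lt_bot

lemma coefA_zero_gaugePos (F : EE R →ₗ[ℝ] R) (hF : ∀ e ∈ lowFil R 0, F e = 0) {a : AA R}
    (ha : a ∈ gaugePos R) : coefA 0 F hF a = 0 := by
  refine gaugePos_induction (p := fun a => coefA 0 F hF a = 0) (map_zero _) (fun a b h h' => ?_)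
    (fun β hβ e he => ?_) ha
  · rw [map_add, h, h', add_zero]
  · rw [coefA_cls hF (GEG_le_fil3 β 1 he), if_neg hβ.symm]

/-- Nothing lies below index `000`, so the coefficient functionals pass to `A` without any
condition. They take the value `∑_{l ≠ i} γ_l`, and the `3 × 3` matrix with zeros on the diagonal
and ones elsewhere is invertible because `2` is. -/
lemma hasGamma0_unique {γ γ' : Fin 3 → R} (h : HasGamma0 D y γ) (h' : HasGamma0 D y γ') :
    γ = γ' := by
  have hF : ∀ i, ∀ e ∈ lowFil R 0, coefE R 0 (i : Fin 3).succ (th R i) e = 0 := by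
    intro i e he
    rw [lowFil_zero, Submodule.mem_bot] at he
    rw [he, map_zero]
  have hm : ∀ γ : Fin 3 → R, ∑ i, γ i • toE (lS i) ∈ fil3 R 0 := fun γ =>
    sum_mem fun i _ => Submodule.smul_mem _ _ (lS_mem i)
  have key : ∀ i, coefE R 0 (i : Fin 3).succ (th R i) (∑ l, γ l • toE (lS l)) =
      coefE R 0 i.succ (th R i) (∑ l, γ' l • toE (lS l)) := by
    intro i
    have h1 := coefA_zero_gaugePos _ (hF i) (sub_mem h h')
    rw [add_sub_add_left_eq_sub, map_sub, ← cls_sum_lS, ← cls_sum_lS, coefA_cls (hF i) (hm γ),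
      coefA_cls (hF i) (hm γ'), if_pos rfl, if_pos rfl] at h1
    exact sub_eq_zero.1 h1
  have val : ∀ (γ : Fin 3 → R) i, coefE R 0 (i : Fin 3).succ (th R i) (∑ l, γ l • toE (lS l)) =
      ∑ l, γ l * if l = i then 0 else 1 := by
    intro γ i
    rw [map_sum]
    simp only [coefE_smul, coefE_lS]
  have key' : ∀ i, ∑ l, γ l * (if l = i then (0 : R) else 1) =
      ∑ l, γ' l * if l = i then (0 : R) else 1 := fun i => by rw [← val, ← val, key i]
  simp only [Fin.sum_univ_three] at key'
  have k0 := key' 0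
  have k1 := key' 1
  have k2 := key' 2
  simp at k0 k1 k2
  have two : ∀ a b : R, 2 * a = 2 * b → a = b := by
    intro a b hab
    have h2 : algebraMap ℝ R 2⁻¹ * 2 = 1 := by
      rw [← map_ofNat (algebraMap ℝ R) 2, ← map_mul, inv_mul_cancel₀ two_ne_zero, map_one]
    rw [← one_mul a, ← one_mul b, ← h2, mul_assoc, mul_assoc, hab]
  funext i
  fin_cases i
  · exact two _ _ (by linear_combination k1 + k2 - k0 : 2 * γ 0 = 2 * γ' 0)
  · exact two _ _ (by linear_combination k0 + k2 - k1 : 2 * γ 1 = 2 * γ' 1)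
  · exact two _ _ (by linear_combination k0 + k1 - k2 : 2 * γ 2 = 2 * γ' 2)

lemma sum_cyclic {M : Type*} [AddCommMonoid M] (F : Fin 3 → M) (i : Fin 3) :
    ∑ l, F l = F i + F (i + 1) + F (i + 2) := by
  rw [Fin.sum_univ_three]
  fin_cases i
  · rfl
  · change F 0 + F 1 + F 2 = F 1 + F 2 + F 0
    abel
  · change F 0 + F 1 + F 2 = F 2 + F 0 + F 1
    abel

lemma mon_mem_gauge {α : Fin 3 →₀ ℕ} (f : R) {l : Lie R} (h : toE l ∈ GEG R α 1) :
    mon α f l ∈ ⨆ β, GAG R β 1 :=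
  Submodule.mem_iSup_of_mem α (mem_GAG.2 ⟨_, Submodule.smul_mem _ f h, rfl⟩)

lemma mon_mem_gauge_of_entry {α : Fin 3 →₀ ℕ} (f : R) {l : Lie R} (h : TableEntry α 1 l) :
    mon α f l ∈ ⨆ β, GAG R β 1 := mon_mem_gauge f (Submodule.subset_span ⟨l, h, rfl⟩)

lemma mon_boost_mem_iff (i : Fin 3) (h : R) :
    mon (e1 (i + 1) + e1 (i + 2)) h (el (th0 R) (sig i)) ∈ (⨆ β, GAG R β 1) ↔ h = 0 := by
  refine ⟨fun hm => ?_, ?_⟩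
  · have := map_eq_zero_of_cls_mem _ (boostForm_lowFil i) (boostForm_GEG i)
      (Submodule.smul_mem _ h (th0_sig_mem i)) hm
    rwa [boostForm, coefE_smul, ← boostForm, boostForm_boost, mul_one] at this
  · rintro rfl
    rw [mon, zero_smul, cls_zero]
    exact zero_mem _

lemma mon_rot_mem_iff (i : Fin 3) (h : R) :
    mon (e1 (i + 1) + e1 (i + 2)) h (el (th0 R) (sigR (i + 1) (i + 2))) ∈ (⨆ β, GAG R β 1) ↔
      h = 0 := by
  refine ⟨fun hm => ?_, ?_⟩
  · have := map_eq_zero_of_cls_mem _ (rotForm_lowFil i) (rotForm_GEG i)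
      (Submodule.smul_mem _ h (th0_sigR_mem i)) hm
    rw [rotForm_smul, rotForm_rot] at this
    have h2 : algebraMap ℝ R 2⁻¹ * 2 = 1 := by
      rw [← map_ofNat (algebraMap ℝ R) 2, ← map_mul, inv_mul_cancel₀ two_ne_zero, map_one]
    linear_combination (-algebraMap ℝ R 2⁻¹) * this - h * h2
  · rintro rfl
    rw [mon, zero_smul, cls_zero]
    exact zero_mem _

lemma mem_iff_of_sub_mem {M : Submodule R (AA R)} {u w : AA R} (h : u - w ∈ M) :
    u ∈ M ↔ w ∈ M := by
  refine ⟨fun hu => ?_, fun hw => ?_⟩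
  · have := sub_mem hu h
    rwa [sub_sub_cancel] at this
  · have := add_mem h hw
    rwa [sub_add_cancel] at this

/-- At index `e_j + e_k` one has `θ_iσ₀ ≡ -θ₀σ_i` modulo the gauge subspace. Differentiating `f`
gives `-D f θ₀σ_i`, the terms with `l = j, k` each give `γ_l f θ₀σ_i`, and the term with `l = i`
gives nothing. -/
lemma expAd_boost_mem_iff (i : Fin 3) (f : R) {γ : Fin 3 → R} (h : HasGamma0 D y γ) :
    expAd (mon (e1 (i + 1) + e1 (i + 2)) f (el 1 (sig i))) y ∈ affineGauge D ↔
      D f - (γ (i + 1) + γ (i + 2)) * f = 0 := by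
  have hv := expAd_mem_gaugePos (pair_ne_zero i) (sig_fst i) (boost_mem i) f
    (fun hβ f g _ hl => brE_sig_mem_gaugeFil i hβ f g hl) h
  have hs := fun r a => expAd_mon_smul (pair_ne_zero i) (sig_fst i) (boost_mem i) f r a
  have hrot : toE (el (th R (i + 1)) (sigR i (i + 1))) ∈ fil3 R (e1 (i + 1) + e1 (i + 2)) :=
    tableEntry_mem_fil3 (TableEntry.g011_f i)
  have hrot' : toE (el (th R (i + 2)) (sigR (i + 2) i)) ∈ fil3 R (e1 (i + 1) + e1 (i + 2)) :=
    tableEntry_mem_fil3 (TableEntry.g011_e i)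
  have hneg : toE (-el (th R (i + 2)) (sigR (i + 2) i)) ∈ fil3 R (e1 (i + 1) + e1 (i + 2)) := by
    rw [map_neg]; exact neg_mem hrot'
  rw [sum_cyclic _ i, mon_eq_smul _ (lS_mem i), mon_eq_smul _ (lS_mem (i + 1)),
    mon_eq_smul _ (lS_mem (i + 2)), map_add, map_sub, map_add, map_add, hs, hs, hs,
    expAd_boost_lD, expAd_boost_lS, expAd_boost_lS_add_one, expAd_boost_lS_add_two,
    sub_eq_add_neg (el (th R i) sig0), mon_add f (th_sig0_mem i) hrot,
    mon_add f (th_sig0_mem i) hneg, mon_neg f hrot', mon_add f (th0_sig_mem i) (th_sig0_mem i),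
    mon_eq_smul (D f) (th0_sig_mem i), mon_eq_smul f (th0_sig_mem i),
    mon_eq_smul f (th_sig0_mem i), mon_eq_smul f hrot, mon_eq_smul f hrot',
    mon_eq_smul f (tableEntry_mem_fil3 (TableEntry.g011_D i D))] at hv
  have hD := mon_mem_gauge_of_entry (1 : R) (TableEntry.g011_D i D)
  have hc := mon_mem_gauge_of_entry (1 : R) (TableEntry.g011_c i)
  have he := mon_mem_gauge_of_entry (1 : R) (TableEntry.g011_e i)
  have hf := mon_mem_gauge_of_entry (1 : R) (TableEntry.g011_f i)
  have hS := fun l => mon_mem_gauge_of_entry (1 : R) (TableEntry.g000_b l)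
  rw [mon_add 1 (th0_sig_mem i) (th_sig0_mem i)] at hc
  have key : expAd (mon (e1 (i + 1) + e1 (i + 2)) f (el 1 (sig i))) y - mon 0 1 (lD D) -
      mon (e1 (i + 1) + e1 (i + 2)) (-(D f - (γ (i + 1) + γ (i + 2)) * f))
        (el (th0 R) (sig i)) ∈ ⨆ β, GAG R β 1 := by
    rw [mon_eq_smul _ (th0_sig_mem i)]
    -- The multiple `(γ_j + γ_k)f` of `hc` trades the terms `θ_iσ₀` for `-θ₀σ_i`; the other summands
    -- remove gauge elements one by one.
    have := add_mem (sub_mem (sub_mem (sub_mem (sub_mem (sub_mem (sub_mem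
      (add_mem (gaugePos_le hv) (Submodule.smul_mem _ f hD))
      (Submodule.smul_mem _ (γ i) (hS i))) (Submodule.smul_mem _ (γ (i + 1)) (hS (i + 1))))
      (Submodule.smul_mem _ (γ (i + 2)) (hS (i + 2)))) (Submodule.smul_mem _ (γ i * f) hc))
      (Submodule.smul_mem _ ((γ (i + 1) + γ (i + 2)) * f) hc))
      (Submodule.smul_mem _ (γ (i + 1) * f) hf)) (Submodule.smul_mem _ (γ (i + 2) * f) he)
    convert this using 1
    simp only [lS]
    module
  rw [mem_affineGauge_iff, mem_iff_of_sub_mem key, mon_boost_mem_iff, neg_eq_zero]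

/-- The rotation changes the elements `θ₀σ₀ + θ_lσ_l` by gauge entries only. The functions `γ_l`
therefore drop out, and `-D f θ₀σ_{jk}` is the only obstruction. -/
lemma expAd_rot_mem_iff (i : Fin 3) (f : R) (hy : y ∈ affineGauge D) :
    expAd (mon (e1 (i + 1) + e1 (i + 2)) f (el 1 (sigR (i + 1) (i + 2)))) y ∈ affineGauge D ↔
      D f = 0 := by
  obtain ⟨γ, h⟩ := exists_hasGamma0 hy
  have hv := expAd_mem_gaugePos (pair_ne_zero i) (sigR_fst _ _) (rot_mem i) f
    (fun hβ f g _ hl => brE_sigR_mem_gaugeFil i hβ f g hl) h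
  have hs := fun r a => expAd_mon_smul (pair_ne_zero i) (sigR_fst _ _) (rot_mem i) f r a
  rw [sum_cyclic _ i, mon_eq_smul _ (lS_mem i), mon_eq_smul _ (lS_mem (i + 1)),
    mon_eq_smul _ (lS_mem (i + 2)), map_add, map_sub, map_add, map_add, hs, hs, hs,
    expAd_rot_lD, expAd_rot_lS, expAd_rot_lS_add_one, expAd_rot_lS_add_two,
    mon_eq_smul (D f) (th0_sigR_mem i),
    mon_eq_smul f (tableEntry_mem_fil3 (TableEntry.g011_d i))] at hv
  have hd := mon_mem_gauge_of_entry (1 : R) (TableEntry.g011_d i)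
  have hS := fun l => mon_mem_gauge_of_entry (1 : R) (TableEntry.g000_b l)
  have key : expAd (mon (e1 (i + 1) + e1 (i + 2)) f (el 1 (sigR (i + 1) (i + 2)))) y -
      mon 0 1 (lD D) - mon (e1 (i + 1) + e1 (i + 2)) (-D f)
        (el (th0 R) (sigR (i + 1) (i + 2))) ∈ ⨆ β, GAG R β 1 := by
    rw [mon_eq_smul _ (th0_sigR_mem i)]
    have := sub_mem (add_mem (sub_mem (sub_mem (sub_mem (gaugePos_le hv)
      (Submodule.smul_mem _ (γ i) (hS i))) (Submodule.smul_mem _ (γ (i + 1)) (hS (i + 1))))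
      (Submodule.smul_mem _ (γ (i + 2)) (hS (i + 2))))
      (Submodule.smul_mem _ (γ (i + 1) * f) hd)) (Submodule.smul_mem _ (γ (i + 2) * f) hd)
    convert this using 1
    simp only [lS]
    module
  rw [mem_affineGauge_iff, mem_iff_of_sub_mem key, mon_rot_mem_iff, neg_eq_zero]

lemma mon_mem_iSup_GA {α : Fin 3 →₀ ℕ} (hα : α ≠ 0) (f : R) {l : Lie R} (h : TableEntry α 0 l) :
    mon α f l ∈ ⨆ α, ⨆ _ : α ≠ 0, GA R α 0 :=
  le_iSup₂_of_le (f := fun γ (_ : γ ≠ 0) => GA R γ 0) α hα le_rfl (mon_mem_GA f h)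

/-- The automorphisms generated by `G_αA⁰` need not preserve the grading. -/
theorem exists_expAd_notMem [Nontrivial R] : ∃ x ∈ ⨆ α, ⨆ _ : α ≠ 0, GA R α 0, ∃ α,
    ∃ y ∈ ⨆ k, GA R α k, expAd x y ∉ ⨆ k, GA R α k := by
  -- The witnesses are `x = s₂s₃σ₁` and `y = θ₀σ₀ + θ₂σ₂`: the image of `y` acquires a component of
  -- index `011`, which `boostForm` sees.
  refine ⟨_, mon_mem_iSup_GA (pair_ne_zero 0) 1 (TableEntry.g011_a 0), 0, mon 0 1 (lS (0 + 1)),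
    Submodule.mem_iSup_of_mem 1 (mon_mem_GA 1 (TableEntry.g000_b _)), fun h => ?_⟩
  have key : ∀ a ∈ ⨆ k, GA R 0 k, coefA _ _ (boostForm_lowFil (R := R) 0) a = 0 := by
    intro a ha
    induction ha using Submodule.iSup_induction' with
    | zero => exact map_zero _
    | add x y _ _ hx hy => rw [map_add, hx, hy, add_zero]
    | mem k a ha =>
      obtain ⟨e, he, rfl⟩ := mem_GA.1 ha
      rw [coefA_cls _ (GE_le_fil3 0 k he), if_neg (pair_ne_zero 0)]
  have h1 := key _ h
  rw [expAd_boost_lS_add_one, map_add, mon, mon, one_smul, one_smul, coefA_cls _ (lS_mem _),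
    if_neg (pair_ne_zero 0), zero_add, coefA_cls, if_pos rfl, boostForm_dil, neg_eq_zero] at h1
  · exact one_ne_zero h1
  · rw [map_add]
    exact add_mem (th_sig0_mem 0) (tableEntry_mem_fil3 (TableEntry.g011_f 0))

end AffineGauge

/-! ### Smooth functions and the integrating factor. -/

section Smooth

open scoped Manifold ContDiff

variable {S : Type*} [TopologicalSpace S] [ChartedSpace (EuclideanSpace ℝ (Fin 3)) S]

instance [Nonempty S] : Nontrivial (Fun S) := by
  refine ⟨0, 1, fun h => ?_⟩
  have h1 := DFunLike.congr_fun h ((0 : ℝ), Classical.arbitrary S)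
  exact zero_ne_one (α := ℝ) h1

lemma expFun_mul_eq_zero (g h : Fun S) : expFun g * h = 0 ↔ h = 0 := by
  refine ⟨fun e => ?_, fun e => by rw [e, mul_zero]⟩
  ext p
  have h1 : Real.exp (g p) * h p = 0 := DFunLike.congr_fun e p
  exact (mul_eq_zero.1 h1).resolve_left (Real.exp_ne_zero _)

variable [IsManifold (𝓡 3) ∞ S]

lemma D0_expFun (g : Fun S) : D0 S (expFun g) = expFun g * D0 S g := by
  ext p
  exact (slice_diff g p).hasDerivAt.exp.deriv

/-- The exponential is an integrating factor: it turns the linear equation for `f` into the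
vanishing of a single derivative, and it has no zeros. -/
lemma D0_expFun_mul_eq_zero_iff (μ ν f : Fun S) : D0 S (expFun (-μ - ν) * f) = 0 ↔
    D0 S f - (D0 S μ + D0 S ν) * f = 0 := by
  have h : D0 S (expFun (-μ - ν) * f) =
      expFun (-μ - ν) * (D0 S f - (D0 S μ + D0 S ν) * f) := by
    rw [Derivation.leibniz, D0_expFun, map_sub, map_neg, smul_eq_mul, smul_eq_mul]
    ring
  rw [h, expFun_mul_eq_zero]

end Smooth

end BKL

/-! ### The theorem. -/

open BKL
open scoped Manifold ContDiff
theorem mainTheorem9 {S : Type*} [TopologicalSpace S]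
    [ChartedSpace (EuclideanSpace ℝ (Fin 3)) S] [IsManifold (𝓡 3) ∞ S]
    (hS : Nonempty (S ≃ₘ^∞⟮𝓡 3, 𝓡 3⟯ EuclideanSpace ℝ (Fin 3))) :
    -- the pieces of the table lie in the filtration, so that `s^α G_αE` has a class in `A`
    (∀ α k, GE (Fun S) α k ≤ fil3 (Fun S) α) ∧
    -- every `x` in the sum of the `G_αA⁰` with `α ≠ 000` generates a nilpotent automorphism of `A`
    -- that is induced by an automorphism of `P`
    (∀ x ∈ ⨆ α, ⨆ _ : α ≠ 0, GA (Fun S) α 0,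
      IsNilpotent (brA x : Module.End ℝ (AA (Fun S))) ∧ IsAutA (expAd x) ∧
      ∃ Φ : PP (Fun S) ≃ₗ[MvPowerSeries (Fin 3) ℝ] PP (Fun S),
        IsAutP Φ ∧ ∀ p, toA (Φ p) = expAd x (toA p)) ∧
    -- such an automorphism need not preserve the `α`-grading
    (∃ x ∈ ⨆ α, ⨆ _ : α ≠ 0, GA (Fun S) α 0, ∃ α, ∃ y ∈ ⨆ k, GA (Fun S) α k,
      expAd x y ∉ ⨆ k, GA (Fun S) α k) ∧
    -- the functions `γ_i⁰` of an element of the affine gauge subspace are well-defined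
    (∀ y ∈ affineGauge (D0 S), ∃! γ : Fin 3 → Fun S, HasGamma0 (D0 S) y γ) ∧
    -- the automorphisms (i)
    (∀ (f : Fun S) (i j k : Fin 3), j = i + 1 → k = i + 2 →
      ∀ x, x = mon (e1 j + e1 k) f (el 1 (sig i)) →
      x ∈ ⨆ α, ⨆ _ : α ≠ 0, GA (Fun S) α 0 ∧
      (∀ (g : Fun S) (a : AA (Fun S)), expAd x (g • a) = g • expAd x a) ∧
      expAd x (mon 0 1 (lD (D0 S))) =
        mon 0 1 (lD (D0 S)) -
          mon (e1 j + e1 k) (D0 S f) (el (th0 _) (sig i)) +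
          mon (e1 j + e1 k) f (el (th _ i) (inj (D0 S))) ∧
      expAd x (mon 0 1 (lS i)) =
        mon 0 1 (lS i) +
          mon (e1 j + e1 k) f (el (th0 _) (sig i) + el (th _ i) sig0) ∧
      expAd x (mon 0 1 (lS j)) =
        mon 0 1 (lS j) +
          mon (e1 j + e1 k) f (el (th _ i) sig0 + el (th _ j) (sigR i j)) ∧
      expAd x (mon 0 1 (lS k)) =
        mon 0 1 (lS k) +
          mon (e1 j + e1 k) f (el (th _ i) sig0 - el (th _ k) (sigR k i)) ∧
      ∀ y ∈ affineGauge (D0 S), ∀ γ : Fin 3 → Fun S, HasGamma0 (D0 S) y γ →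
        (expAd x y ∈ affineGauge (D0 S) ↔ D0 S f - (γ j + γ k) * f = 0) ∧
        ∀ μ : Fin 3 → Fun S, (∀ l, D0 S (μ l) = γ l) →
          (expAd x y ∈ affineGauge (D0 S) ↔ D0 S (expFun (-μ j - μ k) * f) = 0)) ∧
    -- the automorphisms (ii)
    (∀ (f : Fun S) (i j k : Fin 3), j = i + 1 → k = i + 2 →
      ∀ x, x = mon (e1 j + e1 k) f (el 1 (sigR j k)) →
      x ∈ ⨆ α, ⨆ _ : α ≠ 0, GA (Fun S) α 0 ∧
      (∀ (g : Fun S) (a : AA (Fun S)), expAd x (g • a) = g • expAd x a) ∧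
      expAd x (mon 0 1 (lD (D0 S))) =
        mon 0 1 (lD (D0 S)) -
          mon (e1 j + e1 k) (D0 S f) (el (th0 _) (sigR j k)) ∧
      expAd x (mon 0 1 (lS i)) =
        mon 0 1 (lS i) ∧
      expAd x (mon 0 1 (lS j)) =
        mon 0 1 (lS j) -
          mon (e1 j + e1 k) f (el (th _ j) (sig k) + el (th _ k) (sig j)) ∧
      expAd x (mon 0 1 (lS k)) =
        mon 0 1 (lS k) +
          mon (e1 j + e1 k) f (el (th _ j) (sig k) + el (th _ k) (sig j)) ∧
      ∀ y ∈ affineGauge (D0 S),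
        (expAd x y ∈ affineGauge (D0 S) ↔ D0 S f = 0)) := by
  obtain ⟨φ⟩ := hS
  -- A point of `S` gives `0 ≠ 1` in `C^∞`, without which every automorphism would trivially
  -- preserve the grading.
  have : Nonempty S := ⟨φ.symm 0⟩
  refine ⟨GE_le_fil3, fun x hx => isAutA_of_mem_GA hx, exists_expAd_notMem, fun y hy => ?_, ?_, ?_⟩
  · obtain ⟨γ, h⟩ := exists_hasGamma0 hy
    exact ⟨γ, h, fun γ' h' => hasGamma0_unique h' h⟩
  · rintro f i _ _ rfl rfl _ rfl
    refine ⟨mon_mem_iSup_GA (pair_ne_zero i) f (TableEntry.g011_a i),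
      expAd_mon_smul (pair_ne_zero i) (sig_fst i) (boost_mem i) f, expAd_boost_lD i f _,
      expAd_boost_lS i f, expAd_boost_lS_add_one i f, expAd_boost_lS_add_two i f,
      fun y hy γ h => ⟨expAd_boost_mem_iff i f h, fun μ hμ => ?_⟩⟩
    rw [expAd_boost_mem_iff i f h, D0_expFun_mul_eq_zero_iff, hμ, hμ]
  · rintro f i _ _ rfl rfl _ rfl
    exact ⟨mon_mem_iSup_GA (pair_ne_zero i) f (TableEntry.g011_b i),
      expAd_mon_smul (pair_ne_zero i) (sigR_fst _ _) (rot_mem i) f, expAd_rot_lD i f _,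
      expAd_rot_lS i f, expAd_rot_lS_add_one i f, expAd_rot_lS_add_two i f,
      fun y hy => expAd_rot_mem_iff i f hy⟩
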